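/- Let $k\in\mathbb N$ and let $V,W\in C^3(\mathbb R^k)$. Assume that $V$ has a local minimum at $0$ with $V(0)=0$, and that, with operator norms of multilinear forms, $$L=\sup\|D^2V\|,\quad \tilde L=\sup\|D^2W\|,\quad L_H=\sup\|D^3V\|,\quad \tilde L_H=\sup\|D^3W\|$$ are finite. Assume that there are constants $\mathcal R\in[0,\infty)$ and $K\in(0,\infty)$ such that $(x-y)\cdot(\nabla V(x)-\nabla V(y))\ge K|x-y|^2$ for all $x,y\in\mathbb R^k$ with $|x-y|\ge\mathcal R$. Let $T>0$, $\epsilon\ge 0$ and $h_1\ge 0$ satisfy $$L(T+h_1)^2\le\tfrac35\min\Big(\tfrac{3K}{10L},\tfrac14,\tfrac{3K}{256\cdot5\cdot2^6\,L\mathcal R^2(L+K)}\Big),\qquad h_1\le\frac{KT}{525L+235K},$$ $$|\epsilon|\tilde L<\min\Big(\tfrac K6,\ \tfrac12\Big(\tfrac{K}{36\cdot149}\Big)^2\Big(T+8\mathcal R\sqrt{\tfrac{L+K}{K}}\Big)^2\exp\Big(-40\tfrac{\mathcal R}{T}\sqrt{\tfrac{L+K}{K}}\Big)\Big)$$ (a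 quotient with denominator $0$ is read as $+\infty$), and let $h\in(0,h_1]$ satisfy $T/h\in\mathbb N$ and $(L+4\epsilon\tilde L)(T^2+Th)\le 1/6$. Set $$M=\exp\Big(\tfrac52\Big(1+\tfrac{4\mathcal R}{T}\sqrt{\tfrac{L+K}{K}}\Big)\Big),\qquad c=\frac{KT^2}{156}\exp\Big(-10\tfrac{\mathcal R}{T}\sqrt{\tfrac{L+K}{K}}\Big).$$ For $n\ge1$ let $U(x)=\sum_{i=1}^n\big(V(x^i)+\frac{\epsilon}{n}\sum_{\ell\ne i}W(x^i-x^\ell)\big)$ for $x=(x^1,\dots,x^n)\in\mathbb R^{nk}$, and let $\tilde\pi=\tilde\pi_n$ be the transition kernel of unadjusted Hamiltonian Monte Carlo for $U$: from $x$ the chain moves to the position $\tilde q_T(x,\xi)$ obtained by $T/h$ velocity Verlet steps $$q'=q+hv-\tfrac{h^2}{2}\nabla U(q),\qquad v'=v-\tfrac h2\big(\nabla U(q)+\nabla U(q')\big)$$ started at $(x,\xi)$, where $\xi\sim\mathcal N(0,I_{nk})$. Let $\boldsymbol W^1_{\ell_1}$ be the $L^1$-Wasserstein distance for the metric $\ell_1(x,y)=\sum_{i=1}^n|x^i-y^i|$,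 with values in $[0,\infty]$, let $\mathrm{TV}(\nu,\eta)=\sup_A|\nu(A)-\eta(A)|$, and for an invariant probability measure $\tilde\mu$ of $\tilde\pi$ let $t_{\mathrm{mix}}(\varepsilon,\nu)=\inf\{m\ge0:\mathrm{TV}(\tilde\mu,\nu\tilde\pi^m)\le\varepsilon\}$. (i) For every $n\ge1$, $\tilde\pi$ has exactly one invariant probability measure $\tilde\mu$, and for all $\varepsilon>0$ and all probability measures $\nu$ on $\mathbb R^{nk}$, $$t_{\mathrm{mix}}(\varepsilon,\nu)\le\max\bigg\{1,\ 2+\frac1c\log\bigg(\frac{3\big(T^{-2}+34\,k\,(L_H+8\epsilon\tilde L_H)^2T^4\big)^{1/2}M\,\boldsymbol W^1_{\ell_1}(\tilde\mu,\nu)}{2\varepsilon}\bigg)\bigg\},$$ where $\log 0=-\infty$ and $\log\infty=\infty$. (ii) Consequently the mixing time depends at most logarithmically on the number of particles whenever $\boldsymbol W^1_{\ell_1}(\tilde\mu,\nu)$ grows at most polynomially in $n$: with $k,V,W,\epsilon,T,h$ fixed, for all $\varepsilon>0$, $B\in\mathbb R$ and $p\in\mathbb N_0$ there is a constant $C$ such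 that $t_{\mathrm{mix}}(\varepsilon,\nu)\le C(1+\log n)$ for every $n\ge1$ and every probability measure $\nu$ on $\mathbb R^{nk}$ with $\boldsymbol W^1_{\ell_1}(\tilde\mu,\nu)\le B\,n^p$. -/

import Mathlib

open MeasureTheory ProbabilityTheory
open scoped ENNReal

noncomputable section

namespace UHMC

section Distances

variable {E : Type*} [MeasurableSpace E]

/-- Total variation distance between two probability measures:
the supremum of `|ν(A) - η(A)|` over all measurable sets `A`. -/
def tvDist (ν η : Measure E) : ℝ :=
  ⨆ A : {A : Set E // MeasurableSet A}, |ν.real A.1 - η.real A.1|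

/-- The couplings of `ν` and `η`: measures on the product with marginals `ν` and `η`. -/
def couplings (ν η : Measure E) : Set (Measure (E × E)) :=
  {γ | γ.fst = ν ∧ γ.snd = η}

/-- The `L¹`-Wasserstein distance with respect to a distance function `d`
(it may be infinite). -/
def wasserstein1 (d : E → E → ℝ) (ν η : Measure E) : ℝ≥0∞ :=
  ⨅ γ ∈ couplings ν η, ∫⁻ p, ENNReal.ofReal (d p.1 p.2) ∂γ

/-- The law `ν πᵐ` after `m` steps of the Markov chain with kernel `π` and initial law `ν`. -/
def lawAfter (π : Kernel E E) (ν : Measure E) (m : ℕ) : Measure E :=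
  (fun ρ : Measure E => ρ.bind π)^[m] ν

/-- The mixing time `inf {m ≥ 0 : TV(μ, ν πᵐ) ≤ tol}`, which is `⊤` if there is no such `m`. -/
def mixingTime (π : Kernel E E) (μ : Measure E) (tol : ℝ) (ν : Measure E) : ℕ∞ :=
  ⨅ (m : ℕ) (_ : tvDist μ (lawAfter π ν m) ≤ tol), (m : ℕ∞)

end Distances

section Chain

variable {E : Type*} [NormedAddCommGroup E] [InnerProductSpace ℝ E] [FiniteDimensional ℝ E]

/-- One step of the velocity Verlet integrator with step size `h` for the potential `U`:
`q' = q + h v - (h²/2) ∇U(q)`, `v' = v - (h/2) (∇U(q) + ∇U(q'))`. -/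
def verletStep (U : E → ℝ) (h : ℝ) (p : E × E) : E × E :=
  let q' := p.1 + h • p.2 - (h ^ 2 / 2) • gradient U p.1
  (q', p.2 - (h / 2) • (gradient U p.1 + gradient U q'))

/-- The position `q̃_T(x, v)` at time `T = N h` of velocity Verlet started at `(x, v)`. -/
def verletPosition (U : E → ℝ) (h : ℝ) (N : ℕ) (x v : E) : E :=
  ((verletStep U h)^[N] (x, v)).1

theorem continuous_gradient {U : E → ℝ} (hU : ContDiff ℝ 1 U) : Continuous (gradient U) :=
  (InnerProductSpace.toDual ℝ E).symm.continuous.comp (hU.continuous_fderiv one_ne_zero)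

theorem continuous_verletPosition {U : E → ℝ} (hU : ContDiff ℝ 1 U) (h : ℝ) (N : ℕ) :
    Continuous (fun p : E × E => verletPosition U h N p.1 p.2) := by
  have hg := continuous_gradient hU
  have hs : Continuous (verletStep U h) := by
    unfold verletStep
    fun_prop
  exact continuous_fst.comp (hs.iterate N)

variable [MeasurableSpace E] [BorelSpace E]

/-- The transition kernel of unadjusted Hamiltonian Monte Carlo with step size `h` and duration
`T = N h`: from `x` the chain moves to `q̃_T(x, ξ)`, where `ξ` is a standard Gaussian vector. -/
def uhmcKernel (U : E → ℝ) (h : ℝ) (N : ℕ) : Kernel E E :=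
  (Kernel.id ×ₖ Kernel.const E (stdGaussian E)).map
    (fun p : E × E => verletPosition U h N p.1 p.2)

/-- For a continuously differentiable potential, `uhmcKernel U h N x` is the law of
`q̃_T(x, ξ)`. -/
theorem uhmcKernel_apply {U : E → ℝ} (hU : ContDiff ℝ 1 U) (h : ℝ) (N : ℕ) (x : E) :
    uhmcKernel U h N x = (stdGaussian E).map (verletPosition U h N x) := by
  have hm := (continuous_verletPosition hU h N).measurable
  rw [uhmcKernel, Kernel.map_apply _ hm, Kernel.prod_apply, Kernel.id_apply, Kernel.const_apply,
    Measure.dirac_prod, Measure.map_map hm measurable_prodMk_left]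
  rfl

end Chain

/-- The configuration space `ℝ^{nk}` of `n` particles in `ℝᵏ` with its Euclidean structure;
`x i` is the `i`-th particle. -/
abbrev Config (n k : ℕ) : Type := PiLp 2 (fun _ : Fin n => EuclideanSpace ℝ (Fin k))

/-- The metric `ℓ₁(x, y) = ∑ᵢ |xⁱ - yⁱ|` on configurations. -/
def ell1 {n k : ℕ} (x y : Config n k) : ℝ := ∑ i, ‖x i - y i‖

/-- The mean-field potential energy
`U(x) = ∑ᵢ (V(xⁱ) + (ε/n) ∑_{ℓ ≠ i} W(xⁱ - xˡ))`. -/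
def meanFieldPotential {k : ℕ} (V W : EuclideanSpace ℝ (Fin k) → ℝ) (ε : ℝ) (n : ℕ)
    (x : Config n k) : ℝ :=
  ∑ i, (V (x i) + ε / n * ∑ l ∈ Finset.univ.erase i, W (x i - x l))

/-- The transition kernel of unadjusted Hamiltonian Monte Carlo for the mean-field model with
`n` particles. -/
def meanFieldKernel {k : ℕ} (V W : EuclideanSpace ℝ (Fin k) → ℝ) (ε h : ℝ) (N n : ℕ) :
    Kernel (Config n k) (Config n k) :=
  uhmcKernel (meanFieldPotential V W ε n) h N

/-- The constant `M = exp((5/2) (1 + (4 R / T) √((L + K) / K)))`. -/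
def contractionPrefactor (K L R T : ℝ) : ℝ :=
  Real.exp (5 / 2 * (1 + 4 * R / T * √((L + K) / K)))

/-- The rate `c = (K T² / 156) exp(-10 (R / T) √((L + K) / K))`. -/
def contractionRate (K L R T : ℝ) : ℝ :=
  K * T ^ 2 / 156 * Real.exp (-10 * (R / T) * √((L + K) / K))

end UHMC

end

/-! Two properties of a single transition step carry the theorem, both with constants that do not
depend on `n`: the step maps bounded functions to `ell1`-Lipschitz functions, and it contracts a
distance `profileDist` equivalent to `ell1`. Let f_m(x) be the probability of being in A after m
steps from x (`iterProb`). Regularization makes f_1 Lipschitz for `ell1` with a constant s, hence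
for `profileDist` with constant s M. Each further step multiplies this constant by exp(-c), so
f_{m+1} is s M exp(-c m)-Lipschitz for `ell1`. Integrating against couplings gives TV ≤ s M exp(-c
m) W₁ after m + 1 steps, and solving for m gives the mixing time. The same estimate makes the laws
started at a point uniformly Cauchy, which yields the invariant measure. The argument iterates
functions rather than coupled chains, so couplings are needed only for one fixed pair of points and
no measurable selection occurs.

Regularization (`HessianBounds.uhmcKernel_sub_le`): a perturbation e of the starting point is
cancelled at time T by a change u(ξ) of the velocity. The derivative of the mean of g(q_T(x, ξ))
along e is therefore minus a derivative in ξ along u, and Gaussian integration by parts moves it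
onto the divergence of u. The mean square of that divergence is at most sup |u|² plus the squared
Hilbert-Schmidt norm of Du. Since u is Lipschitz from the sup-norm over particles to `ell1`, the
latter is controlled by the value of Du on one vector of signs, whose sup-norm is √k; hence k and
not n k enters.

Contraction (`MeanFieldBounds.integral_meanFieldKernel_sub_le`): the velocities are coupled
independently for each particle. Let S = R √((L + K) / K). Coinciding particles and particles at
distance at least 4 S get the same velocity, and in the distant case convexity at infinity brings
them together. Other particles get velocities that differ by -γ z with maximal probability and are
reflected otherwise; the concave `profile` makes the gain on success outweigh the loss on failure.
The interaction is a perturbation whose sum over the particles is proportional to the summed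
distances, and smallness of ε L' absorbs it. -/

noncomputable section

set_option linter.unusedSectionVars false

namespace UHMC

/-! ### Gaussian density, shifts and integration by parts -/

section Gaussian

variable {E : Type*} [NormedAddCommGroup E] [InnerProductSpace ℝ E] [FiniteDimensional ℝ E]
  [MeasurableSpace E] [BorelSpace E]

/-- The density of the standard Gaussian measure with respect to the volume. -/
def gaussDensity (E : Type*) [NormedAddCommGroup E] [InnerProductSpace ℝ E] [FiniteDimensional ℝ E]
    [MeasurableSpace E] [BorelSpace E] (x : E) : ℝ :=
  (∫ y : E, Real.exp (-(1 / 2) * ‖y‖ ^ 2))⁻¹ * Real.exp (-(1 / 2) * ‖x‖ ^ 2)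

theorem continuous_gaussDensity : Continuous (gaussDensity E) := by
  unfold gaussDensity
  fun_prop

theorem integral_exp_sq_norm_pos : 0 < ∫ y : E, Real.exp (-(1 / 2) * ‖y‖ ^ 2) := by
  rw [GaussianFourier.integral_rexp_neg_mul_sq_norm (by norm_num)]
  positivity

theorem gaussDensity_pos (x : E) : 0 < gaussDensity E x :=
  mul_pos (inv_pos.2 integral_exp_sq_norm_pos) (Real.exp_pos _)

/-- Both measures are finite and have the same characteristic function; the Fourier transform of the
density is an explicit Gaussian integral. -/
theorem stdGaussian_eq_withDensity :
    stdGaussian E = (volume : Measure E).withDensity (fun x => ENNReal.ofReal (gaussDensity E x)) := by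
  have hm : Measurable (fun x : E => ENNReal.ofReal (gaussDensity E x)) :=
    continuous_gaussDensity.measurable.ennreal_ofReal
  have hint : Integrable (gaussDensity E) := by
    unfold gaussDensity
    refine Integrable.const_mul ?_ _
    -- A non-integrable function would have integral `0`, but the normalizing integral is positive.
    by_contra hc
    have := integral_exp_sq_norm_pos (E := E)
    rw [integral_undef hc] at this
    exact lt_irrefl _ this
  have hfin : IsFiniteMeasure
      ((volume : Measure E).withDensity (fun x => ENNReal.ofReal (gaussDensity E x))) :=
    isFiniteMeasure_withDensity_ofReal hint.2
  refine Measure.ext_of_charFun (E := E) ?_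
  ext t
  rw [charFun_stdGaussian, charFun_apply,
    integral_withDensity_eq_integral_toReal_smul hm (by simp)]
  have h1 : ∀ x : E, (ENNReal.ofReal (gaussDensity E x)).toReal •
      Complex.exp (inner ℝ x t * Complex.I) =
      ((∫ y : E, Real.exp (-(1 / 2) * ‖y‖ ^ 2) : ℝ) : ℂ)⁻¹ *
        Complex.exp (-(1 / 2 : ℂ) * ‖x‖ ^ 2 + Complex.I * inner ℝ t x) := by
    intro x
    rw [ENNReal.toReal_ofReal (gaussDensity_pos x).le, gaussDensity, Complex.real_smul,
      Complex.exp_add, real_inner_comm]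
    push_cast
    ring_nf
  simp_rw [h1]
  rw [integral_const_mul,
    GaussianFourier.integral_cexp_neg_mul_sq_norm_add (by norm_num),
    GaussianFourier.integral_rexp_neg_mul_sq_norm (by norm_num)]
  rw [← mul_assoc]
  have h2 : ((((Real.pi / (1 / 2)) ^ ((Module.finrank ℝ E : ℝ) / 2) : ℝ) : ℂ))⁻¹ *
      ((Real.pi : ℂ) / (1 / 2)) ^ ((Module.finrank ℝ E : ℂ) / 2) = 1 := by
    rw [Complex.ofReal_cpow (by positivity)]
    push_cast
    rw [inv_mul_cancel₀]
    have : ((Real.pi : ℂ) / (1 / 2)) ≠ 0 := by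
      simp [Real.pi_ne_zero]
    simp [Complex.cpow_eq_zero_iff, Real.pi_ne_zero]
  rw [h2, one_mul, Complex.I_sq]
  congr 1
  ring

theorem integral_stdGaussian (f : E → ℝ) :
    ∫ x, f x ∂stdGaussian E = ∫ x, gaussDensity E x * f x := by
  rw [stdGaussian_eq_withDensity, integral_withDensity_eq_integral_toReal_smul
    continuous_gaussDensity.measurable.ennreal_ofReal (by simp)]
  simp [ENNReal.toReal_ofReal (gaussDensity_pos _).le]

theorem integrable_stdGaussian_iff (f : E → ℝ) :
    Integrable f (stdGaussian E) ↔ Integrable (fun x => gaussDensity E x * f x) := by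
  rw [stdGaussian_eq_withDensity, integrable_withDensity_iff_integrable_smul'
    continuous_gaussDensity.measurable.ennreal_ofReal (by simp)]
  simp [ENNReal.toReal_ofReal (gaussDensity_pos _).le]

/-- The Cameron-Martin formula for the standard Gaussian measure. -/
theorem lintegral_stdGaussian_add {g : E → ℝ≥0∞} (hg : Measurable g) (v : E) :
    ∫⁻ x, g (x + v) ∂stdGaussian E =
      ∫⁻ x, ENNReal.ofReal (Real.exp (inner ℝ v x - ‖v‖ ^ 2 / 2)) * g x ∂stdGaussian E := by
  have hm := (continuous_gaussDensity (E := E)).measurable.ennreal_ofReal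
  rw [stdGaussian_eq_withDensity, lintegral_withDensity_eq_lintegral_mul _ hm (by fun_prop),
    lintegral_withDensity_eq_lintegral_mul _ hm (by fun_prop)]
  conv_rhs => rw [← lintegral_add_right_eq_self (μ := (volume : Measure E)) _ v]
  refine lintegral_congr fun x => ?_
  simp only [Pi.mul_apply]
  rw [← mul_assoc, ← ENNReal.ofReal_mul (gaussDensity_pos _).le]
  congr 2
  rw [gaussDensity, gaussDensity, mul_assoc, ← Real.exp_add, norm_add_sq_real, inner_add_right,
    real_inner_comm, real_inner_self_eq_norm_sq]
  congr 2
  ring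

theorem hasFDerivAt_gaussDensity (x : E) :
    HasFDerivAt (gaussDensity E) (-(gaussDensity E x) • innerSL ℝ x) x := by
  have h := ((((hasStrictFDerivAt_norm_sq x).hasFDerivAt.const_mul (-(1 / 2) : ℝ)).exp).const_mul
    ((∫ y : E, Real.exp (-(1 / 2) * ‖y‖ ^ 2))⁻¹))
  refine h.congr_fderiv ?_
  ext v
  simp [gaussDensity]
  ring

/-- Gaussian integration by parts. -/
theorem integral_stdGaussian_inner_mul {G : E → ℝ} (e : E) (hG : Differentiable ℝ G)
    (h0 : Integrable G (stdGaussian E))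
    (h1 : Integrable (fun x => fderiv ℝ G x e) (stdGaussian E))
    (h2 : Integrable (fun x => inner ℝ e x * G x) (stdGaussian E)) :
    ∫ x, inner ℝ e x * G x ∂stdGaussian E = ∫ x, fderiv ℝ G x e ∂stdGaussian E := by
  rw [integrable_stdGaussian_iff] at h0 h1 h2
  rw [integral_stdGaussian, integral_stdGaussian]
  have hf : ∀ x : E, fderiv ℝ (gaussDensity E) x e * G x =
      -(gaussDensity E x * (inner ℝ e x * G x)) := by
    intro x
    rw [(hasFDerivAt_gaussDensity x).fderiv]
    simp [real_inner_comm]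
    ring
  rw [integral_mul_fderiv_eq_neg_fderiv_mul_of_integrable (f := gaussDensity E) (g := G) (v := e)
    (by simp_rw [hf]; exact h2.neg) h1 h0
    (fun x _ => (hasFDerivAt_gaussDensity x).differentiableAt) (fun x _ => hG x)]
  simp_rw [hf, integral_neg, neg_neg]

end Gaussian

/-! ### Reflection coupling of Gaussian velocities -/

section Reflection

variable {E : Type*} [NormedAddCommGroup E] [InnerProductSpace ℝ E] [FiniteDimensional ℝ E]
  [MeasurableSpace E] [BorelSpace E]

theorem integrable_norm_stdGaussian : Integrable (fun x : E => ‖x‖) (stdGaussian E) :=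
  (IsGaussian.integrable_id (μ := stdGaussian E)).norm

theorem integrable_inner_stdGaussian (e : E) :
    Integrable (fun x : E => inner ℝ e x) (stdGaussian E) :=
  (IsGaussian.integrable_id (μ := stdGaussian E)).const_inner e

theorem integrable_norm_sq_stdGaussian : Integrable (fun x : E => ‖x‖ ^ 2) (stdGaussian E) :=
  (IsGaussian.memLp_two_id (μ := stdGaussian E)).integrable_norm_pow two_ne_zero

theorem integrable_inner_sq_stdGaussian (e : E) :
    Integrable (fun x : E => inner ℝ e x ^ 2) (stdGaussian E) := by
  refine (integrable_norm_sq_stdGaussian.const_mul (‖e‖ ^ 2)).mono'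
    (by fun_prop) (Filter.Eventually.of_forall fun x => ?_)
  rw [Real.norm_eq_abs, abs_of_nonneg (sq_nonneg _), ← mul_pow, ← sq_abs]
  exact pow_le_pow_left₀ (abs_nonneg _) (abs_real_inner_le_norm e x) 2

theorem integral_inner_stdGaussian (e : E) : ∫ x, inner ℝ e x ∂stdGaussian E = 0 :=
  integral_strongDual_stdGaussian (innerSL ℝ e)

theorem integral_inner_sq_stdGaussian (e : E) :
    ∫ x, inner ℝ e x ^ 2 ∂stdGaussian E = ‖e‖ ^ 2 := by
  have h1 : ∀ x : E, fderiv ℝ (fun x : E => inner ℝ e x) x e = ‖e‖ ^ 2 := by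
    intro x
    rw [show (fun x : E => inner ℝ e x) = innerSL ℝ e from rfl, ContinuousLinearMap.fderiv]
    simp
  have h2 : ∀ x : E, inner ℝ e x * inner ℝ e x = inner ℝ e x ^ 2 := fun x => (sq _).symm
  have := integral_stdGaussian_inner_mul (E := E) (G := fun x => inner ℝ e x) e
    (innerSL ℝ e).differentiable (integrable_inner_stdGaussian e)
    (by simp_rw [h1]; exact integrable_const _)
    (by simp_rw [h2]; exact integrable_inner_sq_stdGaussian e)
  simp_rw [h1, h2] at this
  simpa using this

theorem integral_abs_inner_stdGaussian_le {e : E} (he : ‖e‖ = 1) :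
    ∫ x, |inner ℝ e x| ∂stdGaussian E ≤ 1 := by
  have h : ∫ x, |inner ℝ e x| ∂stdGaussian E ≤
      ∫ x, (1 / 2 + 1 / 2 * inner ℝ e x ^ 2) ∂stdGaussian E := by
    refine integral_mono (integrable_inner_stdGaussian e).abs
      ((integrable_const _).add ((integrable_inner_sq_stdGaussian e).const_mul _)) fun x => ?_
    have := sq_nonneg (|inner ℝ e x| - 1)
    have h2 := sq_abs (inner ℝ e x)
    simp only
    nlinarith
  rw [integral_add (integrable_const _) ((integrable_inner_sq_stdGaussian e).const_mul _),
    integral_const_mul, integral_inner_sq_stdGaussian, he] at h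
  simpa using h.trans (by norm_num)

/-- The integrand is odd and the Gaussian is symmetric. This halves the leading term in
`integral_reflection_abs_le`. -/
theorem integral_abs_mul_inner_stdGaussian (e : E) :
    ∫ x, |inner ℝ e x| * inner ℝ e x ∂stdGaussian E = 0 := by
  have h : ∫ x, |inner ℝ e x| * inner ℝ e x ∂stdGaussian E =
      ∫ x, |inner ℝ e (-x)| * inner ℝ e (-x) ∂stdGaussian E := by
    conv_lhs => rw [← stdGaussian_map (LinearIsometryEquiv.neg ℝ (E := E))]
    rw [integral_map (by fun_prop) (by fun_prop)]
    rfl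
  simp only [inner_neg_right, abs_neg, mul_neg, integral_neg] at h
  linarith

/-- The ratio `φ(x + a e) / φ(x)` of shifted Gaussian densities. -/
def shiftRatio (e : E) (a : ℝ) (x : E) : ℝ := Real.exp (-a * inner ℝ e x - a ^ 2 / 2)

theorem shiftRatio_pos (e : E) (a : ℝ) (x : E) : 0 < shiftRatio e a x := Real.exp_pos _

theorem continuous_shiftRatio (e : E) (a : ℝ) : Continuous (shiftRatio e a) := by
  unfold shiftRatio
  fun_prop

/-- The coupling of two standard Gaussian vectors which differ by `a e` with maximal probability
and are reflected to each other otherwise. -/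
def reflectionCoupling (e : E) (a : ℝ) : Measure (E × E) :=
  ((stdGaussian E).withDensity fun x => ENNReal.ofReal (min 1 (shiftRatio e a x))).map
      (fun x => (x, x + a • e)) +
    ((stdGaussian E).withDensity fun x => ENNReal.ofReal (1 - shiftRatio e a x)).map
      (fun x => (x, x - (2 * inner ℝ e x) • e))

theorem lintegral_reflectionCoupling (e : E) (a : ℝ) {g : E × E → ℝ≥0∞} (hg : Measurable g) :
    ∫⁻ p, g p ∂reflectionCoupling e a =
      ∫⁻ x, ENNReal.ofReal (min 1 (shiftRatio e a x)) * g (x, x + a • e) ∂stdGaussian E +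
      ∫⁻ x, ENNReal.ofReal (1 - shiftRatio e a x) * g (x, x - (2 * inner ℝ e x) • e)
        ∂stdGaussian E := by
  have h0 := (continuous_shiftRatio e a).measurable
  rw [reflectionCoupling, lintegral_add_measure, lintegral_map hg (by fun_prop),
    lintegral_map hg (by fun_prop), lintegral_withDensity_eq_lintegral_mul _ (by fun_prop)
      (by fun_prop), lintegral_withDensity_eq_lintegral_mul _ (by fun_prop) (by fun_prop)]
  rfl

/-- `ENNReal.ofReal` truncates at zero, so the second density in `reflectionCoupling` is a positive
part and complements the first one to total density one. -/
theorem ofReal_min_one_add_ofReal_one_sub {t : ℝ} (ht : 0 ≤ t) :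
    ENNReal.ofReal (min 1 t) + ENNReal.ofReal (1 - t) = 1 := by
  rcases le_total 1 t with h | h
  · rw [min_eq_left h, ENNReal.ofReal_of_nonpos (by linarith : 1 - t ≤ 0)]
    simp
  · rw [min_eq_right h, ← ENNReal.ofReal_add ht (by linarith)]
    simp

theorem reflectionCoupling_fst (e : E) (a : ℝ) :
    (reflectionCoupling e a).fst = stdGaussian E := by
  refine Measure.ext_of_lintegral _ fun g hg => ?_
  have h0 := (continuous_shiftRatio e a).measurable
  rw [Measure.fst, lintegral_map hg measurable_fst,
    lintegral_reflectionCoupling e a (by fun_prop), ← lintegral_add_left (by fun_prop)]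
  refine lintegral_congr fun x => ?_
  rw [← add_mul, ofReal_min_one_add_ofReal_one_sub (shiftRatio_pos e a x).le, one_mul]

theorem lintegral_stdGaussian_reflection {e : E} (he : ‖e‖ = 1) {g : E → ℝ≥0∞}
    (hg : Measurable g) :
    ∫⁻ x, g (x - (2 * inner ℝ e x) • e) ∂stdGaussian E = ∫⁻ x, g x ∂stdGaussian E := by
  have hS : ∀ x : E, (ℝ ∙ e)ᗮ.reflection x = x - (2 * inner ℝ e x) • e := by
    intro x
    rw [Submodule.reflection_orthogonal_apply, Submodule.reflection_singleton_apply, he]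
    simp [two_smul, two_mul, add_smul]
  conv_rhs => rw [← stdGaussian_map (ℝ ∙ e)ᗮ.reflection]
  rw [lintegral_map hg (by fun_prop)]
  simp_rw [hS]

/-- The Cameron-Martin formula turns the shifted part into the density min(1, exp(a s - a²/2)) with
s the component along `e`. The reflection changes the sign of s and turns the other part into the
positive part of 1 - exp(a s - a²/2). The two again add up to one. -/
theorem reflectionCoupling_snd {e : E} (he : ‖e‖ = 1) (a : ℝ) :
    (reflectionCoupling e a).snd = stdGaussian E := by
  refine Measure.ext_of_lintegral _ fun g hg => ?_
  have h0 := (continuous_shiftRatio e a).measurable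
  rw [Measure.snd, lintegral_map hg measurable_snd,
    lintegral_reflectionCoupling e a (by fun_prop)]
  have hee : inner ℝ e e = (1 : ℝ) := by rw [real_inner_self_eq_norm_sq, he]; norm_num
  have h1 : ∫⁻ x, ENNReal.ofReal (min 1 (shiftRatio e a x)) * g (x + a • e) ∂stdGaussian E =
      ∫⁻ x, ENNReal.ofReal (min 1 (Real.exp (a * inner ℝ e x - a ^ 2 / 2))) * g x
        ∂stdGaussian E := by
    have := lintegral_stdGaussian_add (E := E)
      (g := fun x => ENNReal.ofReal (min 1 (Real.exp (-a * inner ℝ e x + a ^ 2 / 2))) * g x)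
      (by fun_prop) (a • e)
    have e1 : ∀ x : E, shiftRatio e a x =
        Real.exp (-a * inner ℝ e (x + a • e) + a ^ 2 / 2) := by
      intro x
      rw [shiftRatio, inner_add_right, inner_smul_right, hee]
      ring_nf
    simp_rw [e1]
    rw [this]
    refine lintegral_congr fun x => ?_
    rw [← mul_assoc, ← ENNReal.ofReal_mul (Real.exp_pos _).le]
    congr 2
    rw [mul_min_of_nonneg _ _ (Real.exp_pos _).le, ← Real.exp_add, mul_one, min_comm,
      inner_smul_left, norm_smul, he]
    congr 1
    · rw [Real.exp_eq_one_iff]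
      simp
    · simp
  have h2 : ∫⁻ x, ENNReal.ofReal (1 - shiftRatio e a x) * g (x - (2 * inner ℝ e x) • e)
        ∂stdGaussian E =
      ∫⁻ x, ENNReal.ofReal (1 - Real.exp (a * inner ℝ e x - a ^ 2 / 2)) * g x
        ∂stdGaussian E := by
    rw [← lintegral_stdGaussian_reflection he (by fun_prop)]
    refine lintegral_congr fun x => ?_
    have h3 : inner ℝ e (x - (2 * inner ℝ e x) • e) = -inner ℝ e x := by
      rw [inner_sub_right, inner_smul_right, hee]
      ring
    rw [h3, shiftRatio, h3]
    simp
  simp only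
  rw [h1, h2, ← lintegral_add_left (by fun_prop)]
  refine lintegral_congr fun x => ?_
  rw [← add_mul, ofReal_min_one_add_ofReal_one_sub (Real.exp_pos _).le, one_mul]

/-- The probability that the reflection coupling reflects. -/
def reflectionProb (e : E) (a : ℝ) : ℝ := ∫ x, max (1 - shiftRatio e a x) 0 ∂stdGaussian E

/-- By exp t ≥ 1 + t, and with the positive part of s written as (s + |s|) / 2. The bound is linear
in `a` to first order, so failures are rare for nearby particles. -/
theorem max_one_sub_shiftRatio_le (e : E) {a : ℝ} (ha : 0 ≤ a) (x : E) :
    max (1 - shiftRatio e a x) 0 ≤ a * ((inner ℝ e x + |inner ℝ e x|) / 2) + a ^ 2 / 2 := by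
  have h1 := Real.add_one_le_exp (-a * inner ℝ e x - a ^ 2 / 2)
  have h2 := mul_le_mul_of_nonneg_left (le_abs_self (inner ℝ e x)) ha
  have h3 := mul_le_mul_of_nonneg_left (neg_abs_le (inner ℝ e x)) ha
  refine max_le ?_ (by nlinarith [sq_nonneg a])
  rw [shiftRatio]
  nlinarith

theorem max_one_sub_shiftRatio_mem (e : E) (a : ℝ) (x : E) :
    ‖max (1 - shiftRatio e a x) 0‖ ≤ 1 := by
  have : 0 < shiftRatio e a x := Real.exp_pos _
  rw [Real.norm_of_nonneg (le_max_right _ _)]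
  exact max_le (by linarith) (by norm_num)

theorem min_one_shiftRatio (e : E) (a : ℝ) (x : E) :
    min 1 (shiftRatio e a x) = 1 - max (1 - shiftRatio e a x) 0 := by
  rcases le_total 1 (shiftRatio e a x) with h | h
  · rw [min_eq_left h, max_eq_right (by linarith)]; ring
  · rw [min_eq_right h, max_eq_left (by linarith)]; ring

theorem integrable_max_one_sub_shiftRatio_mul (e : E) (a : ℝ) {g : E → ℝ}
    (hg : Integrable g (stdGaussian E)) :
    Integrable (fun x => max (1 - shiftRatio e a x) 0 * g x) (stdGaussian E) := by
  have := (continuous_shiftRatio e a).measurable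
  exact hg.bdd_mul (c := 1) (by fun_prop)
    (Filter.Eventually.of_forall fun x => max_one_sub_shiftRatio_mem e a x)

theorem integrable_max_one_sub_shiftRatio (e : E) (a : ℝ) :
    Integrable (fun x => max (1 - shiftRatio e a x) 0) (stdGaussian E) := by
  simpa using integrable_max_one_sub_shiftRatio_mul e a (integrable_const (1 : ℝ))

theorem reflectionProb_nonneg (e : E) (a : ℝ) : 0 ≤ reflectionProb e a :=
  integral_nonneg fun _ => le_max_right _ _

/-- The mean of the positive part of a Gaussian component is at most 1/2, because the component is
centred and its mean absolute value is at most one. -/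
theorem reflectionProb_le {e : E} (he : ‖e‖ = 1) {a : ℝ} (ha : 0 ≤ a) :
    reflectionProb e a ≤ (a + a ^ 2) / 2 := by
  have hs := integrable_inner_stdGaussian e
  have hi : Integrable (fun x : E => a * ((inner ℝ e x + |inner ℝ e x|) / 2))
      (stdGaussian E) := ((hs.add hs.abs).div_const 2).const_mul a
  have h := integral_mono (integrable_max_one_sub_shiftRatio e a)
    (hi.add (integrable_const (a ^ 2 / 2))) (fun x => max_one_sub_shiftRatio_le e ha x)
  simp only [Pi.add_apply] at h
  rw [integral_add hi (integrable_const _), integral_const_mul, integral_div,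
    integral_add hs hs.abs, integral_inner_stdGaussian] at h
  have := mul_le_mul_of_nonneg_left (integral_abs_inner_stdGaussian_le he) ha
  simp at h
  rw [reflectionProb]
  linarith

theorem integral_reflection_abs_le {e : E} (he : ‖e‖ = 1) {a : ℝ} (ha : 0 ≤ a) :
    ∫ x, max (1 - shiftRatio e a x) 0 * |inner ℝ e x| ∂stdGaussian E ≤ (a + a ^ 2) / 2 := by
  have hs := integrable_inner_stdGaussian e
  have h2 := integrable_inner_sq_stdGaussian e
  have h3 : Integrable (fun x : E => |inner ℝ e x| * inner ℝ e x) (stdGaussian E) := by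
    refine h2.mono' (by fun_prop) (Filter.Eventually.of_forall fun x => ?_)
    rw [norm_mul, Real.norm_eq_abs, Real.norm_eq_abs, abs_abs, ← sq, sq_abs]
  have hi1 : Integrable (fun x : E => a / 2 * (|inner ℝ e x| * inner ℝ e x))
      (stdGaussian E) := h3.const_mul _
  have hi2 : Integrable (fun x : E => a / 2 * inner ℝ e x ^ 2) (stdGaussian E) := h2.const_mul _
  have hi3 : Integrable (fun x : E => a ^ 2 / 2 * |inner ℝ e x|) (stdGaussian E) :=
    hs.abs.const_mul _
  have h : ∫ x, max (1 - shiftRatio e a x) 0 * |inner ℝ e x| ∂stdGaussian E ≤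
      ∫ x, (a / 2 * (|inner ℝ e x| * inner ℝ e x) + a / 2 * inner ℝ e x ^ 2 +
        a ^ 2 / 2 * |inner ℝ e x|) ∂stdGaussian E := by
    refine integral_mono (integrable_max_one_sub_shiftRatio_mul e a hs.abs)
      ((hi1.add hi2).add hi3) fun x => ?_
    have := mul_le_mul_of_nonneg_right (max_one_sub_shiftRatio_le e ha x)
      (abs_nonneg (inner ℝ e x))
    refine this.trans (le_of_eq ?_)
    rw [← sq_abs (inner ℝ e x)]
    ring
  rw [integral_add (by exact hi1.add hi2) hi3, integral_add hi1 hi2, integral_const_mul,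
    integral_const_mul, integral_const_mul, integral_abs_mul_inner_stdGaussian,
    integral_inner_sq_stdGaussian, he] at h
  have := mul_le_mul_of_nonneg_left (integral_abs_inner_stdGaussian_le he)
    (by positivity : 0 ≤ a ^ 2 / 2)
  linarith

theorem integrable_coupling_sub {Γ : Measure (E × E)} (h1 : Γ.fst = stdGaussian E)
    (h2 : Γ.snd = stdGaussian E) {G : E → ℝ} (hG : Measurable G) {C D : ℝ}
    (hb : ∀ w, |G w| ≤ C + D * ‖w‖) (hD : 0 ≤ D) :
    Integrable (fun p : E × E => G (p.1 - p.2)) Γ := by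
  have hP : IsProbabilityMeasure Γ := by
    constructor
    have : Γ.fst Set.univ = 1 := by rw [h1]; exact measure_univ
    rwa [Measure.fst_univ] at this
  have i1 : Integrable (fun p : E × E => ‖p.1‖) Γ := by
    have := integrable_norm_stdGaussian (E := E)
    rw [← h1, Measure.fst] at this
    exact this.comp_measurable measurable_fst
  have i2 : Integrable (fun p : E × E => ‖p.2‖) Γ := by
    have := integrable_norm_stdGaussian (E := E)
    rw [← h2, Measure.snd] at this
    exact this.comp_measurable measurable_snd
  refine ((integrable_const C).add ((i1.add i2).const_mul D)).mono'
    (hG.comp (measurable_fst.sub measurable_snd)).aestronglyMeasurable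
    (Filter.Eventually.of_forall fun p => ?_)
  refine (hb _).trans ?_
  simp only [Pi.add_apply]
  gcongr
  exact norm_sub_le _ _

/-- The velocity difference is -(a e) on success and 2 s e on reflection, so only two moments of the
failure event enter: its probability and the mean of |s| on it. -/
theorem integral_reflectionCoupling_le {e : E} (he : ‖e‖ = 1) {a : ℝ} (ha : 0 ≤ a) {G : E → ℝ}
    (hG : Measurable G) {C D : ℝ} (hb : ∀ w, |G w| ≤ C + D * ‖w‖) (hD : 0 ≤ D)
    {g₀ α β : ℝ} (h0 : G (-(a • e)) ≤ g₀) (hβ : 0 ≤ β)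
    (h1 : ∀ s : ℝ, G ((2 * s) • e) ≤ α + β * |s|) :
    ∫ p, G (p.1 - p.2) ∂reflectionCoupling e a ≤
      (1 - reflectionProb e a) * g₀ + reflectionProb e a * α + β * ((a + a ^ 2) / 2) := by
  have hm := (continuous_shiftRatio e a).measurable
  have hGm : ∀ μ : Measure (E × E), AEStronglyMeasurable (fun p : E × E => G (p.1 - p.2)) μ :=
    fun μ => (hG.comp (measurable_fst.sub measurable_snd)).aestronglyMeasurable
  have hint := integrable_coupling_sub (reflectionCoupling_fst e a)
    (reflectionCoupling_snd he a) hG hb hD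
  have hi := integrable_max_one_sub_shiftRatio e a
  have hs := (integrable_inner_stdGaussian e).abs
  rw [reflectionCoupling] at hint ⊢
  rw [integral_add_measure hint.left_of_add_measure hint.right_of_add_measure,
    integral_map (by fun_prop) (hGm _), integral_map (by fun_prop) (hGm _),
    integral_withDensity_eq_integral_toReal_smul (by fun_prop) (by simp),
    integral_withDensity_eq_integral_toReal_smul (by fun_prop) (by simp)]
  have e1 : ∀ x : E, (ENNReal.ofReal (min 1 (shiftRatio e a x))).toReal •
      G ((x, x + a • e).1 - (x, x + a • e).2) =
      (1 - max (1 - shiftRatio e a x) 0) * G (-(a • e)) := by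
    intro x
    rw [ENNReal.toReal_ofReal (le_min zero_le_one (shiftRatio_pos e a x).le), min_one_shiftRatio]
    simp
  have e2 : ∀ x : E, (ENNReal.ofReal (1 - shiftRatio e a x)).toReal •
      G ((x, x - (2 * inner ℝ e x) • e).1 - (x, x - (2 * inner ℝ e x) • e).2) =
      max (1 - shiftRatio e a x) 0 * G ((2 * inner ℝ e x) • e) := by
    intro x
    rw [ENNReal.toReal_ofReal']
    simp
  simp_rw [e1, e2]
  rw [integral_mul_const, integral_sub (integrable_const _) hi]
  have hp1 : reflectionProb e a ≤ 1 := by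
    have := integral_mono hi (integrable_const (1 : ℝ)) fun x =>
      (le_abs_self _).trans (max_one_sub_shiftRatio_mem e a x)
    simpa [reflectionProb] using this
  have hsecond : ∫ x, max (1 - shiftRatio e a x) 0 * G ((2 * inner ℝ e x) • e) ∂stdGaussian E ≤
      reflectionProb e a * α + β * ((a + a ^ 2) / 2) := by
    have hi2 : Integrable (fun x : E => max (1 - shiftRatio e a x) 0 * |inner ℝ e x|)
      (stdGaussian E) := integrable_max_one_sub_shiftRatio_mul e a hs
    have hG2 : Integrable (fun x : E => G ((2 * inner ℝ e x) • e)) (stdGaussian E) := by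
      refine ((integrable_const C).add (hs.const_mul (D * 2))).mono'
        (hG.comp (by fun_prop)).aestronglyMeasurable
        (Filter.Eventually.of_forall fun x => (hb _).trans (le_of_eq ?_))
      simp [norm_smul, he]
      ring
    have := integral_mono (integrable_max_one_sub_shiftRatio_mul e a hG2)
      ((hi.mul_const α).add (hi2.const_mul β)) (fun x => by
        have := mul_le_mul_of_nonneg_left (h1 (inner ℝ e x))
          (le_max_right (1 - shiftRatio e a x) 0)
        refine this.trans (le_of_eq ?_)
        simp only [Pi.add_apply]
        ring)
    simp only [Pi.add_apply] at this
    rw [integral_add (hi.mul_const α) (hi2.const_mul β), integral_mul_const,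
      integral_const_mul] at this
    have h3 := mul_le_mul_of_nonneg_left (integral_reflection_abs_le he ha) hβ
    rw [reflectionProb]
    linarith
  have hfirst := mul_le_mul_of_nonneg_left h0 (by linarith : 0 ≤ 1 - reflectionProb e a)
  simp only [integral_const, probReal_univ, smul_eq_mul, mul_one]
  rw [reflectionProb] at hfirst hsecond ⊢
  linarith

end Reflection

/-! ### The Gaussian divergence and its second moment -/

section Divergence

variable {E : Type*} [NormedAddCommGroup E] [InnerProductSpace ℝ E] [FiniteDimensional ℝ E]
  [MeasurableSpace E] [BorelSpace E] {ι : Type*} [Fintype ι]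

theorem integrable_stdGaussian_of_growth {f : E → ℝ} (hf : Continuous f) {C : ℝ}
    (h : ∀ x, |f x| ≤ C * (1 + ‖x‖) ^ 2) : Integrable f (stdGaussian E) := by
  have h1 : Integrable (fun x : E => C * (1 + 2 * ‖x‖ + ‖x‖ ^ 2)) (stdGaussian E) :=
    ((((integrable_const (1 : ℝ)).add (integrable_norm_stdGaussian.const_mul 2)).add
      integrable_norm_sq_stdGaussian).const_mul C)
  refine h1.mono' hf.aestronglyMeasurable (Filter.Eventually.of_forall fun x => ?_)
  refine (h x).trans (le_of_eq ?_)
  ring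

/-- The Gaussian divergence `⟨x, u(x)⟩ - div u(x)` of a vector field. -/
def gaussDiv (b : OrthonormalBasis ι ℝ E) (u : E → E) (x : E) : ℝ :=
  inner ℝ x (u x) - ∑ a, inner ℝ (b a) (fderiv ℝ u x (b a))

theorem abs_trace_le (b : OrthonormalBasis ι ℝ E) (D : E →L[ℝ] E) :
    |∑ a, inner ℝ (b a) (D (b a))| ≤ Fintype.card ι * ‖D‖ := by
  refine (Finset.abs_sum_le_sum_abs _ _).trans ?_
  have : ∀ a ∈ Finset.univ, |inner ℝ (b a) (D (b a))| ≤ ‖D‖ := by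
    intro a _
    refine (abs_real_inner_le_norm _ _).trans ?_
    have := D.le_opNorm (b a)
    simp only [b.norm_eq_one, mul_one, one_mul] at this ⊢
    exact this
  refine (Finset.sum_le_sum this).trans ?_
  simp

/-- The Gaussian divergence is the adjoint of the gradient. -/
theorem integral_mul_gaussDiv (b : OrthonormalBasis ι ℝ E) {u : E → E} (hu : ContDiff ℝ 1 u)
    {G : E → ℝ} (hG : ContDiff ℝ 1 G) {A C : ℝ} (huA : ∀ x, ‖u x‖ ≤ A)
    (huC : ∀ x, ‖fderiv ℝ u x‖ ≤ A) (hGC : ∀ x, |G x| ≤ C * (1 + ‖x‖))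
    (hGC' : ∀ x, ‖fderiv ℝ G x‖ ≤ C * (1 + ‖x‖)) :
    ∫ x, G x * gaussDiv b u x ∂stdGaussian E = ∫ x, fderiv ℝ G x (u x) ∂stdGaussian E := by
  have hu' := hu.continuous_fderiv one_ne_zero
  have hG' := hG.continuous_fderiv one_ne_zero
  have huc := hu.continuous
  have hGc := hG.continuous
  have hA : 0 ≤ A := (norm_nonneg _).trans (huA 0)
  have hC : 0 ≤ C := by
    have := (abs_nonneg _).trans (hGC 0)
    simpa using this
  have hcomp : ∀ a x, |inner ℝ (b a) (u x)| ≤ A := fun a x => by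
    refine (abs_real_inner_le_norm _ _).trans ?_
    rw [b.norm_eq_one, one_mul]
    exact huA x
  have hderiv : ∀ a x, HasFDerivAt (fun x => inner ℝ (b a) (u x) * G x)
      (inner ℝ (b a) (u x) • fderiv ℝ G x + G x • (innerSL ℝ (b a)).comp (fderiv ℝ u x)) x := by
    intro a x
    have h1 : HasFDerivAt (fun x => inner ℝ (b a) (u x))
        ((innerSL ℝ (b a)).comp (fderiv ℝ u x)) x :=
      (innerSL ℝ (b a)).hasFDerivAt.comp x (hu.differentiable one_ne_zero x).hasFDerivAt
    exact h1.mul (hG.differentiable one_ne_zero x).hasFDerivAt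
  have hfd : ∀ a x, fderiv ℝ (fun x => inner ℝ (b a) (u x) * G x) x (b a) =
      inner ℝ (b a) (u x) * fderiv ℝ G x (b a) + G x * inner ℝ (b a) (fderiv ℝ u x (b a)) := by
    intro a x
    rw [(hderiv a x).fderiv]
    simp
  have hDa : ∀ a x, |fderiv ℝ G x (b a)| ≤ C * (1 + ‖x‖) := fun a x => by
    have := (fderiv ℝ G x).le_opNorm (b a)
    rw [b.norm_eq_one, mul_one] at this
    exact this.trans (hGC' x)
  have hda : ∀ a x, |inner ℝ (b a) (fderiv ℝ u x (b a))| ≤ A := fun a x => by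
    refine (abs_real_inner_le_norm _ _).trans ?_
    have := (fderiv ℝ u x).le_opNorm (b a)
    rw [b.norm_eq_one, mul_one] at this
    rw [b.norm_eq_one, one_mul]
    exact this.trans (huC x)
  have hsq : ∀ x : E, C * (1 + ‖x‖) * A ≤ A * C * (1 + ‖x‖) ^ 2 := fun x => by
    nlinarith [norm_nonneg x, mul_nonneg hA hC, mul_nonneg (mul_nonneg hA hC) (norm_nonneg x)]
  have i1 : ∀ a, Integrable (fun x => inner ℝ (b a) (u x) * fderiv ℝ G x (b a))
      (stdGaussian E) := fun a => by
    refine integrable_stdGaussian_of_growth (C := A * C) (by fun_prop) fun x => ?_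
    rw [abs_mul, mul_comm]
    exact (mul_le_mul (hDa a x) (hcomp a x) (abs_nonneg _) (by positivity)).trans (hsq x)
  have i2 : ∀ a, Integrable (fun x => G x * inner ℝ (b a) (fderiv ℝ u x (b a)))
      (stdGaussian E) := fun a => by
    refine integrable_stdGaussian_of_growth (C := A * C) (by fun_prop) fun x => ?_
    rw [abs_mul]
    exact (mul_le_mul (hGC x) (hda a x) (abs_nonneg _) (by positivity)).trans (hsq x)
  have i3 : ∀ a, Integrable (fun x => inner ℝ (b a) x * (inner ℝ (b a) (u x) * G x))
      (stdGaussian E) := fun a => by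
    refine integrable_stdGaussian_of_growth (C := A * C) (by fun_prop) fun x => ?_
    rw [abs_mul, abs_mul]
    have h1 : |inner ℝ (b a) x| ≤ 1 + ‖x‖ := by
      refine (abs_real_inner_le_norm _ _).trans ?_
      rw [b.norm_eq_one]
      linarith
    calc _ ≤ (1 + ‖x‖) * (A * (C * (1 + ‖x‖))) := by
          gcongr
          · exact hcomp a x
          · exact hGC x
      _ = _ := by ring
  have i4 : ∀ a, Integrable (fun x => inner ℝ (b a) (u x) * G x) (stdGaussian E) := fun a => by
    refine integrable_stdGaussian_of_growth (C := A * C) (by fun_prop) fun x => ?_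
    rw [abs_mul, mul_comm]
    exact (mul_le_mul (hGC x) (hcomp a x) (abs_nonneg _) (by positivity)).trans (hsq x)
  have key : ∀ a, ∫ x, inner ℝ (b a) x * (inner ℝ (b a) (u x) * G x) ∂stdGaussian E =
      ∫ x, inner ℝ (b a) (u x) * fderiv ℝ G x (b a) ∂stdGaussian E +
      ∫ x, G x * inner ℝ (b a) (fderiv ℝ u x (b a)) ∂stdGaussian E := by
    intro a
    rw [integral_stdGaussian_inner_mul (b a) (fun x => (hderiv a x).differentiableAt) (i4 a)
      (by simp_rw [hfd]; exact (i1 a).add (i2 a)) (i3 a)]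
    simp_rw [hfd]
    exact integral_add (i1 a) (i2 a)
  have e1 : ∀ x, G x * gaussDiv b u x =
      ∑ a, (inner ℝ (b a) x * (inner ℝ (b a) (u x) * G x) -
        G x * inner ℝ (b a) (fderiv ℝ u x (b a))) := by
    intro x
    rw [gaussDiv, ← b.sum_inner_mul_inner x (u x), Finset.sum_sub_distrib, mul_sub,
      Finset.mul_sum, Finset.mul_sum]
    congr 1
    refine Finset.sum_congr rfl fun a _ => ?_
    rw [real_inner_comm]
    ring
  have e2 : ∀ x, fderiv ℝ G x (u x) = ∑ a, inner ℝ (b a) (u x) * fderiv ℝ G x (b a) := by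
    intro x
    conv_lhs => rw [← b.sum_repr' (u x)]
    simp
  simp_rw [e1, e2]
  rw [integral_finsetSum _ (fun a _ => by exact (i3 a).sub (i2 a)), integral_finsetSum _ (fun a _ => i1 a)]
  refine Finset.sum_congr rfl fun a _ => ?_
  rw [integral_sub (i3 a) (i2 a), key]
  ring

/-- The trace of D² is the Hilbert-Schmidt pairing of D* with D, and both have the same
Hilbert-Schmidt norm. -/
theorem trace_sq_le (b : OrthonormalBasis ι ℝ E) (D : E →L[ℝ] E) :
    ∑ a, inner ℝ (b a) (D (D (b a))) ≤ ∑ a, ‖D (b a)‖ ^ 2 := by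
  have h1 : ∑ a, ‖D.adjoint (b a)‖ ^ 2 = ∑ a, ‖D (b a)‖ ^ 2 := by
    simp_rw [← b.sum_sq_inner_right]
    rw [Finset.sum_comm]
    refine Finset.sum_congr rfl fun a _ => Finset.sum_congr rfl fun c _ => ?_
    rw [ContinuousLinearMap.adjoint_inner_right, real_inner_comm]
  have h2 : ∀ a, inner ℝ (b a) (D (D (b a))) ≤
      (‖D.adjoint (b a)‖ ^ 2 + ‖D (b a)‖ ^ 2) / 2 := by
    intro a
    rw [← ContinuousLinearMap.adjoint_inner_left]
    have := real_inner_le_norm (D.adjoint (b a)) (D (b a))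
    nlinarith [sq_nonneg (‖D.adjoint (b a)‖ - ‖D (b a)‖)]
  calc _ ≤ ∑ a, (‖D.adjoint (b a)‖ ^ 2 + ‖D (b a)‖ ^ 2) / 2 := Finset.sum_le_sum fun a _ => h2 a
    _ = _ := by rw [← Finset.sum_div, Finset.sum_add_distrib, h1]; ring

/-- The mean of the squared divergence equals the mean of |u|² + tr((Du)²). To see this, the
divergence is integrated by parts against itself. Its derivative along u is |u|² + tr((Du)²) plus
the divergence of the field Du·u, which has mean zero. The bound `C` only provides integrability and
leaves no trace in the conclusion. -/
theorem integral_gaussDiv_sq_le (b : OrthonormalBasis ι ℝ E) {u : E → E} (hu : ContDiff ℝ 2 u)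
    {A C S : ℝ} (huA : ∀ x, ‖u x‖ ≤ A) (huC : ∀ x, ‖fderiv ℝ u x‖ ≤ C)
    (huC' : ∀ x, ‖fderiv ℝ (fderiv ℝ u) x‖ ≤ C)
    (hS : ∀ x, ∑ a, ‖fderiv ℝ u x (b a)‖ ^ 2 ≤ S) :
    Integrable (fun x => gaussDiv b u x ^ 2) (stdGaussian E) ∧
      ∫ x, gaussDiv b u x ^ 2 ∂stdGaussian E ≤ A ^ 2 + S := by
  have hA : 0 ≤ A := (norm_nonneg _).trans (huA 0)
  have hC : 0 ≤ C := (norm_nonneg _).trans (huC 0)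
  have hu1 : ContDiff ℝ 1 u := hu.of_le (by norm_num)
  have hd1 : ContDiff ℝ 1 (fderiv ℝ u) := hu.fderiv_right (by norm_num)
  have hd0 := hd1.continuous
  have hdd := hd1.continuous_fderiv one_ne_zero
  have hc := hu.continuous
  obtain ⟨d, hd⟩ : ∃ d : ℝ, d = Fintype.card ι := ⟨_, rfl⟩
  have hd0' : 0 ≤ d := hd ▸ Nat.cast_nonneg _
  have hG : ContDiff ℝ 1 (gaussDiv b u) :=
    (contDiff_id.inner ℝ hu1).sub (ContDiff.sum fun a _ =>
      contDiff_const.inner ℝ (hd1.clm_apply contDiff_const))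
  have hGderiv : ∀ x w, fderiv ℝ (gaussDiv b u) x w =
      inner ℝ w (u x) + inner ℝ x (fderiv ℝ u x w) -
        ∑ a, inner ℝ (b a) (fderiv ℝ (fderiv ℝ u) x w (b a)) := by
    intro x w
    have h1 : HasFDerivAt (fun x => inner ℝ x (u x)) _ x :=
      (hasFDerivAt_id x).inner ℝ (hu1.differentiable one_ne_zero x).hasFDerivAt
    have h2 : ∀ a, HasFDerivAt (fun x => inner ℝ (b a) (fderiv ℝ u x (b a)))
        ((innerSL ℝ (b a)).comp ((fderiv ℝ (fderiv ℝ u) x).flip (b a))) x := by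
      intro a
      refine (innerSL ℝ (b a)).hasFDerivAt.comp x ?_
      have := (hd1.differentiable one_ne_zero x).hasFDerivAt.clm_apply
        (hasFDerivAt_const (b a) x)
      simpa using this
    have h3 := h1.sub (HasFDerivAt.fun_sum fun a (_ : a ∈ Finset.univ) => h2 a)
    have h4 : HasFDerivAt (gaussDiv b u) _ x := h3
    rw [h4.fderiv]
    simp [fderivInnerCLM_apply, add_comm]
  have hGb : ∀ x, |gaussDiv b u x| ≤ (A + C + d * C) * (1 + ‖x‖) := by
    intro x
    have h1 := (abs_real_inner_le_norm x (u x)).trans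
      (mul_le_mul_of_nonneg_left (huA x) (norm_nonneg x))
    have h2 := (hd ▸ abs_trace_le b (fderiv ℝ u x)).trans
      (mul_le_mul_of_nonneg_left (huC x) hd0')
    refine (abs_sub _ _).trans ((add_le_add h1 h2).trans ?_)
    nlinarith [norm_nonneg x, mul_nonneg hd0' hC,
      mul_nonneg (mul_nonneg hd0' hC) (norm_nonneg x), mul_nonneg hC (norm_nonneg x)]
  have hGb' : ∀ x, ‖fderiv ℝ (gaussDiv b u) x‖ ≤ (A + C + d * C) * (1 + ‖x‖) := by
    intro x
    refine ContinuousLinearMap.opNorm_le_bound _ (by positivity) fun w => ?_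
    rw [hGderiv, Real.norm_eq_abs]
    have h1 : |inner ℝ w (u x)| ≤ ‖w‖ * A := (abs_real_inner_le_norm _ _).trans
      (mul_le_mul_of_nonneg_left (huA x) (norm_nonneg w))
    have h2 : |inner ℝ x (fderiv ℝ u x w)| ≤ ‖x‖ * (C * ‖w‖) :=
      (abs_real_inner_le_norm _ _).trans (mul_le_mul_of_nonneg_left
        (((fderiv ℝ u x).le_opNorm w).trans
          (mul_le_mul_of_nonneg_right (huC x) (norm_nonneg w))) (norm_nonneg x))
    have h3 : |∑ a, inner ℝ (b a) (fderiv ℝ (fderiv ℝ u) x w (b a))| ≤ d * (C * ‖w‖) :=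
      (hd ▸ abs_trace_le b _).trans (mul_le_mul_of_nonneg_left
        (((fderiv ℝ (fderiv ℝ u) x).le_opNorm w).trans
          (mul_le_mul_of_nonneg_right (huC' x) (norm_nonneg w))) hd0')
    have h4 := abs_sub (inner ℝ w (u x) + inner ℝ x (fderiv ℝ u x w))
      (∑ a, inner ℝ (b a) (fderiv ℝ (fderiv ℝ u) x w (b a)))
    have h5 := abs_add_le (inner ℝ w (u x)) (inner ℝ x (fderiv ℝ u x w))
    have p1 := mul_nonneg hA (mul_nonneg (norm_nonneg x) (norm_nonneg w))
    have p2 := mul_nonneg hC (norm_nonneg w)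
    have p3 := mul_nonneg (mul_nonneg hd0' hC) (mul_nonneg (norm_nonneg x) (norm_nonneg w))
    nlinarith
  have hint : Integrable (fun x => gaussDiv b u x ^ 2) (stdGaussian E) := by
    refine integrable_stdGaussian_of_growth (C := (A + C + d * C) ^ 2) (hG.continuous.pow 2)
      fun x => ?_
    rw [abs_of_nonneg (sq_nonneg _), ← mul_pow, ← sq_abs]
    exact pow_le_pow_left₀ (abs_nonneg _) (hGb x) 2
  refine ⟨hint, ?_⟩
  have k1 := integral_mul_gaussDiv b hu1 hG (A := A + C) (fun x => (huA x).trans (by linarith))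
    (fun x => (huC x).trans (by linarith)) hGb hGb'
  have hu2 : ContDiff ℝ 1 (fun x => fderiv ℝ u x (u x)) := hd1.clm_apply hu1
  have hu2d : ∀ x w, fderiv ℝ (fun x => fderiv ℝ u x (u x)) x w =
      fderiv ℝ u x (fderiv ℝ u x w) + fderiv ℝ (fderiv ℝ u) x w (u x) := by
    intro x w
    have := (hd1.differentiable one_ne_zero x).hasFDerivAt.clm_apply
      (hu1.differentiable one_ne_zero x).hasFDerivAt
    rw [this.fderiv]
    simp
  -- Testing against the constant `1` shows that the divergence of Du·u has mean zero.
  have k2 := integral_mul_gaussDiv b hu2 (contDiff_const (c := (1 : ℝ))) (A := C * A + C * C)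
    (C := 1)
    (fun x => ((fderiv ℝ u x).le_opNorm _).trans (by
      have := mul_le_mul (huC x) (huA x) (norm_nonneg _) hC
      nlinarith [mul_nonneg hC hC]))
    (fun x => ContinuousLinearMap.opNorm_le_bound _ (by positivity) fun w => by
      rw [hu2d]
      have h1 := ((fderiv ℝ u x).le_opNorm (fderiv ℝ u x w)).trans (mul_le_mul (huC x)
        (((fderiv ℝ u x).le_opNorm w).trans
          (mul_le_mul_of_nonneg_right (huC x) (norm_nonneg w))) (norm_nonneg _) hC)
      have h2 := ((fderiv ℝ (fderiv ℝ u) x w).le_opNorm (u x)).trans (mul_le_mul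
        (((fderiv ℝ (fderiv ℝ u) x).le_opNorm w).trans
          (mul_le_mul_of_nonneg_right (huC' x) (norm_nonneg w))) (huA x) (norm_nonneg _)
          (by positivity))
      refine (norm_add_le _ _).trans ((add_le_add h1 h2).trans (le_of_eq ?_))
      ring)
    (fun x => by rw [abs_one]; nlinarith [norm_nonneg x])
    (fun x => by simp; positivity)
  have i1 : Integrable (fun x => gaussDiv b (fun x => fderiv ℝ u x (u x)) x) (stdGaussian E) := by
    have hcd := hu2.continuous_fderiv one_ne_zero
    have hcc := hu2.continuous
    refine integrable_stdGaussian_of_growth (C := C * A + d * (C * A + C * C)) ?_ fun x => ?_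
    · unfold gaussDiv
      fun_prop
    · have hb1 : ‖fderiv ℝ u x (u x)‖ ≤ C * A := ((fderiv ℝ u x).le_opNorm _).trans
        (mul_le_mul (huC x) (huA x) (norm_nonneg _) hC)
      have hb2 : ‖fderiv ℝ (fun x => fderiv ℝ u x (u x)) x‖ ≤ C * A + C * C :=
        ContinuousLinearMap.opNorm_le_bound _ (by positivity) fun w => by
          rw [hu2d]
          have h1 := ((fderiv ℝ u x).le_opNorm (fderiv ℝ u x w)).trans (mul_le_mul (huC x)
            (((fderiv ℝ u x).le_opNorm w).trans
              (mul_le_mul_of_nonneg_right (huC x) (norm_nonneg w))) (norm_nonneg _) hC)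
          have h2 := ((fderiv ℝ (fderiv ℝ u) x w).le_opNorm (u x)).trans (mul_le_mul
            (((fderiv ℝ (fderiv ℝ u) x).le_opNorm w).trans
              (mul_le_mul_of_nonneg_right (huC' x) (norm_nonneg w))) (huA x) (norm_nonneg _)
              (by positivity))
          refine (norm_add_le _ _).trans ((add_le_add h1 h2).trans (le_of_eq ?_))
          ring
      have h1 := (abs_real_inner_le_norm x (fderiv ℝ u x (u x))).trans
        (mul_le_mul_of_nonneg_left hb1 (norm_nonneg x))
      have h2 := (hd ▸ abs_trace_le b (fderiv ℝ (fun x => fderiv ℝ u x (u x)) x)).trans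
        (mul_le_mul_of_nonneg_left hb2 hd0')
      refine (abs_sub _ _).trans ((add_le_add h1 h2).trans ?_)
      have p1 := mul_nonneg hC hA
      have p2 : 0 ≤ d * (C * A + C * C) := by positivity
      have p3 := norm_nonneg x
      have p4 := mul_nonneg p1 p3
      have p5 := mul_nonneg p2 p3
      have p6 := mul_nonneg p4 p3
      have p7 := mul_nonneg p5 p3
      nlinarith
  simp only [one_mul, fderiv_fun_const, Pi.zero_apply, zero_apply,
    integral_zero] at k2
  -- Symmetry of the second derivative cancels the terms with D²u in the two divergences.
  have e1 : ∀ x, fderiv ℝ (gaussDiv b u) x (u x) =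
      gaussDiv b (fun x => fderiv ℝ u x (u x)) x +
        (‖u x‖ ^ 2 + ∑ a, inner ℝ (b a) (fderiv ℝ u x (fderiv ℝ u x (b a)))) := by
    intro x
    have hsymm := hu.contDiffAt.isSymmSndFDerivAt (x := x) (by simp)
    rw [hGderiv, gaussDiv, real_inner_self_eq_norm_sq]
    have : ∀ a, fderiv ℝ (fderiv ℝ u) x (u x) (b a) = fderiv ℝ (fderiv ℝ u) x (b a) (u x) :=
      fun a => hsymm.eq _ _
    simp_rw [hu2d, inner_add_right, Finset.sum_add_distrib, this]
    ring
  have hsq : ∀ x, gaussDiv b u x ^ 2 = gaussDiv b u x * gaussDiv b u x := fun x => sq _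
  have i2 : Integrable (fun x => ‖u x‖ ^ 2 +
      ∑ a, inner ℝ (b a) (fderiv ℝ u x (fderiv ℝ u x (b a)))) (stdGaussian E) := by
    refine integrable_stdGaussian_of_growth (C := A ^ 2 + d * (C * C)) (by fun_prop) fun x => ?_
    have h1 : ‖u x‖ ^ 2 ≤ A ^ 2 := pow_le_pow_left₀ (norm_nonneg _) (huA x) 2
    have h2 : |∑ a, inner ℝ (b a) (fderiv ℝ u x (fderiv ℝ u x (b a)))| ≤ d * (C * C) :=
      (hd ▸ abs_trace_le b ((fderiv ℝ u x).comp (fderiv ℝ u x))).trans (mul_le_mul_of_nonneg_left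
        ((ContinuousLinearMap.opNorm_comp_le _ _).trans
          (mul_le_mul (huC x) (huC x) (norm_nonneg _) hC)) hd0')
    have h3 := abs_add_le (‖u x‖ ^ 2) (∑ a, inner ℝ (b a) (fderiv ℝ u x (fderiv ℝ u x (b a))))
    rw [abs_of_nonneg (sq_nonneg ‖u x‖)] at h3
    have p1 : 0 ≤ A ^ 2 + d * (C * C) := by positivity
    have p2 := mul_nonneg p1 (norm_nonneg x)
    nlinarith [mul_nonneg p2 (norm_nonneg x)]
  simp_rw [e1] at k1
  rw [integral_add i1 i2, k2, zero_add] at k1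
  simp_rw [hsq]
  rw [k1]
  have := integral_mono i2 (integrable_const (A ^ 2 + S)) fun x => by
    refine add_le_add (pow_le_pow_left₀ (norm_nonneg _) (huA x) 2)
      ((trace_sq_le b _).trans (hS x))
  simpa using this

/-- After integration by parts only |G| ≤ 1 matters: the integral is at most the L¹ norm of the
divergence, hence its L² norm. The bound `D` on the derivative of `G` does not enter the result. -/
theorem abs_integral_fderiv_apply_le_of_contDiff (b : OrthonormalBasis ι ℝ E) {u : E → E}
    (hu : ContDiff ℝ 2 u) {A C S : ℝ} (huA : ∀ x, ‖u x‖ ≤ A) (huC : ∀ x, ‖fderiv ℝ u x‖ ≤ C)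
    (huC' : ∀ x, ‖fderiv ℝ (fderiv ℝ u) x‖ ≤ C)
    (hS : ∀ x, ∑ a, ‖fderiv ℝ u x (b a)‖ ^ 2 ≤ S) {G : E → ℝ} (hG : ContDiff ℝ 1 G)
    (hG1 : ∀ x, |G x| ≤ 1) {D : ℝ} (hGD : ∀ x, ‖fderiv ℝ G x‖ ≤ D) :
    |∫ x, fderiv ℝ G x (u x) ∂stdGaussian E| ≤ √(A ^ 2 + S) := by
  have hD : 0 ≤ D := (norm_nonneg _).trans (hGD 0)
  have hA : 0 ≤ A := (norm_nonneg _).trans (huA 0)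
  have hC : 0 ≤ C := (norm_nonneg _).trans (huC 0)
  obtain ⟨h1, h2⟩ := integral_gaussDiv_sq_le b hu huA huC huC' hS
  rw [← integral_mul_gaussDiv b (hu.of_le (by norm_num)) hG (A := A + C) (C := 1 + D)
    (fun x => (huA x).trans (by linarith)) (fun x => (huC x).trans (by linarith))
    (fun x => (hG1 x).trans (by nlinarith [norm_nonneg x]))
    (fun x => (hGD x).trans (by nlinarith [norm_nonneg x, mul_nonneg hD (norm_nonneg x)]))]
  have hc : Continuous (gaussDiv b u) := by
    have hd := hu.continuous_fderiv two_ne_zero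
    have := hu.continuous
    unfold gaussDiv
    fun_prop
  have h3 : Integrable (gaussDiv b u) (stdGaussian E) := by
    refine ((integrable_const (1 : ℝ)).add h1).mono' hc.aestronglyMeasurable
      (Filter.Eventually.of_forall fun x => ?_)
    rw [Real.norm_eq_abs, Pi.add_apply, ← sq_abs]
    nlinarith [sq_nonneg (|gaussDiv b u x| - 1)]
  have h4 : |∫ x, G x * gaussDiv b u x ∂stdGaussian E| ≤
      ∫ x, |gaussDiv b u x| ∂stdGaussian E := by
    rw [← Real.norm_eq_abs]
    refine norm_integral_le_of_norm_le h3.abs (Filter.Eventually.of_forall fun x => ?_)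
    rw [Real.norm_eq_abs, abs_mul]
    exact mul_le_of_le_one_left (abs_nonneg _) (hG1 x)
  refine h4.trans ?_
  refine Real.le_sqrt_of_sq_le ?_
  set m := ∫ x, |gaussDiv b u x| ∂stdGaussian E with hm
  -- The variance of |div u| is nonnegative, which gives m² ≤ S + A².
  have h5 := integral_nonneg (μ := stdGaussian E)
    (f := fun x => gaussDiv b u x ^ 2 - 2 * m * |gaussDiv b u x| + m ^ 2) (fun x => by
      have := sq_nonneg (|gaussDiv b u x| - m)
      have h6 := sq_abs (gaussDiv b u x)
      simp only [Pi.zero_apply]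
      nlinarith)
  rw [integral_add (by exact h1.sub (h3.abs.const_mul _)) (integrable_const _),
    integral_sub h1 (h3.abs.const_mul _), integral_const_mul, ← hm] at h5
  simp only [integral_const, probReal_univ, smul_eq_mul, one_mul] at h5
  nlinarith

end Divergence

/-! ### Extension to Lipschitz vector fields -/

section Mollification

open scoped Convolution

variable {E : Type*} [NormedAddCommGroup E] [InnerProductSpace ℝ E] [FiniteDimensional ℝ E]
  [MeasurableSpace E] [BorelSpace E] {ι : Type*} [Fintype ι]

theorem norm_convolution_sub_le {F F' F'' : Type*} [NormedAddCommGroup F] [NormedSpace ℝ F]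
    [NormedAddCommGroup F'] [NormedSpace ℝ F'] [NormedAddCommGroup F''] [NormedSpace ℝ F'']
    (M : F →L[ℝ] F' →L[ℝ] F'') {ψ : E → F} (hψ : Continuous ψ) (hψc : HasCompactSupport ψ)
    {u : E → F'} (hu : Continuous u) (x y : E) {B : ℝ} (hB : ∀ t, ‖u (x - t) - u (y - t)‖ ≤ B) :
    ‖(ψ ⋆[M] u) x - (ψ ⋆[M] u) y‖ ≤ ‖M‖ * (∫ t, ‖ψ t‖) * B := by
  have hi : ∀ z, Integrable (fun t => M (ψ t) (u (z - t))) := fun z =>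
    hψc.convolutionExists_left_of_continuous_right M
      (hψ.locallyIntegrable) hu z
  rw [convolution_def, convolution_def, ← integral_sub (hi x) (hi y), ← integral_const_mul,
    ← integral_mul_const]
  refine norm_integral_le_of_norm_le (((hψ.integrable_of_hasCompactSupport hψc).norm.const_mul
    _).mul_const _) (Filter.Eventually.of_forall fun t => ?_)
  rw [← map_sub]
  refine (M.le_opNorm₂ _ _).trans ?_
  gcongr
  exact hB t

theorem exists_norm_convolution_sub_le {F F' F'' : Type*} [NormedAddCommGroup F] [NormedSpace ℝ F]
    [NormedAddCommGroup F'] [NormedSpace ℝ F'] [NormedAddCommGroup F''] [NormedSpace ℝ F'']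
    (M : F →L[ℝ] F' →L[ℝ] F'') {ψ : E → F} (hψ : Continuous ψ) (hψc : HasCompactSupport ψ)
    {u : E → F'} (hu : Continuous u) :
    ∃ C, 0 ≤ C ∧ ∀ x y B, (∀ t, ‖u (x - t) - u (y - t)‖ ≤ B) →
      ‖(ψ ⋆[M] u) x - (ψ ⋆[M] u) y‖ ≤ C * B :=
  ⟨‖M‖ * ∫ t, ‖ψ t‖, by positivity, fun x y _ hB => norm_convolution_sub_le M hψ hψc hu x y hB⟩

/-- Convolution with a bump of radius η moves values by at most K η and averages differences of
translates, so translation-invariant bounds such as the one by `q` persist with the same constant.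
The derivative bound `C` may blow up as η → 0, which is harmless. -/
theorem exists_smooth_vectorField {u : E → E} {A K : ℝ} {q : E → ℝ} (hA : ∀ x, ‖u x‖ ≤ A)
    (hK : ∀ x y, ‖u x - u y‖ ≤ K * ‖x - y‖) (hK0 : 0 ≤ K) (hq : ∀ x y, ‖u x - u y‖ ≤ q (x - y))
    {η : ℝ} (hη : 0 < η) :
    ∃ w : E → E, ContDiff ℝ 2 w ∧ (∀ x, ‖w x - u x‖ ≤ K * η) ∧ (∀ x, ‖w x‖ ≤ A + K * η) ∧
      (∀ x y, ‖w x - w y‖ ≤ q (x - y)) ∧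
      ∃ C, (∀ x, ‖fderiv ℝ w x‖ ≤ C) ∧ ∀ x, ‖fderiv ℝ (fderiv ℝ w) x‖ ≤ C := by
  have huc : Continuous u := by
    refine (LipschitzWith.of_dist_le_mul (K := K.toNNReal) fun x y => ?_).continuous
    rw [dist_eq_norm, dist_eq_norm, Real.coe_toNNReal _ hK0]
    exact hK x y
  let φ : ContDiffBump (0 : E) := ⟨η / 2, η, by positivity, by linarith⟩
  set ψ : E → ℝ := φ.normed volume with hψ
  have hψs : ContDiff ℝ (2 : ℕ∞) ψ := φ.contDiff_normed
  have hψc : HasCompactSupport ψ := φ.hasCompactSupport_normed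
  have hψ1 : ∫ t, ‖ψ t‖ = 1 := by
    simp_rw [hψ, Real.norm_of_nonneg (φ.nonneg_normed _)]
    exact φ.integral_normed
  have hψd : ContDiff ℝ 1 ψ := hψs.of_le (by norm_num)
  set w : E → E := ψ ⋆[ContinuousLinearMap.lsmul ℝ ℝ] u with hw
  have hws : ContDiff ℝ (2 : ℕ∞) w := hψc.contDiff_convolution_left _ hψs huc.locallyIntegrable
  have hl1 : ‖(ContinuousLinearMap.lsmul ℝ ℝ : ℝ →L[ℝ] E →L[ℝ] E)‖ ≤ 1 :=
    ContinuousLinearMap.opNorm_lsmul_le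
  have hwu : ∀ x, ‖w x - u x‖ ≤ K * η := by
    intro x
    rw [← dist_eq_norm]
    refine φ.dist_normed_convolution_le huc.aestronglyMeasurable fun y hy => ?_
    rw [dist_eq_norm]
    refine (hK y x).trans (mul_le_mul_of_nonneg_left ?_ hK0)
    rw [← dist_eq_norm]
    exact (Metric.mem_ball.1 hy).le
  have hwq : ∀ (B : ℝ) (x y : E), (∀ t, ‖u (x - t) - u (y - t)‖ ≤ B) → ‖w x - w y‖ ≤ B := by
    intro B x y hB
    refine (norm_convolution_sub_le _ hψs.continuous hψc huc x y hB).trans ?_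
    rw [hψ1, mul_one]
    exact mul_le_of_le_one_left ((norm_nonneg _).trans (hB 0)) hl1
  have hwK : LipschitzWith K.toNNReal w := LipschitzWith.of_dist_le_mul fun x y => by
    rw [dist_eq_norm, dist_eq_norm, Real.coe_toNNReal _ hK0]
    exact hwq _ x y fun t => by simpa using hK (x - t) (y - t)
  have hfd : fderiv ℝ w = fderiv ℝ ψ ⋆[(ContinuousLinearMap.lsmul ℝ ℝ).precompL E] u := by
    ext1 x
    exact (hψc.hasFDerivAt_convolution_left _ hψd huc.locallyIntegrable x).fderiv
  obtain ⟨C₁, hC₁0, hC₁⟩ := exists_norm_convolution_sub_le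
    ((ContinuousLinearMap.lsmul ℝ ℝ : ℝ →L[ℝ] E →L[ℝ] E).precompL E)
    (hψd.continuous_fderiv one_ne_zero) (hψc.fderiv ℝ) huc
  set C₂ := C₁ * K with hC₂
  have hC₂0 : 0 ≤ C₂ := by positivity
  have hwK2 : LipschitzWith C₂.toNNReal (fderiv ℝ w) := LipschitzWith.of_dist_le_mul fun x y => by
    rw [dist_eq_norm, dist_eq_norm, Real.coe_toNNReal _ hC₂0, hfd, hC₂, mul_assoc]
    exact hC₁ x y _ fun t => by simpa using hK (x - t) (y - t)
  refine ⟨w, hws, hwu, fun x => ?_, fun x y => ?_, K + C₂, fun x => ?_, fun x => ?_⟩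
  · have := norm_add_le (u x) (w x - u x)
    rw [add_sub_cancel] at this
    exact this.trans (add_le_add (hA x) (hwu x))
  · exact hwq _ x y fun t => by simpa using hq (x - t) (y - t)
  · refine (norm_fderiv_le_of_lipschitz ℝ hwK).trans ?_
    rw [Real.coe_toNNReal _ hK0]
    linarith
  · refine (norm_fderiv_le_of_lipschitz ℝ hwK2).trans ?_
    rw [Real.coe_toNNReal _ hC₂0]
    linarith

/-- Signs are chosen greedily so that each new vector has nonnegative inner product with the signed
partial sum. Applied to the images of a basis, this bounds a Hilbert-Schmidt norm by the norm at a
single vector. -/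
theorem exists_signs_sum_sq_le {F : Type*} [NormedAddCommGroup F] [InnerProductSpace ℝ F]
    {ι : Type*} (v : ι → F) (s : Finset ι) :
    ∃ σ : ι → ℝ, (∀ a, σ a = 1 ∨ σ a = -1) ∧ ∑ a ∈ s, ‖v a‖ ^ 2 ≤ ‖∑ a ∈ s, σ a • v a‖ ^ 2 := by
  classical
  induction s using Finset.induction_on with
  | empty => exact ⟨fun _ => 1, fun _ => Or.inl rfl, by simp⟩
  | insert i s his ih =>
    obtain ⟨σ, hσ, hle⟩ := ih
    set z := ∑ a ∈ s, σ a • v a with hz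
    have key : ∀ c : ℝ, (c = 1 ∨ c = -1) → 0 ≤ c * inner ℝ (v i) z →
        ∃ σ : ι → ℝ, (∀ a, σ a = 1 ∨ σ a = -1) ∧
          ∑ a ∈ insert i s, ‖v a‖ ^ 2 ≤ ‖∑ a ∈ insert i s, σ a • v a‖ ^ 2 := by
      intro c hc hc0
      refine ⟨Function.update σ i c, fun a => ?_, ?_⟩
      · by_cases h : a = i
        · subst h; simpa using hc
        · simpa [h] using hσ a
      · rw [Finset.sum_insert his, Finset.sum_insert his]
        have : ∑ a ∈ s, Function.update σ i c a • v a = z := by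
          refine Finset.sum_congr rfl fun a ha => ?_
          rw [Function.update_of_ne]
          rintro rfl
          exact his ha
        rw [this, Function.update_self, norm_add_sq_real, norm_smul, inner_smul_left, mul_pow,
          Real.norm_eq_abs, sq_abs]
        have hc2 : c ^ 2 = 1 := by rcases hc with rfl | rfl <;> norm_num
        have : (starRingEnd ℝ) c = c := rfl
        rw [hc2, this]
        nlinarith
    rcases le_total 0 (inner ℝ (v i) z) with h | h
    · exact key 1 (Or.inl rfl) (by simpa using h)
    · exact key (-1) (Or.inr rfl) (by linarith)

/-- Homogeneity of `q` bounds the difference quotients along `v` by `q v` at every scale. -/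
theorem norm_fderiv_apply_le_of_homogeneous {w : E → E} (hw : Differentiable ℝ w) {q : E → ℝ}
    (hq : ∀ x y, ‖w x - w y‖ ≤ q (x - y)) (hhom : ∀ (t : ℝ) x, q (t • x) = |t| * q x) (x v : E) :
    ‖fderiv ℝ w x v‖ ≤ q v := by
  have h1 : HasDerivAt (fun t : ℝ => w (x + t • v)) (fderiv ℝ w x v) 0 := by
    have h2 : HasDerivAt (fun t : ℝ => x + t • v) v 0 := by
      simpa using ((hasDerivAt_id (0 : ℝ)).smul_const v).const_add x
    have h3 : HasFDerivAt w (fderiv ℝ w x) (x + (0 : ℝ) • v) := by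
      simpa using (hw x).hasFDerivAt
    exact h3.comp_hasDerivAt (0 : ℝ) h2
  refine h1.le_of_lip' ((norm_nonneg _).trans (hq v 0) |>.trans (by simp)) ?_
  refine Filter.Eventually.of_forall fun t => ?_
  refine (hq _ _).trans (le_of_eq ?_)
  rw [show x + t • v - (x + (0 : ℝ) • v) = t • v by simp, hhom, sub_zero, Real.norm_eq_abs,
    mul_comm]

/-- A bound on the pairing of a gradient with a Lipschitz vector field under the standard
Gaussian measure, in which the Lipschitz condition is with respect to a norm `q`. -/
theorem abs_integral_fderiv_apply_le (b : OrthonormalBasis ι ℝ E) {u : E → E} {A K B s : ℝ}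
    {q : E → ℝ} (hA : ∀ x, ‖u x‖ ≤ A) (hK : ∀ x y, ‖u x - u y‖ ≤ K * ‖x - y‖) (hK0 : 0 ≤ K)
    (hB : 0 ≤ B) (hq : ∀ x y, ‖u x - u y‖ ≤ B * q (x - y))
    (hhom : ∀ (t : ℝ) x, q (t • x) = |t| * q x)
    (hsign : ∀ σ : ι → ℝ, (∀ a, σ a = 1 ∨ σ a = -1) → q (∑ a, σ a • b a) ≤ s)
    {G : E → ℝ} (hG : ContDiff ℝ 1 G) (hG1 : ∀ x, |G x| ≤ 1) {D : ℝ}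
    (hGD : ∀ x, ‖fderiv ℝ G x‖ ≤ D) :
    |∫ x, fderiv ℝ G x (u x) ∂stdGaussian E| ≤ √(A ^ 2 + (B * s) ^ 2) := by
  have hD : 0 ≤ D := (norm_nonneg _).trans (hGD 0)
  have hA0 : 0 ≤ A := (norm_nonneg _).trans (hA 0)
  have huc : Continuous u := by
    refine (LipschitzWith.of_dist_le_mul (K := K.toNNReal) fun x y => ?_).continuous
    rw [dist_eq_norm, dist_eq_norm, Real.coe_toNNReal _ hK0]
    exact hK x y
  have hdc := hG.continuous_fderiv one_ne_zero
  have hmain : ∀ η : ℝ, 0 < η → |∫ x, fderiv ℝ G x (u x) ∂stdGaussian E| ≤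
      √((A + K * η) ^ 2 + (B * s) ^ 2) + D * (K * η) := by
    intro η hη
    obtain ⟨w, hw, hwu, hwA, hwq, C, hC1, hC2⟩ := exists_smooth_vectorField
      (q := fun x => B * q x) hA hK hK0 hq hη
    -- Only the `q`-size `s` of one vector of signs enters here, not the number of basis vectors.
    have hHS : ∀ x, ∑ a, ‖fderiv ℝ w x (b a)‖ ^ 2 ≤ (B * s) ^ 2 := by
      intro x
      obtain ⟨σ, hσ, hle⟩ := exists_signs_sum_sq_le (fun a => fderiv ℝ w x (b a)) Finset.univ
      refine hle.trans (pow_le_pow_left₀ (norm_nonneg _) ?_ 2)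
      have : ∑ a, σ a • fderiv ℝ w x (b a) = fderiv ℝ w x (∑ a, σ a • b a) := by simp
      rw [this]
      refine (norm_fderiv_apply_le_of_homogeneous (q := fun x => B * q x)
        (hw.differentiable two_ne_zero) hwq (fun t x => by
        simp only [hhom]; ring) x _).trans ?_
      exact mul_le_mul_of_nonneg_left (hsign σ hσ) hB
    have h1 := abs_integral_fderiv_apply_le_of_contDiff b hw hwA hC1 hC2 hHS hG hG1 hGD
    have hwc := hw.continuous
    have hbound : ∀ (z : E → E) (Z : ℝ), Continuous z → (∀ x, ‖z x‖ ≤ Z) →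
        Integrable (fun x => fderiv ℝ G x (z x)) (stdGaussian E) := by
      intro z Z hz hzZ
      refine (integrable_const (D * Z)).mono' (hdc.clm_apply hz).aestronglyMeasurable
        (Filter.Eventually.of_forall fun x => ?_)
      exact ((fderiv ℝ G x).le_opNorm _).trans
        (mul_le_mul (hGD x) (hzZ x) (norm_nonneg _) hD)
    have h2 : |∫ x, fderiv ℝ G x (u x) ∂stdGaussian E -
        ∫ x, fderiv ℝ G x (w x) ∂stdGaussian E| ≤ D * (K * η) := by
      rw [← integral_sub (hbound u A huc hA) (hbound w _ hwc hwA), ← Real.norm_eq_abs]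
      have := norm_integral_le_of_norm_le_const (μ := stdGaussian E) (C := D * (K * η))
        (f := fun x => fderiv ℝ G x (u x) - fderiv ℝ G x (w x))
        (Filter.Eventually.of_forall fun x => by
          rw [← map_sub]
          refine ((fderiv ℝ G x).le_opNorm _).trans
            (mul_le_mul (hGD x) ?_ (norm_nonneg _) hD)
          rw [norm_sub_rev]
          exact hwu x)
      simpa using this
    have h3 := abs_sub_abs_le_abs_sub (∫ x, fderiv ℝ G x (u x) ∂stdGaussian E)
      (∫ x, fderiv ℝ G x (w x) ∂stdGaussian E)
    linarith
  have hlim : Filter.Tendsto (fun η : ℝ => √((A + K * η) ^ 2 + (B * s) ^ 2) + D * (K * η))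
      (nhdsWithin 0 (Set.Ioi 0)) (nhds (√((A + K * 0) ^ 2 + (B * s) ^ 2) + D * (K * 0))) :=
    (Continuous.tendsto (by fun_prop) 0).mono_left nhdsWithin_le_nhds
  simp only [mul_zero, add_zero] at hlim
  exact ge_of_tendsto hlim (eventually_mem_nhdsWithin.mono fun η hη => hmain η hη)

end Mollification

/-! ### Velocity Verlet as a discrete second-order equation -/

section Verlet

variable {E : Type*} [NormedAddCommGroup E] [NormedSpace ℝ E]

/-- `(q, v)` is a velocity Verlet trajectory driven by the forces `-g`. -/
structure IsVerlet (h : ℝ) (q v g : ℕ → E) : Prop where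
  pos : ∀ j, q (j + 1) = q j + h • v j - (h ^ 2 / 2) • g j
  vel : ∀ j, v (j + 1) = v j - (h / 2) • (g j + g (j + 1))

/-- The weights of the forces in the position after `j` Verlet steps. -/
def verletWeight (j i : ℕ) : ℝ := if i = 0 then j / 2 else j - i

theorem verletWeight_nonneg {j i : ℕ} (hij : i < j) : 0 ≤ verletWeight j i := by
  unfold verletWeight
  split_ifs
  · positivity
  · have : (i : ℝ) ≤ j := by exact_mod_cast hij.le
    linarith

/-- With step size h the total weight is (j h)² / 2, exactly as for twice-integrated forces in
continuous time, so the estimates carry no discretization error. -/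
theorem sum_verletWeight (j : ℕ) : ∑ i ∈ Finset.range j, verletWeight j i = (j : ℝ) ^ 2 / 2 := by
  rcases j with _ | m
  · simp
  · rw [Finset.sum_range_succ']
    have h1 : ∀ i ∈ Finset.range m, verletWeight (m + 1) (i + 1) = (m : ℝ) - i := by
      intro i _
      simp [verletWeight]
    rw [Finset.sum_congr rfl h1]
    have h2 : ∀ m : ℕ, ∑ i ∈ Finset.range m, ((m : ℝ) - i) = m * (m + 1) / 2 := by
      intro m
      induction m with
      | zero => simp
      | succ k ih =>
        rw [Finset.sum_range_succ]
        have : ∑ i ∈ Finset.range k, (((k + 1 : ℕ) : ℝ) - i) =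
            ∑ i ∈ Finset.range k, ((k : ℝ) - i) + k := by
          rw [← sub_eq_iff_eq_add', ← Finset.sum_sub_distrib]
          simp
        rw [this, ih]
        push_cast
        ring
    rw [h2]
    simp [verletWeight]
    ring

theorem IsVerlet.vel_eq {h : ℝ} {q v g : ℕ → E} (H : IsVerlet h q v g) (j : ℕ) :
    v j = v 0 - (h / 2) • g 0 - h • ∑ i ∈ Finset.range j, g (i + 1) + (h / 2) • g j := by
  induction j with
  | zero => simp
  | succ j ih =>
    rw [H.vel, Finset.sum_range_succ, ih]
    module

theorem IsVerlet.pos_eq_aux {h : ℝ} {q v g : ℕ → E} (H : IsVerlet h q v g) (j : ℕ) :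
    q j = q 0 + (j * h) • v 0 - h ^ 2 • (((j : ℝ) / 2) • g 0 +
      ∑ i ∈ Finset.range j, ((j : ℝ) - 1 - i) • g (i + 1)) := by
  induction j with
  | zero => simp
  | succ j ih =>
    have h1 : ∑ i ∈ Finset.range (j + 1), (((j + 1 : ℕ) : ℝ) - 1 - i) • g (i + 1) =
        ∑ i ∈ Finset.range j, ((j : ℝ) - 1 - i) • g (i + 1) +
          ∑ i ∈ Finset.range j, g (i + 1) := by
      rw [Finset.sum_range_succ, ← Finset.sum_add_distrib]
      have : (((j + 1 : ℕ) : ℝ) - 1 - j) = 0 := by push_cast; ring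
      rw [this, zero_smul, add_zero]
      refine Finset.sum_congr rfl fun i _ => ?_
      push_cast
      module
    rw [H.pos, h1, H.vel_eq j, ih]
    push_cast
    module

/-- A discrete Duhamel formula: the position is the free motion minus a nonnegative combination of
past forces, so force bounds in any seminorm become position bounds. -/
theorem IsVerlet.pos_eq {h : ℝ} {q v g : ℕ → E} (H : IsVerlet h q v g) (j : ℕ) :
    q j = q 0 + (j * h) • v 0 - h ^ 2 • ∑ i ∈ Finset.range j, verletWeight j i • g i := by
  rw [H.pos_eq_aux j]
  congr 2
  rcases j with _ | m
  · simp
  · rw [Finset.sum_range_succ, Finset.sum_range_succ' (fun i => verletWeight (m + 1) i • g i)]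
    have h1 : ∀ i ∈ Finset.range m, verletWeight (m + 1) (i + 1) • g (i + 1) =
        (((m + 1 : ℕ) : ℝ) - 1 - i) • g (i + 1) := by
      intro i _
      simp [verletWeight]
    rw [Finset.sum_congr rfl h1]
    simp [verletWeight, add_comm]

theorem IsVerlet.map {F : Type*} [NormedAddCommGroup F] [NormedSpace ℝ F] {h : ℝ}
    {q v g : ℕ → E} (H : IsVerlet h q v g) (A : E →ₗ[ℝ] F) :
    IsVerlet h (fun j => A (q j)) (fun j => A (v j)) (fun j => A (g j)) where
  pos j := by simp [H.pos j]
  vel j := by simp [H.vel j]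

theorem IsVerlet.sub {h : ℝ} {q v g q' v' g' : ℕ → E} (H : IsVerlet h q v g)
    (H' : IsVerlet h q' v' g') :
    IsVerlet h (fun j => q j - q' j) (fun j => v j - v' j) (fun j => g j - g' j) where
  pos j := by simp only [H.pos j, H'.pos j]; module
  vel j := by simp only [H.vel j, H'.vel j]; module

theorem seminorm_sum_verletWeight_le (p : Seminorm ℝ E) {g : ℕ → E} {C : ℝ} {j : ℕ}
    (hg : ∀ i < j, p (g i) ≤ C) :
    p (∑ i ∈ Finset.range j, verletWeight j i • g i) ≤ (j : ℝ) ^ 2 / 2 * C := by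
  have h1 : p (∑ i ∈ Finset.range j, verletWeight j i • g i) ≤
      ∑ i ∈ Finset.range j, p (verletWeight j i • g i) :=
    Finset.le_sum_of_subadditive p (map_zero p).le (map_add_le_add p) _ _
  refine h1.trans ?_
  rw [← sum_verletWeight, Finset.sum_mul]
  refine Finset.sum_le_sum fun i hi => ?_
  have hij := Finset.mem_range.1 hi
  rw [map_smul_eq_mul, Real.norm_of_nonneg (verletWeight_nonneg hij)]
  exact mul_le_mul_of_nonneg_left (hg i hij) (verletWeight_nonneg hij)

theorem IsVerlet.seminorm_sub_le {h : ℝ} {q v g : ℕ → E} (H : IsVerlet h q v g)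
    (p : Seminorm ℝ E) {C : ℝ} {j : ℕ} (hg : ∀ i < j, p (g i) ≤ C) :
    p (q j - (q 0 + (j * h) • v 0)) ≤ (j * h) ^ 2 / 2 * C := by
  have : q j - (q 0 + (j * h) • v 0) =
      (-h ^ 2) • ∑ i ∈ Finset.range j, verletWeight j i • g i := by
    rw [H.pos_eq j]
    module
  rw [this, map_smul_eq_mul, norm_neg, Real.norm_of_nonneg (sq_nonneg h)]
  refine (mul_le_mul_of_nonneg_left (seminorm_sum_verletWeight_le p hg) (sq_nonneg h)).trans
    (le_of_eq ?_)
  ring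

theorem seminorm_add_smul_le_max (p : Seminorm ℝ E) (x w : E) {t T : ℝ} (ht : 0 ≤ t)
    (htT : t ≤ T) : p (x + t • w) ≤ max (p x) (p (x + T • w)) := by
  rcases eq_or_lt_of_le (ht.trans htT) with hT | hT
  · have : t = 0 := le_antisymm (htT.trans hT.ge) ht
    simp [this]
  · have h1 : x + t • w = (1 - t / T) • x + (t / T) • (x + T • w) := by
      rw [smul_add, smul_smul, div_mul_cancel₀ _ hT.ne']
      module
    have h0 : 0 ≤ t / T := by positivity
    have h2 : t / T ≤ 1 := (div_le_one hT).2 htT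
    rw [h1]
    refine (map_add_le_add p _ _).trans ?_
    rw [map_smul_eq_mul, map_smul_eq_mul, Real.norm_of_nonneg (by linarith : 0 ≤ 1 - t / T),
      Real.norm_of_nonneg h0]
    have h3 := mul_le_mul_of_nonneg_left (le_max_left (p x) (p (x + T • w)))
      (by linarith : 0 ≤ 1 - t / T)
    have h4 := mul_le_mul_of_nonneg_left (le_max_right (p x) (p (x + T • w))) h0
    linarith

/-- A priori bound for a Verlet trajectory with perturbed linearly bounded forces. -/
theorem IsVerlet.seminorm_le {h : ℝ} {q v g : ℕ → E} (H : IsVerlet h q v g) (p : Seminorm ℝ E)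
    {Λ a : ℝ} {N : ℕ} (hh : 0 ≤ h) (hΛ : 0 ≤ Λ) (hT : Λ * (N * h) ^ 2 ≤ 1 / 6)
    (h0 : p (q 0) ≤ a) (h1 : p (q 0 + (N * h) • v 0) ≤ a) {C : ℝ} (hC : 0 ≤ C)
    (hg : ∀ i < N, p (g i) ≤ Λ * p (q i) + C) :
    (∀ j ≤ N, p (q j) ≤ 12 / 11 * (a + (N * h) ^ 2 / 2 * C)) ∧
    ∀ j ≤ N, p (q j - (q 0 + (j * h) • v 0)) ≤
      (N * h) ^ 2 / 2 * (Λ * (12 / 11 * (a + (N * h) ^ 2 / 2 * C)) + C) := by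
  have ha : 0 ≤ a := (apply_nonneg p _).trans h0
  -- Solution of b = a + b / 12 + T² C / 2 with T = N h. Since Λ T² / 2 ≤ 1 / 12, the bound
  -- reproduces itself by strong induction on time.
  set b := 12 / 11 * (a + (N * h) ^ 2 / 2 * C) with hb
  have hb0 : 0 ≤ b := by positivity
  have hjN : ∀ j ≤ N, ((j : ℝ) * h) ^ 2 ≤ (N * h) ^ 2 := fun j hj => by
    gcongr
  have hstep : ∀ j ≤ N, (∀ i < j, p (q i) ≤ b) →
      p (q j - (q 0 + (j * h) • v 0)) ≤ (N * h) ^ 2 / 2 * (Λ * b + C) := by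
    intro j hj hi
    refine (H.seminorm_sub_le p (C := Λ * b + C) fun i hij => ?_).trans ?_
    · refine (hg i (hij.trans_le hj)).trans ?_
      have := mul_le_mul_of_nonneg_left (hi i hij) hΛ
      linarith
    · have := hjN j hj
      gcongr
  have hmain : ∀ j ≤ N, p (q j) ≤ b := by
    intro j
    induction j using Nat.strong_induction_on with
    | _ j ih =>
      intro hj
      have h2 := hstep j hj fun i hij => ih i hij (hij.le.trans hj)
      have h3 := seminorm_add_smul_le_max p (q 0) (v 0) (t := j * h) (T := N * h) (by positivity)
        (by gcongr)
      have h4 := map_add_le_add p (q 0 + (j * h) • v 0) (q j - (q 0 + (j * h) • v 0))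
      rw [add_sub_cancel] at h4
      have h5 := h3.trans (max_le h0 h1)
      have h6 : (N * h) ^ 2 / 2 * (Λ * b + C) ≤ 1 / 12 * b + (N * h) ^ 2 / 2 * C := by
        nlinarith
      linarith
  exact ⟨hmain, fun j hj => hstep j hj fun i hij => hmain i (hij.le.trans hj)⟩

end Verlet

section VerletStep

variable {E : Type*} [NormedAddCommGroup E] [InnerProductSpace ℝ E] [FiniteDimensional ℝ E]

theorem isVerlet_iterate (U : E → ℝ) (h : ℝ) (p : E × E) :
    IsVerlet h (fun j => ((verletStep U h)^[j] p).1) (fun j => ((verletStep U h)^[j] p).2)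
      (fun j => gradient U ((verletStep U h)^[j] p).1) where
  pos j := by simp only [Function.iterate_succ_apply']; rfl
  vel j := by simp only [Function.iterate_succ_apply']; rfl

end VerletStep

/-! ### Seminorms on configurations and mean-field sums -/

section Config

variable {n k : ℕ}

/-- The seminorm `x ↦ ∑ᵢ |xⁱ|` on configurations. -/
def ell1Seminorm (n k : ℕ) : Seminorm ℝ (Config n k) :=
  Seminorm.of (fun x => ∑ i, ‖x i‖)
    (fun x y => by
      rw [← Finset.sum_add_distrib]
      exact Finset.sum_le_sum fun i _ => norm_add_le _ _)
    (fun a x => by simp [norm_smul, Finset.mul_sum])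

/-- The seminorm `x ↦ maxᵢ |xⁱ|` on configurations. -/
def supSeminorm (n k : ℕ) : Seminorm ℝ (Config n k) :=
  (normSeminorm ℝ (Fin n → EuclideanSpace ℝ (Fin k))).comp
    (WithLp.linearEquiv 2 ℝ (Fin n → EuclideanSpace ℝ (Fin k))).toLinearMap

/-- The projection on the `i`-th particle. -/
def particle (i : Fin n) : Config n k →L[ℝ] EuclideanSpace ℝ (Fin k) :=
  PiLp.proj 2 (fun _ : Fin n => EuclideanSpace ℝ (Fin k)) i

@[simp]
theorem particle_apply (i : Fin n) (x : Config n k) : particle i x = x i := rfl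

theorem ell1Seminorm_apply (x : Config n k) : ell1Seminorm n k x = ∑ i, ‖x i‖ := rfl

theorem ell1_eq (x y : Config n k) : ell1 x y = ell1Seminorm n k (x - y) := rfl

theorem supSeminorm_le_iff {x : Config n k} {c : ℝ} (hc : 0 ≤ c) :
    supSeminorm n k x ≤ c ↔ ∀ i, ‖x i‖ ≤ c :=
  pi_norm_le_iff_of_nonneg hc

theorem norm_apply_le_supSeminorm (x : Config n k) (i : Fin n) : ‖x i‖ ≤ supSeminorm n k x :=
  (supSeminorm_le_iff (apply_nonneg _ _)).1 le_rfl i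

theorem norm_le_ell1Seminorm (x : Config n k) : ‖x‖ ≤ ell1Seminorm n k x := by
  rw [PiLp.norm_eq_of_L2]
  refine Real.sqrt_le_iff.2 ⟨apply_nonneg _ _, ?_⟩
  exact Finset.sum_sq_le_sq_sum_of_nonneg fun i _ => norm_nonneg _

theorem supSeminorm_le_norm (x : Config n k) : supSeminorm n k x ≤ ‖x‖ :=
  (supSeminorm_le_iff (norm_nonneg _)).2 fun i => PiLp.norm_apply_le x i

theorem ell1Seminorm_le_mul_norm (x : Config n k) : ell1Seminorm n k x ≤ n * ‖x‖ := by
  have : ∑ i, ‖x i‖ ≤ ∑ _i : Fin n, ‖x‖ := Finset.sum_le_sum fun i _ => PiLp.norm_apply_le x i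
  rw [ell1Seminorm_apply]
  simpa using this

/-- Bounds for mean-field sums. -/
theorem norm_mean_field_sum_le {F : Type*} [NormedAddCommGroup F] [NormedSpace ℝ F] {ε B : ℝ}
    (hε : 0 ≤ ε) (hB : 0 ≤ B) (β : Fin n → Fin n → F) (s : Fin n → ℝ)
    (hs : ∀ i, 0 ≤ s i) (hβ : ∀ i l, ‖β i l‖ ≤ B * (s i + s l)) (i : Fin n) :
    ‖(ε / n) • ∑ l ∈ Finset.univ.erase i, β i l‖ ≤ ε * B * (s i + (∑ l, s l) / n) := by
  have hn : (0 : ℝ) < n := by exact_mod_cast (Fin.pos i)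
  have h1 : ‖∑ l ∈ Finset.univ.erase i, β i l‖ ≤ ∑ l, B * (s i + s l) := by
    refine (norm_sum_le _ _).trans ?_
    refine (Finset.sum_le_sum fun l _ => hβ i l).trans ?_
    exact Finset.sum_le_sum_of_subset_of_nonneg (Finset.subset_univ _) fun l _ _ =>
      mul_nonneg hB (add_nonneg (hs i) (hs l))
  rw [← Finset.mul_sum, Finset.sum_add_distrib] at h1
  simp only [Finset.sum_const, Finset.card_univ, Fintype.card_fin, nsmul_eq_mul] at h1
  rw [norm_smul, Real.norm_of_nonneg (by positivity)]
  refine (mul_le_mul_of_nonneg_left h1 (by positivity)).trans (le_of_eq ?_)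
  field_simp

/-- A mean summed over all particles returns the total. For this reason the interaction enters
`ell1` estimates with a factor free of `n`. -/
theorem sum_add_mean_eq (s : Fin n → ℝ) : ∑ i, (s i + (∑ l, s l) / n) = 2 * ∑ i, s i := by
  rcases Nat.eq_zero_or_pos n with rfl | hn
  · simp
  · have hn : (n : ℝ) ≠ 0 := by positivity
    rw [Finset.sum_add_distrib]
    simp only [Finset.sum_const, Finset.card_univ, Fintype.card_fin, nsmul_eq_mul]
    field_simp
    ring

end Config

/-! ### Gradients and their Lipschitz constants -/

section Smooth

variable {E : Type*} [NormedAddCommGroup E] [InnerProductSpace ℝ E] [FiniteDimensional ℝ E]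

theorem contDiff_gradient {U : E → ℝ} {m : ℕ} (hU : ContDiff ℝ (m + 1) U) :
    ContDiff ℝ m (gradient U) :=
  (InnerProductSpace.toDual ℝ E).symm.contDiff.comp (hU.fderiv_right (by norm_num))

theorem norm_iteratedFDeriv_gradient (U : E → ℝ) (m : ℕ) (x : E) :
    ‖iteratedFDeriv ℝ m (gradient U) x‖ = ‖iteratedFDeriv ℝ (m + 1) U x‖ := by
  rw [← norm_iteratedFDeriv_fderiv]
  exact (InnerProductSpace.toDual ℝ E).symm.norm_iteratedFDeriv_comp_left (fderiv ℝ U) x m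

theorem norm_fderiv_gradient_le {U : E → ℝ} {L : ℝ} (hL : ∀ x, ‖iteratedFDeriv ℝ 2 U x‖ ≤ L)
    (x : E) : ‖fderiv ℝ (gradient U) x‖ ≤ L := by
  rw [← norm_iteratedFDeriv_one, norm_iteratedFDeriv_gradient]
  exact hL x

theorem norm_gradient_sub_le {U : E → ℝ} (hU : ContDiff ℝ 3 U) {L : ℝ}
    (hL : ∀ x, ‖iteratedFDeriv ℝ 2 U x‖ ≤ L) (x y : E) :
    ‖gradient U x - gradient U y‖ ≤ L * ‖x - y‖ := by
  have hg : ContDiff ℝ (2 : ℕ) (gradient U) := contDiff_gradient (by exact_mod_cast hU)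
  exact Convex.norm_image_sub_le_of_norm_fderiv_le
    (fun z _ => hg.differentiable (by norm_num) z) (fun z _ => norm_fderiv_gradient_le hL z)
    convex_univ (Set.mem_univ y) (Set.mem_univ x)

theorem norm_fderiv_gradient_sub_le {U : E → ℝ} (hU : ContDiff ℝ 3 U) {M : ℝ}
    (hM : ∀ x, ‖iteratedFDeriv ℝ 3 U x‖ ≤ M) (x y : E) :
    ‖fderiv ℝ (gradient U) x - fderiv ℝ (gradient U) y‖ ≤ M * ‖x - y‖ := by
  have hg : ContDiff ℝ (2 : ℕ) (gradient U) := contDiff_gradient (by exact_mod_cast hU)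
  have hg' : ContDiff ℝ 1 (fderiv ℝ (gradient U)) := hg.fderiv_right (by norm_num)
  refine Convex.norm_image_sub_le_of_norm_fderiv_le
    (fun z _ => hg'.differentiable (by norm_num) z) (fun z _ => ?_)
    convex_univ (Set.mem_univ y) (Set.mem_univ x)
  rw [← norm_iteratedFDeriv_one, norm_iteratedFDeriv_fderiv, norm_iteratedFDeriv_gradient]
  exact hM z

end Smooth

/-! ### Force and Hessian of the mean-field potential -/

section MeanField

variable {n k : ℕ} {V W : EuclideanSpace ℝ (Fin k) → ℝ} {ε : ℝ}

theorem contDiff_apply_config (i : Fin n) {m : WithTop ℕ∞} :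
    ContDiff ℝ m (fun x : Config n k => x i) :=
  (particle i).contDiff

theorem contDiff_meanFieldPotential (hV : ContDiff ℝ 3 V) (hW : ContDiff ℝ 3 W) (ε : ℝ) (n : ℕ) :
    ContDiff ℝ 3 (meanFieldPotential V W ε n) := by
  unfold meanFieldPotential
  refine ContDiff.sum fun i _ => (hV.comp (contDiff_apply_config i)).add
    (contDiff_const.mul (ContDiff.sum fun l _ => hW.comp ?_))
  exact (contDiff_apply_config i).sub (contDiff_apply_config l)

theorem hasFDerivAt_of_gradient {f : EuclideanSpace ℝ (Fin k) → ℝ}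
    {x : EuclideanSpace ℝ (Fin k)} (hf : DifferentiableAt ℝ f x) :
    HasFDerivAt f (innerSL ℝ (gradient f x)) x := by
  have := hf.hasGradientAt.hasFDerivAt
  exact this

/-- `W` is not assumed even, so particle i feels two forces per partner: one from its own summand
and one, with opposite sign, from the summand of the partner. Exchanging the two particle sums
collects them. -/
theorem gradient_meanFieldPotential_apply (hV : ContDiff ℝ 3 V) (hW : ContDiff ℝ 3 W) (ε : ℝ)
    (x : Config n k) (i : Fin n) :
    gradient (meanFieldPotential V W ε n) x i = gradient V (x i) +
      (ε / n) • ∑ l ∈ Finset.univ.erase i,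
        (gradient W (x i - x l) - gradient W (x l - x i)) := by
  have hVd := hV.differentiable three_ne_zero
  have hWd := hW.differentiable three_ne_zero
  have h1 : HasFDerivAt (meanFieldPotential V W ε n)
      (∑ i, ((innerSL ℝ (gradient V (x i))).comp (particle i) + (ε / n) •
        ∑ l ∈ Finset.univ.erase i,
          (innerSL ℝ (gradient W (x i - x l))).comp (particle i - particle l))) x := by
    unfold meanFieldPotential
    refine HasFDerivAt.fun_sum fun i _ => HasFDerivAt.add ?_ (HasFDerivAt.const_mul
      (HasFDerivAt.fun_sum fun l _ => ?_) _)
    · exact (hasFDerivAt_of_gradient (hVd (x i))).comp x (particle i).hasFDerivAt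
    · exact (hasFDerivAt_of_gradient (hWd (x i - x l))).comp x
        ((particle i).hasFDerivAt.sub (particle l).hasFDerivAt)
  set F : Config n k := WithLp.toLp 2 fun i => gradient V (x i) +
      (ε / n) • ∑ l ∈ Finset.univ.erase i,
        (gradient W (x i - x l) - gradient W (x l - x i)) with hF
  suffices h : gradient (meanFieldPotential V W ε n) x = F by rw [h]
  refine HasGradientAt.gradient ?_
  rw [hasGradientAt_iff_hasFDerivAt]
  refine h1.congr_fderiv ?_
  ext w
  have hswap : ∑ i, ∑ l ∈ Finset.univ.erase i, inner ℝ (gradient W (x i - x l)) (w l) =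
      ∑ i, ∑ l ∈ Finset.univ.erase i, inner ℝ (gradient W (x l - x i)) (w i) := by
    refine Finset.sum_comm' fun i l => ?_
    simp [eq_comm]
  have hR : InnerProductSpace.toDual ℝ (Config n k) F w = ∑ i, inner ℝ (F i) (w i) := rfl
  rw [hR]
  simp only [hF, inner_add_left, inner_smul_left, sum_inner, inner_sub_left,
    Finset.sum_add_distrib, Finset.sum_sub_distrib, mul_sub, ← Finset.mul_sum]
  simp only [add_apply, smul_apply,
    ContinuousLinearMap.comp_apply, sum_apply,
    sub_apply, innerSL_apply_apply, particle_apply, inner_sub_right,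
    Finset.sum_sub_distrib, smul_eq_mul, mul_sub, ← Finset.mul_sum]
  rw [hswap]
  simp

/-- Lipschitz and smoothness constants of the two potentials. -/
structure MeanFieldBounds (V W : EuclideanSpace ℝ (Fin k) → ℝ) (L L' LH LH' : ℝ) : Prop where
  smoothV : ContDiff ℝ 3 V
  smoothW : ContDiff ℝ 3 W
  hessV : ∀ x, ‖iteratedFDeriv ℝ 2 V x‖ ≤ L
  hessW : ∀ x, ‖iteratedFDeriv ℝ 2 W x‖ ≤ L'
  thirdV : ∀ x, ‖iteratedFDeriv ℝ 3 V x‖ ≤ LH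
  thirdW : ∀ x, ‖iteratedFDeriv ℝ 3 W x‖ ≤ LH'

variable {L L' LH LH' : ℝ}

theorem MeanFieldBounds.L_nonneg (H : MeanFieldBounds V W L L' LH LH') : 0 ≤ L :=
  (norm_nonneg _).trans (H.hessV 0)

theorem MeanFieldBounds.L'_nonneg (H : MeanFieldBounds V W L L' LH LH') : 0 ≤ L' :=
  (norm_nonneg _).trans (H.hessW 0)

theorem MeanFieldBounds.LH_nonneg (H : MeanFieldBounds V W L L' LH LH') : 0 ≤ LH :=
  (norm_nonneg _).trans (H.thirdV 0)

theorem MeanFieldBounds.LH'_nonneg (H : MeanFieldBounds V W L L' LH LH') : 0 ≤ LH' :=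
  (norm_nonneg _).trans (H.thirdW 0)

/-- The gradient of the potential energy differs from the one of the confining potential by a
Lipschitz mean-field term. -/
theorem MeanFieldBounds.interaction_le (H : MeanFieldBounds V W L L' LH LH') (hε : 0 ≤ ε)
    (x y : Config n k) (i : Fin n) :
    ‖gradient (meanFieldPotential V W ε n) x i - gradient (meanFieldPotential V W ε n) y i -
      (gradient V (x i) - gradient V (y i))‖ ≤
      2 * (ε * L') * (‖x i - y i‖ + (∑ l, ‖x l - y l‖) / n) := by
  rw [gradient_meanFieldPotential_apply H.smoothV H.smoothW,
    gradient_meanFieldPotential_apply H.smoothV H.smoothW]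
  have e : ∀ a b c d : EuclideanSpace ℝ (Fin k), a + c - (b + d) - (a - b) = c - d := by
    intro a b c d; abel
  rw [e, ← smul_sub, ← Finset.sum_sub_distrib]
  refine (norm_mean_field_sum_le hε (B := 2 * L') (by linarith [H.L'_nonneg]) (fun i l =>
    gradient W (x i - x l) - gradient W (x l - x i) -
      (gradient W (y i - y l) - gradient W (y l - y i))) (fun i => ‖x i - y i‖)
    (fun i => norm_nonneg _) (fun i l => ?_) i).trans (le_of_eq (by ring))
  have h1 := norm_gradient_sub_le H.smoothW H.hessW (x i - x l) (y i - y l)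
  have h2 := norm_gradient_sub_le H.smoothW H.hessW (x l - x i) (y l - y i)
  have h3 : ‖x i - x l - (y i - y l)‖ ≤ ‖x i - y i‖ + ‖x l - y l‖ := by
    rw [show x i - x l - (y i - y l) = (x i - y i) - (x l - y l) by abel]
    exact norm_sub_le _ _
  have h4 : ‖x l - x i - (y l - y i)‖ ≤ ‖x i - y i‖ + ‖x l - y l‖ := by
    rw [show x l - x i - (y l - y i) = -((x i - y i) - (x l - y l)) by abel, norm_neg]
    exact norm_sub_le _ _
  have h5 := norm_sub_le (gradient W (x i - x l) - gradient W (y i - y l))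
    (gradient W (x l - x i) - gradient W (y l - y i))
  rw [show gradient W (x i - x l) - gradient W (x l - x i) -
      (gradient W (y i - y l) - gradient W (y l - y i)) =
      gradient W (x i - x l) - gradient W (y i - y l) -
        (gradient W (x l - x i) - gradient W (y l - y i)) by abel]
  have h6 := mul_le_mul_of_nonneg_left h3 H.L'_nonneg
  have h7 := mul_le_mul_of_nonneg_left h4 H.L'_nonneg
  linarith

theorem MeanFieldBounds.contDiff_gradient_potential (H : MeanFieldBounds V W L L' LH LH')
    (ε : ℝ) (n : ℕ) : ContDiff ℝ (2 : ℕ) (gradient (meanFieldPotential V W ε n)) :=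
  contDiff_gradient (m := 2) (by
    exact_mod_cast contDiff_meanFieldPotential H.smoothV H.smoothW ε n)

theorem MeanFieldBounds.differentiable_gradient_potential (H : MeanFieldBounds V W L L' LH LH')
    (ε : ℝ) (n : ℕ) : Differentiable ℝ (gradient (meanFieldPotential V W ε n)) :=
  (H.contDiff_gradient_potential ε n).differentiable two_ne_zero

theorem add_smul_sum_apply {ι E F : Type*} [NormedAddCommGroup E] [NormedSpace ℝ E]
    [NormedAddCommGroup F] [NormedSpace ℝ F] (A : E →L[ℝ] F) (c : ℝ) (s : Finset ι)
    (B : ι → E →L[ℝ] F) (w : E) : (A + c • ∑ l ∈ s, B l) w = A w + c • ∑ l ∈ s, B l w := by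
  simp

theorem hasFDerivAt_unique {E F : Type*} [NormedAddCommGroup E] [NormedSpace ℝ E]
    [NormedAddCommGroup F] [NormedSpace ℝ F] {f : E → F} {A B : E →L[ℝ] F} {x : E}
    (h1 : HasFDerivAt f A x) (h2 : HasFDerivAt f B x) : A = B := h1.unique h2

theorem hasFDerivAt_apply_particle {F : Config n k → Config n k} (hF : Differentiable ℝ F)
    (x : Config n k) (i : Fin n) :
    HasFDerivAt (fun x => F x i) ((particle i).comp (fderiv ℝ F x)) x :=
  (particle i).hasFDerivAt.comp x (hF x).hasFDerivAt

theorem MeanFieldBounds.hasFDerivAt_force (H : MeanFieldBounds V W L L' LH LH')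
    (ε : ℝ) (x : Config n k) (i : Fin n) :
    HasFDerivAt (fun x : Config n k => gradient V (x i) +
      (ε / n) • ∑ l ∈ Finset.univ.erase i,
        (gradient W (x i - x l) - gradient W (x l - x i)))
      ((fderiv ℝ (gradient V) (x i)).comp (particle i) + (ε / n : ℝ) •
        ∑ l ∈ Finset.univ.erase i,
        ((fderiv ℝ (gradient W) (x i - x l)).comp (particle i - particle l) -
          (fderiv ℝ (gradient W) (x l - x i)).comp (particle l - particle i))) x := by
  have hgV : Differentiable ℝ (gradient V) := (contDiff_gradient (m := 2)
    (by exact_mod_cast H.smoothV)).differentiable two_ne_zero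
  have hgW : Differentiable ℝ (gradient W) := (contDiff_gradient (m := 2)
    (by exact_mod_cast H.smoothW)).differentiable two_ne_zero
  have hf : ∀ i l : Fin n, HasFDerivAt (fun x : Config n k => x i - x l)
      (particle i - particle l) x := fun i l => by
    have := (particle (n := n) (k := k) i).hasFDerivAt (x := x)
    exact this.fun_sub (particle l).hasFDerivAt
  have hfi : HasFDerivAt (fun x : Config n k => x i) (particle i) x := (particle i).hasFDerivAt
  have hp : ∀ i l : Fin n, HasFDerivAt (fun x : Config n k => gradient W (x i - x l))
      ((fderiv ℝ (gradient W) (x i - x l)).comp (particle i - particle l)) x := fun i l =>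
    HasFDerivAt.comp (f := fun x : Config n k => x i - x l) x (hgW _).hasFDerivAt (hf i l)
  have hv : HasFDerivAt (fun x : Config n k => gradient V (x i))
      ((fderiv ℝ (gradient V) (x i)).comp (particle i)) x :=
    HasFDerivAt.comp (f := fun x : Config n k => x i) x (hgV _).hasFDerivAt hfi
  have hs : HasFDerivAt (fun x : Config n k => ∑ l ∈ Finset.univ.erase i,
        (gradient W (x i - x l) - gradient W (x l - x i)))
      (∑ l ∈ Finset.univ.erase i,
        ((fderiv ℝ (gradient W) (x i - x l)).comp (particle i - particle l) -
          (fderiv ℝ (gradient W) (x l - x i)).comp (particle l - particle i))) x :=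
    HasFDerivAt.fun_sum fun l _ => (hp i l).fun_sub (hp l i)
  exact hv.fun_add (hs.fun_const_smul (ε / n))

/-- The Hessian of the mean-field potential. -/
theorem MeanFieldBounds.fderiv_gradient_apply (H : MeanFieldBounds V W L L' LH LH')
    (ε : ℝ) (x w : Config n k) (i : Fin n) :
    fderiv ℝ (gradient (meanFieldPotential V W ε n)) x w i =
      fderiv ℝ (gradient V) (x i) (w i) + (ε / n) • ∑ l ∈ Finset.univ.erase i,
        (fderiv ℝ (gradient W) (x i - x l) (w i - w l) -
          fderiv ℝ (gradient W) (x l - x i) (w l - w i)) := by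
  have h3 : (fun x => gradient (meanFieldPotential V W ε n) x i) =
      (fun x : Config n k => gradient V (x i) + (ε / n) • ∑ l ∈ Finset.univ.erase i,
        (gradient W (x i - x l) - gradient W (x l - x i))) := by
    ext1 x
    exact gradient_meanFieldPotential_apply H.smoothV H.smoothW ε x i
  have h2 := H.hasFDerivAt_force ε x i
  rw [← h3] at h2
  have h1 := hasFDerivAt_apply_particle (H.differentiable_gradient_potential ε n) x i
  have h4 := DFunLike.congr_fun (hasFDerivAt_unique h1 h2) w
  rw [add_smul_sum_apply] at h4
  exact h4

theorem norm_fderiv_gradient_apply_le {U : EuclideanSpace ℝ (Fin k) → ℝ} {L : ℝ}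
    (hL : ∀ x, ‖iteratedFDeriv ℝ 2 U x‖ ≤ L) (x w : EuclideanSpace ℝ (Fin k)) :
    ‖fderiv ℝ (gradient U) x w‖ ≤ L * ‖w‖ :=
  ((fderiv ℝ (gradient U) x).le_opNorm w).trans
    (mul_le_mul_of_nonneg_right (norm_fderiv_gradient_le hL x) (norm_nonneg _))

theorem MeanFieldBounds.norm_hess_apply_le (H : MeanFieldBounds V W L L' LH LH') (hε : 0 ≤ ε)
    (x w : Config n k) (i : Fin n) :
    ‖fderiv ℝ (gradient (meanFieldPotential V W ε n)) x w i‖ ≤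
      L * ‖w i‖ + ε * (2 * L') * (‖w i‖ + (∑ l, ‖w l‖) / n) := by
  rw [H.fderiv_gradient_apply]
  refine (norm_add_le _ _).trans (add_le_add (norm_fderiv_gradient_apply_le H.hessV _ _) ?_)
  refine norm_mean_field_sum_le hε (B := 2 * L') (by linarith [H.L'_nonneg]) (fun i l =>
    fderiv ℝ (gradient W) (x i - x l) (w i - w l) - fderiv ℝ (gradient W) (x l - x i) (w l - w i))
    (fun i => ‖w i‖) (fun i => norm_nonneg _) (fun i l => ?_) i
  have h1 := norm_fderiv_gradient_apply_le H.hessW (x i - x l) (w i - w l)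
  have h2 := norm_fderiv_gradient_apply_le H.hessW (x l - x i) (w l - w i)
  have h3 := mul_le_mul_of_nonneg_left (norm_sub_le (w i) (w l)) H.L'_nonneg
  rw [norm_sub_rev (w l)] at h2
  refine (norm_sub_le _ _).trans ?_
  linarith

/-- The two `W`-terms of each pair give `2 * L'`, and summing particle plus mean doubles this to the
factor 4. -/
theorem MeanFieldBounds.ell1_hess_le (H : MeanFieldBounds V W L L' LH LH') (hε : 0 ≤ ε)
    (x w : Config n k) :
    ell1Seminorm n k (fderiv ℝ (gradient (meanFieldPotential V W ε n)) x w) ≤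
      (L + 4 * ε * L') * ell1Seminorm n k w := by
  rw [ell1Seminorm_apply, ell1Seminorm_apply]
  refine (Finset.sum_le_sum fun i _ => H.norm_hess_apply_le hε x w i).trans (le_of_eq ?_)
  rw [Finset.sum_add_distrib, ← Finset.mul_sum, ← Finset.mul_sum, sum_add_mean_eq]
  ring

theorem norm_fderiv_gradient_sub_apply_le {U : EuclideanSpace ℝ (Fin k) → ℝ}
    (hU : ContDiff ℝ 3 U) {M : ℝ} (hM : ∀ x, ‖iteratedFDeriv ℝ 3 U x‖ ≤ M)
    (x y w : EuclideanSpace ℝ (Fin k)) :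
    ‖fderiv ℝ (gradient U) x w - fderiv ℝ (gradient U) y w‖ ≤ M * ‖x - y‖ * ‖w‖ := by
  rw [← sub_apply]
  exact ((fderiv ℝ (gradient U) x - fderiv ℝ (gradient U) y).le_opNorm w).trans
    (mul_le_mul_of_nonneg_right (norm_fderiv_gradient_sub_le hU hM x y) (norm_nonneg _))

/-- The displacement is measured by its largest particle and `w` by the sum. This mixed form later
makes the compensating velocity Lipschitz from the sup-norm to `ell1`. The factor 8 exceeds the 4 of
the Hessian bound because a pair difference moves by up to twice the largest displacement. -/
theorem MeanFieldBounds.ell1_hess_sub_le (H : MeanFieldBounds V W L L' LH LH') (hε : 0 ≤ ε)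
    (x y w : Config n k) :
    ell1Seminorm n k (fderiv ℝ (gradient (meanFieldPotential V W ε n)) x w -
      fderiv ℝ (gradient (meanFieldPotential V W ε n)) y w) ≤
      (LH + 8 * ε * LH') * supSeminorm n k (x - y) * ell1Seminorm n k w := by
  set c := supSeminorm n k (x - y) with hc
  have hc0 : 0 ≤ c := apply_nonneg _ _
  have hxy : ∀ i, ‖x i - y i‖ ≤ c := fun i => norm_apply_le_supSeminorm (x - y) i
  have hi : ∀ i, ‖(fderiv ℝ (gradient (meanFieldPotential V W ε n)) x w -
      fderiv ℝ (gradient (meanFieldPotential V W ε n)) y w) i‖ ≤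
      LH * c * ‖w i‖ + ε * (4 * LH' * c) * (‖w i‖ + (∑ l, ‖w l‖) / n) := by
    intro i
    rw [PiLp.sub_apply, H.fderiv_gradient_apply, H.fderiv_gradient_apply, add_sub_add_comm,
      ← smul_sub, ← Finset.sum_sub_distrib]
    refine (norm_add_le _ _).trans (add_le_add ?_ ?_)
    · refine (norm_fderiv_gradient_sub_apply_le H.smoothV H.thirdV _ _ _).trans ?_
      exact mul_le_mul_of_nonneg_right (mul_le_mul_of_nonneg_left (hxy i) H.LH_nonneg)
        (norm_nonneg _)
    · refine norm_mean_field_sum_le hε (B := 4 * LH' * c)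
        (mul_nonneg (by linarith [H.LH'_nonneg]) hc0) (fun i l =>
        fderiv ℝ (gradient W) (x i - x l) (w i - w l) -
          fderiv ℝ (gradient W) (x l - x i) (w l - w i) -
        (fderiv ℝ (gradient W) (y i - y l) (w i - w l) -
          fderiv ℝ (gradient W) (y l - y i) (w l - w i)))
        (fun i => ‖w i‖) (fun i => norm_nonneg _) (fun i l => ?_) i
      have hd : ∀ i l, ‖x i - x l - (y i - y l)‖ ≤ 2 * c := by
        intro i l
        rw [show x i - x l - (y i - y l) = (x i - y i) - (x l - y l) by abel]
        refine (norm_sub_le _ _).trans ?_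
        linarith [hxy i, hxy l]
      have h0 : ∀ i l, ‖fderiv ℝ (gradient W) (x i - x l) (w i - w l) -
          fderiv ℝ (gradient W) (y i - y l) (w i - w l)‖ ≤ LH' * (2 * c) * (‖w i‖ + ‖w l‖) := by
        intro i l
        refine (norm_fderiv_gradient_sub_apply_le H.smoothW H.thirdW _ _ _).trans ?_
        have := H.LH'_nonneg
        gcongr
        · exact hd i l
        · exact norm_sub_le _ _
      rw [sub_sub_sub_comm]
      refine (norm_sub_le _ _).trans ((add_le_add (h0 i l) (h0 l i)).trans (le_of_eq ?_))
      ring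
  rw [ell1Seminorm_apply, ell1Seminorm_apply]
  refine (Finset.sum_le_sum fun i _ => hi i).trans (le_of_eq ?_)
  rw [Finset.sum_add_distrib, ← Finset.mul_sum, ← Finset.mul_sum, sum_add_mean_eq]
  ring

theorem MeanFieldBounds.norm_gradient_sub_apply_le (H : MeanFieldBounds V W L L' LH LH')
    (hε : 0 ≤ ε) (x y : Config n k) (i : Fin n) :
    ‖gradient (meanFieldPotential V W ε n) x i - gradient (meanFieldPotential V W ε n) y i‖ ≤
      L * ‖x i - y i‖ + 2 * (ε * L') * (‖x i - y i‖ + (∑ l, ‖x l - y l‖) / n) := by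
  have h1 := H.interaction_le hε x y i
  have h2 := norm_gradient_sub_le H.smoothV H.hessV (x i) (y i)
  have h3 := norm_add_le (gradient V (x i) - gradient V (y i))
    (gradient (meanFieldPotential V W ε n) x i - gradient (meanFieldPotential V W ε n) y i -
      (gradient V (x i) - gradient V (y i)))
  rw [add_sub_cancel] at h3
  linarith

theorem MeanFieldBounds.ell1_gradient_sub_le (H : MeanFieldBounds V W L L' LH LH')
    (hε : 0 ≤ ε) (x y : Config n k) :
    ell1Seminorm n k (gradient (meanFieldPotential V W ε n) x -
      gradient (meanFieldPotential V W ε n) y) ≤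
      (L + 4 * ε * L') * ell1Seminorm n k (x - y) := by
  rw [ell1Seminorm_apply, ell1Seminorm_apply]
  refine (Finset.sum_le_sum fun i _ => H.norm_gradient_sub_apply_le hε x y i).trans (le_of_eq ?_)
  simp only [PiLp.sub_apply]
  rw [Finset.sum_add_distrib, ← Finset.mul_sum, ← Finset.mul_sum, sum_add_mean_eq]
  ring

theorem MeanFieldBounds.sup_gradient_sub_le (H : MeanFieldBounds V W L L' LH LH')
    (hε : 0 ≤ ε) (x y : Config n k) :
    supSeminorm n k (gradient (meanFieldPotential V W ε n) x -
      gradient (meanFieldPotential V W ε n) y) ≤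
      (L + 4 * ε * L') * supSeminorm n k (x - y) := by
  set c := supSeminorm n k (x - y) with hc
  have hc0 : 0 ≤ c := apply_nonneg _ _
  have hL := H.L_nonneg
  have hL' := mul_nonneg hε H.L'_nonneg
  have hxy : ∀ i, ‖x i - y i‖ ≤ c := fun i => norm_apply_le_supSeminorm (x - y) i
  refine (supSeminorm_le_iff (mul_nonneg (by linarith) hc0)).2 fun i => ?_
  have hn : (0 : ℝ) < n := by exact_mod_cast (Fin.pos i)
  have hmean : (∑ l, ‖x l - y l‖) / n ≤ c := by
    rw [div_le_iff₀ hn]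
    refine (Finset.sum_le_sum fun l _ => hxy l).trans (le_of_eq ?_)
    simp [mul_comm]
  refine (H.norm_gradient_sub_apply_le hε x y i).trans ?_
  have h1 := mul_le_mul_of_nonneg_left (hxy i) hL
  have h2 := mul_le_mul_of_nonneg_left (add_le_add (hxy i) hmean)
    (by linarith : 0 ≤ 2 * (ε * L'))
  linarith

end MeanField

/-! ### Total variation from smooth test functions -/

section Approximation

open scoped Manifold ContDiff

variable {E : Type*} [NormedAddCommGroup E] [InnerProductSpace ℝ E] [FiniteDimensional ℝ E]
  [MeasurableSpace E] [BorelSpace E]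

theorem exists_contDiff_bump {K O : Set E} (hK : IsCompact K) (hO : IsOpen O) (hKO : K ⊆ O) :
    ∃ g : E → ℝ, ContDiff ℝ 1 g ∧ HasCompactSupport g ∧ (∀ x, 0 ≤ g x ∧ g x ≤ 1) ∧
      (∀ x ∈ K, g x = 1) ∧ ∀ x ∉ O, g x = 0 := by
  obtain ⟨r, hr⟩ := hK.isBounded.subset_ball (0 : E)
  obtain ⟨f, hf0, hf1, hf⟩ := exists_contMDiffMap_zero_one_of_isClosed (n := 1) 𝓘(ℝ, E)
    (s := (O ∩ Metric.ball 0 r)ᶜ) (t := K) (hO.inter Metric.isOpen_ball).isClosed_compl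
    hK.isClosed (Set.disjoint_left.2 fun x hx hxK => hx ⟨hKO hxK, hr hxK⟩)
  refine ⟨f, f.contMDiff.contDiff, ?_, fun x => hf x, fun x hx => hf1 hx, fun x hx => hf0 fun h => hx h.1⟩
  refine HasCompactSupport.of_support_subset_isCompact (isCompact_closedBall (0 : E) r) fun x hx => ?_
  by_contra hc
  exact hx (hf0 fun h => hc (Metric.ball_subset_closedBall h.2))

/-- A compact K inside A carries almost all of μ(A), an open set around K has ν-mass close to ν(K),
and a bump function between the two compares them. -/
theorem measureReal_le_of_forall_contDiff {μ ν : Measure E} [IsProbabilityMeasure μ]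
    [IsProbabilityMeasure ν] {δ : ℝ}
    (h : ∀ g : E → ℝ, ContDiff ℝ 1 g → HasCompactSupport g → (∀ x, 0 ≤ g x ∧ g x ≤ 1) →
      ∫ x, g x ∂μ - ∫ x, g x ∂ν ≤ δ) {A : Set E} (hA : MeasurableSet A) :
    μ.real A - ν.real A ≤ δ := by
  refine le_of_forall_pos_le_add fun η hη => ?_
  have hη2 : ENNReal.ofReal (η / 2) ≠ 0 := by simpa using hη
  obtain ⟨K, hKA, hK, hμK⟩ := hA.exists_isCompact_lt_add (measure_ne_top μ A) hη2
  obtain ⟨O, hKO, hO, hνO⟩ := K.exists_isOpen_lt_add (measure_ne_top ν K) hη2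
  obtain ⟨g, hg1, hg2, hg3, hg4, hg5⟩ := exists_contDiff_bump hK hO hKO
  have h0 := h g hg1 hg2 hg3
  have hgi : ∀ ρ : Measure E, IsProbabilityMeasure ρ → Integrable g ρ := fun ρ _ =>
    hg1.continuous.integrable_of_hasCompactSupport hg2
  have h1 : μ.real K ≤ ∫ x, g x ∂μ := by
    rw [← integral_indicator_one hK.measurableSet]
    refine integral_mono ((integrable_const (1 : ℝ)).indicator hK.measurableSet)
      (hgi μ inferInstance) fun x => ?_
    by_cases hx : x ∈ K
    · simp [hx, hg4 x hx]
    · simp [hx, (hg3 x).1]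
  have h2 : ∫ x, g x ∂ν ≤ ν.real O := by
    rw [← integral_indicator_one hO.measurableSet]
    refine integral_mono (hgi ν inferInstance)
      ((integrable_const (1 : ℝ)).indicator hO.measurableSet) fun x => ?_
    by_cases hx : x ∈ O
    · simp [hx, (hg3 x).2]
    · simp [hx, hg5 x hx]
  have h3 : μ.real A ≤ μ.real K + η / 2 := by
    have := ENNReal.toReal_mono (by finiteness) hμK.le
    rwa [ENNReal.toReal_add (by finiteness) (by finiteness),
      ENNReal.toReal_ofReal (by positivity)] at this
  have h4 : ν.real O ≤ ν.real K + η / 2 := by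
    have := ENNReal.toReal_mono (by finiteness) hνO.le
    rwa [ENNReal.toReal_add (by finiteness) (by finiteness),
      ENNReal.toReal_ofReal (by positivity)] at this
  have h5 : ν.real K ≤ ν.real A := measureReal_mono hKA
  linarith

end Approximation

/-! ### First variation of Verlet trajectories -/

section Variation

variable {E : Type*} [NormedAddCommGroup E] [InnerProductSpace ℝ E] [FiniteDimensional ℝ E]

/-- Bounds on the Hessian of a potential with respect to two dual seminorms. -/
structure HessianBounds (U : E → ℝ) (p r : Seminorm ℝ E) (Λ ΛH c : ℝ) : Prop where
  smooth : ContDiff ℝ 1 (gradient U)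
  nonneg : 0 ≤ Λ
  nonneg' : 0 ≤ ΛH
  hess : ∀ x w, p (fderiv ℝ (gradient U) x w) ≤ Λ * p w
  grad_sub : ∀ x y, r (gradient U x - gradient U y) ≤ Λ * r (x - y)
  hess_sub : ∀ x y w, p (fderiv ℝ (gradient U) x w - fderiv ℝ (gradient U) y w) ≤
    ΛH * r (x - y) * p w
  norm_le : ∀ x, ‖x‖ ≤ p x
  le_norm : ∀ x, p x ≤ c * ‖x‖
  sup_le : ∀ x, r x ≤ ‖x‖

theorem contDiff_verletStep {U : E → ℝ} (hU : ContDiff ℝ 1 (gradient U)) (h : ℝ) :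
    ContDiff ℝ 1 (verletStep U h) := by
  unfold verletStep
  fun_prop

theorem contDiff_verletStep_iterate {U : E → ℝ} (hU : ContDiff ℝ 1 (gradient U)) (h : ℝ) (j : ℕ) :
    ContDiff ℝ 1 (verletStep U h)^[j] := by
  induction j with
  | zero => exact contDiff_id
  | succ j ih =>
    rw [Function.iterate_succ']
    exact (contDiff_verletStep hU h).comp ih

theorem fderiv_verletStep {U : E → ℝ} (hU : ContDiff ℝ 1 (gradient U)) (h : ℝ) (p d : E × E) :
    (fderiv ℝ (verletStep U h) p d).1 =
      d.1 + h • d.2 - (h ^ 2 / 2) • fderiv ℝ (gradient U) p.1 d.1 ∧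
    (fderiv ℝ (verletStep U h) p d).2 =
      d.2 - (h / 2) • (fderiv ℝ (gradient U) p.1 d.1 +
        fderiv ℝ (gradient U) (verletStep U h p).1 (fderiv ℝ (verletStep U h) p d).1) := by
  have hd := hU.differentiable one_ne_zero
  have h1 : HasFDerivAt (fun p : E × E => gradient U p.1)
      ((fderiv ℝ (gradient U) p.1).comp (ContinuousLinearMap.fst ℝ E E)) p :=
    (hd p.1).hasFDerivAt.comp p hasFDerivAt_fst
  have h2 : HasFDerivAt (fun p : E × E => p.1 + h • p.2 - (h ^ 2 / 2) • gradient U p.1)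
      (ContinuousLinearMap.fst ℝ E E + h • ContinuousLinearMap.snd ℝ E E - (h ^ 2 / 2) •
        (fderiv ℝ (gradient U) p.1).comp (ContinuousLinearMap.fst ℝ E E)) p :=
    (hasFDerivAt_fst.fun_add (hasFDerivAt_snd.fun_const_smul h)).fun_sub (h1.fun_const_smul _)
  have h3 : HasFDerivAt (fun p : E × E =>
      gradient U (p.1 + h • p.2 - (h ^ 2 / 2) • gradient U p.1)) _ p :=
    HasFDerivAt.comp (f := fun p : E × E => p.1 + h • p.2 - (h ^ 2 / 2) • gradient U p.1) p
      (hd _).hasFDerivAt h2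
  have h4 : HasFDerivAt (verletStep U h) _ p :=
    h2.prodMk (hasFDerivAt_snd.fun_sub ((h1.fun_add h3).fun_const_smul (h / 2)))
  rw [h4.fderiv]
  exact ⟨rfl, rfl⟩

/-- The first variation of a Verlet trajectory is itself a Verlet trajectory. -/
theorem isVerlet_fderiv {U : E → ℝ} (hU : ContDiff ℝ 1 (gradient U)) (h : ℝ) (p d : E × E) :
    IsVerlet h (fun j => (fderiv ℝ (verletStep U h)^[j] p d).1)
      (fun j => (fderiv ℝ (verletStep U h)^[j] p d).2)
      (fun j => fderiv ℝ (gradient U) ((verletStep U h)^[j] p).1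
        (fderiv ℝ (verletStep U h)^[j] p d).1) := by
  have hs : ∀ j, fderiv ℝ (verletStep U h)^[j + 1] p d =
      fderiv ℝ (verletStep U h) ((verletStep U h)^[j] p) (fderiv ℝ (verletStep U h)^[j] p d) := by
    intro j
    rw [Function.iterate_succ', fderiv_comp p
      ((contDiff_verletStep hU h).differentiable one_ne_zero _)
      ((contDiff_verletStep_iterate hU h j).differentiable one_ne_zero _)]
    rfl
  constructor
  · intro j
    simp only [hs]
    exact (fderiv_verletStep hU h _ _).1
  · intro j
    simp only [hs, Function.iterate_succ_apply']
    exact (fderiv_verletStep hU h _ _).2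

variable {U : E → ℝ} {p r : Seminorm ℝ E} {Λ ΛH c : ℝ}

/-- The variation is a Verlet trajectory with linear forces, so the a priori bound applies with C =
0; the deviation from free motion is at most 1/12 · 12/11 = 1/11 of `a`. -/
theorem HessianBounds.variation_le (H : HessianBounds U p r Λ ΛH c) {h : ℝ} {N : ℕ} (hh : 0 ≤ h)
    (hT : Λ * (N * h) ^ 2 ≤ 1 / 6) (z d : E × E) {a : ℝ} (h0 : p d.1 ≤ a)
    (h1 : p (d.1 + (N * h) • d.2) ≤ a) :
    (∀ j ≤ N, p (fderiv ℝ (verletStep U h)^[j] z d).1 ≤ 12 / 11 * a) ∧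
      p ((fderiv ℝ (verletStep U h)^[N] z d).1 - (d.1 + (N * h) • d.2)) ≤ 1 / 11 * a := by
  have ha : 0 ≤ a := (apply_nonneg p _).trans h0
  have := (isVerlet_fderiv H.smooth h z d).seminorm_le p (a := a) hh H.nonneg hT
    (by simpa using h0) (by simpa using h1) (C := 0) le_rfl
    (fun i _ => by simpa using H.hess _ _)
  refine ⟨fun j hj => (this.1 j hj).trans (le_of_eq (by ring)), ?_⟩
  have h2 := this.2 N le_rfl
  simp only [Function.iterate_zero, fderiv_id, ContinuousLinearMap.id_apply] at h2
  refine h2.trans ?_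
  nlinarith

/-- The derivative of the final position with respect to the initial velocity is onto. -/
theorem HessianBounds.exists_velocity (H : HessianBounds U p r Λ ΛH c) {h : ℝ} {N : ℕ}
    (hh : 0 < h) (hN : 0 < N) (hT : Λ * (N * h) ^ 2 ≤ 1 / 6) (z : E × E) (e : E) :
    ∃ u, (fderiv ℝ (verletStep U h)^[N] z (e, u)).1 = 0 := by
  have hTpos : 0 < N * h := by positivity
  set A : E →ₗ[ℝ] E := (LinearMap.fst ℝ E E).comp
    ((fderiv ℝ (verletStep U h)^[N] z).toLinearMap.comp (LinearMap.inr ℝ E E)) with hA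
  have hAw : ∀ w, A w = (fderiv ℝ (verletStep U h)^[N] z (0, w)).1 := fun w => rfl
  -- Free motion carries w to T w and the correction is at most a fraction 1/11 of it, so the kernel
  -- is trivial; in finite dimension the map is then onto.
  have hinj : Function.Injective A := by
    rw [injective_iff_map_eq_zero]
    intro w hw
    have h1 := (H.variation_le hh.le hT z (0, w) (a := N * h * p w)
      (by simp; positivity) (by simp [map_smul_eq_mul, abs_of_pos hh])).2
    rw [← hAw, hw, zero_sub, map_neg_eq_map, zero_add, map_smul_eq_mul,
      Real.norm_of_nonneg hTpos.le] at h1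
    have h2 : p w ≤ 0 := by
      by_contra hc
      push Not at hc
      have := mul_pos hTpos hc
      linarith
    exact norm_le_zero_iff.1 ((H.norm_le w).trans h2)
  obtain ⟨u, hu⟩ := LinearMap.surjective_of_injective hinj
    (-(fderiv ℝ (verletStep U h)^[N] z (e, 0)).1)
  refine ⟨u, ?_⟩
  have h3 : ((e, u) : E × E) = (e, 0) + (0, u) := by simp
  rw [h3, map_add, Prod.fst_add, ← hAw, hu]
  simp

/-- The variation ends at zero, so the free endpoint e + T u is at most 1/11 of the larger of p(e)
and p(e + T u). The maximum must then be p(e), whence T p(u) ≤ (1 + 1/11) p(e). -/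
theorem HessianBounds.velocity_le (H : HessianBounds U p r Λ ΛH c) {h : ℝ} {N : ℕ} (hh : 0 < h)
    (hN : 0 < N) (hT : Λ * (N * h) ^ 2 ≤ 1 / 6) (z : E × E) {e u : E}
    (hu : (fderiv ℝ (verletStep U h)^[N] z (e, u)).1 = 0) :
    p u ≤ 12 / 11 / (N * h) * p e ∧
      ∀ j ≤ N, p (fderiv ℝ (verletStep U h)^[j] z (e, u)).1 ≤ 12 / 11 * p e := by
  have hTpos : 0 < N * h := by positivity
  have h1 := H.variation_le hh.le hT z (e, u) (a := max (p e) (p (e + (N * h) • u)))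
    (le_max_left _ _) (le_max_right _ _)
  have h2 := h1.2
  rw [hu, zero_sub, map_neg_eq_map] at h2
  simp only at h2
  have hpe : 0 ≤ p e := apply_nonneg _ _
  have hmax : max (p e) (p (e + (N * h) • u)) = p e := by
    refine max_eq_left ?_
    by_contra hc
    push Not at hc
    rw [max_eq_right hc.le] at h2
    linarith
  rw [hmax] at h1 h2
  refine ⟨?_, h1.1⟩
  have h3 : (N * h) * p u ≤ 12 / 11 * p e := by
    have := map_sub_le_add p (e + (N * h) • u) e
    rw [add_sub_cancel_left, map_smul_eq_mul, Real.norm_of_nonneg hTpos.le] at this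
    linarith
  rw [div_mul_eq_mul_div, le_div_iff₀ hTpos]
  linarith

/-- Both variations start at e and end at zero, so their difference starts with velocity u - u' from
the origin and returns to it. Only the inhomogeneous force due to the change of the Hessian can
achieve this, and that force is proportional to r(ξ - ξ') p(e). -/
theorem HessianBounds.velocity_sub_le (H : HessianBounds U p r Λ ΛH c) {h : ℝ} {N : ℕ}
    (hh : 0 < h) (hN : 0 < N) (hT : Λ * (N * h) ^ 2 ≤ 1 / 6) (x ξ ξ' : E) {e u u' : E}
    (hu : (fderiv ℝ (verletStep U h)^[N] (x, ξ) (e, u)).1 = 0)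
    (hu' : (fderiv ℝ (verletStep U h)^[N] (x, ξ') (e, u')).1 = 0) :
    p (u - u') ≤ 3 / 4 * ΛH * (N * h) ^ 2 * p e * r (ξ - ξ') := by
  have hTpos : 0 < N * h := by positivity
  have hT0 := hTpos.le
  have hr0 : 0 ≤ r (ξ - ξ') := apply_nonneg _ _
  have hpe : 0 ≤ p e := apply_nonneg _ _
  have hq := ((isVerlet_iterate U h (x, ξ)).sub (isVerlet_iterate U h (x, ξ'))).seminorm_le r
    (a := N * h * r (ξ - ξ')) hh.le H.nonneg hT (by simpa using mul_nonneg hT0 hr0)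
    (by simp [map_smul_eq_mul, abs_of_pos hh]) (C := 0) le_rfl
    (fun i _ => by simpa using H.grad_sub _ _)
  have hz' := (H.velocity_le hh hN hT (x, ξ') hu').2
  set C := ΛH * (12 / 11 * (N * h * r (ξ - ξ'))) * (12 / 11 * p e) with hC
  have hC0 : 0 ≤ C := by have := H.nonneg'; positivity
  have hy := ((isVerlet_fderiv H.smooth h (x, ξ) (e, u)).sub
    (isVerlet_fderiv H.smooth h (x, ξ') (e, u'))).seminorm_le p (a := N * h * p (u - u'))
    hh.le H.nonneg hT (by simpa using mul_nonneg hT0 (apply_nonneg p _))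
    (by simp [map_smul_eq_mul, abs_of_pos hh]) (C := C) hC0 (fun i hi => by
      set q := ((verletStep U h)^[i] (x, ξ)).1
      set q' := ((verletStep U h)^[i] (x, ξ')).1
      set y := (fderiv ℝ (verletStep U h)^[i] (x, ξ) (e, u)).1
      set y' := (fderiv ℝ (verletStep U h)^[i] (x, ξ') (e, u')).1
      -- A linear force on y - y' plus the change of the Hessian, which is bounded by `C`.
      have e1 : fderiv ℝ (gradient U) q y - fderiv ℝ (gradient U) q' y' =
          fderiv ℝ (gradient U) q (y - y') +
            (fderiv ℝ (gradient U) q y' - fderiv ℝ (gradient U) q' y') := by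
        rw [map_sub]; abel
      rw [e1]
      refine (map_add_le_add p _ _).trans (add_le_add (H.hess _ _) ?_)
      refine (H.hess_sub q q' y').trans ?_
      have h1 := hq.1 i hi.le
      simp only [mul_zero, add_zero] at h1
      have h2 := hz' i hi.le
      exact mul_le_mul (mul_le_mul_of_nonneg_left h1 H.nonneg') h2 (apply_nonneg _ _)
        (by have := H.nonneg'; positivity))
  have h1 := hy.2 N le_rfl
  rw [hu, hu'] at h1
  simp only [Function.iterate_zero, fderiv_id, ContinuousLinearMap.id_apply, sub_self,
    zero_add, zero_sub, map_neg_eq_map, map_smul_eq_mul, Real.norm_of_nonneg hT0] at h1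
  -- The a priori bound reads T p ≤ T p / 11 + (6/11) T² C, and 6/11 · 11/10 = 3/5. Inserting `C`
  -- then uses 3/5 · (12/11)² ≤ 3/4.
  have h2 : N * h * p (u - u') ≤ 3 / 5 * ((N * h) ^ 2 * C) := by
    have hb : 0 ≤ 12 / 11 * (N * h * p (u - u') + (N * h) ^ 2 / 2 * C) := by
      have := apply_nonneg p (u - u')
      positivity
    have := mul_le_mul_of_nonneg_right hT hb
    nlinarith
  have h3 : N * h * p (u - u') ≤
      N * h * (3 / 4 * ΛH * (N * h) ^ 2 * p e * r (ξ - ξ')) := by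
    refine h2.trans ?_
    have h4 : 0 ≤ ΛH * (N * h) ^ 3 * p e * r (ξ - ξ') := by
      have := H.nonneg'
      positivity
    rw [hC]
    nlinarith
  exact le_of_mul_le_mul_left h3 hTpos

end Variation

/-! ### One-step regularization in total variation -/

section OneShot

variable {E : Type*} [NormedAddCommGroup E] [InnerProductSpace ℝ E] [FiniteDimensional ℝ E]
  [MeasurableSpace E] [BorelSpace E] {ι : Type*} [Fintype ι]

variable {U : E → ℝ} {p r : Seminorm ℝ E} {Λ ΛH c : ℝ}

theorem contDiff_verletPosition (hU : ContDiff ℝ 1 (gradient U)) (h : ℝ) (N : ℕ) :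
    ContDiff ℝ 1 (fun z : E × E => verletPosition U h N z.1 z.2) :=
  contDiff_fst.comp (contDiff_verletStep_iterate hU h N)

theorem fderiv_verletPosition (hU : ContDiff ℝ 1 (gradient U)) (h : ℝ) (N : ℕ) (z d : E × E) :
    fderiv ℝ (fun z : E × E => verletPosition U h N z.1 z.2) z d =
      (fderiv ℝ (verletStep U h)^[N] z d).1 := by
  have h1 := ((contDiff_verletStep_iterate hU h N).differentiable one_ne_zero z).hasFDerivAt
  have h2 : HasFDerivAt (fun z : E × E => verletPosition U h N z.1 z.2)
      ((ContinuousLinearMap.fst ℝ E E).comp (fderiv ℝ (verletStep U h)^[N] z)) z :=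
    hasFDerivAt_fst.comp z h1
  rw [h2.fderiv]
  rfl

theorem HessianBounds.norm_fderiv_fst_le (H : HessianBounds U p r Λ ΛH c) {h : ℝ} {N : ℕ}
    (hh : 0 ≤ h) (hT : Λ * (N * h) ^ 2 ≤ 1 / 6) (z : E × E) (e : E) :
    ‖(fderiv ℝ (verletStep U h)^[N] z (e, 0)).1‖ ≤ 12 / 11 * p e :=
  (H.norm_le _).trans ((H.variation_le hh hT z (e, 0) le_rfl (by simp)).1 N le_rfl)

theorem HessianBounds.norm_fderiv_snd_le (H : HessianBounds U p r Λ ΛH c) {h : ℝ} {N : ℕ}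
    (hh : 0 ≤ h) (hT : Λ * (N * h) ^ 2 ≤ 1 / 6) (z : E × E) (w : E) :
    ‖(fderiv ℝ (verletStep U h)^[N] z (0, w)).1‖ ≤ 12 / 11 * (N * h * c) * ‖w‖ := by
  have hT0 : 0 ≤ N * h := by positivity
  refine (H.norm_le _).trans (((H.variation_le hh hT z (0, w) (a := N * h * p w)
    (by simpa using mul_nonneg hT0 (apply_nonneg p w))
    (by simp [map_smul_eq_mul, abs_of_nonneg hh])).1 N le_rfl).trans ?_)
  have := mul_le_mul_of_nonneg_left (H.le_norm w) hT0
  linarith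

/-- Moving the starting point along e has, to first order, the effect of moving the velocity along
-u(ξ). The derivative is thereby transferred to the Gaussian variable, where it can be integrated by
parts. -/
theorem HessianBounds.abs_integral_fderiv_le (H : HessianBounds U p r Λ ΛH c)
    (b : OrthonormalBasis ι ℝ E) {s : ℝ}
    (hsign : ∀ σ : ι → ℝ, (∀ a, σ a = 1 ∨ σ a = -1) → r (∑ a, σ a • b a) ≤ s)
    {h : ℝ} {N : ℕ} (hh : 0 < h) (hN : 0 < N) (hT : Λ * (N * h) ^ 2 ≤ 1 / 6) (x e : E)
    {g : E → ℝ} (hg : ContDiff ℝ 1 g) (hg1 : ∀ x, |g x| ≤ 1) {D : ℝ}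
    (hgD : ∀ x, ‖fderiv ℝ g x‖ ≤ D) :
    |∫ ξ, fderiv ℝ g (verletPosition U h N x ξ)
        (fderiv ℝ (verletStep U h)^[N] (x, ξ) (e, 0)).1 ∂stdGaussian E| ≤
      √((12 / 11 / (N * h)) ^ 2 + (3 / 4 * ΛH * (N * h) ^ 2 * s) ^ 2) * p e := by
  have hTpos : 0 < N * h := by positivity
  have hpe : 0 ≤ p e := apply_nonneg _ _
  have hD : 0 ≤ D := (norm_nonneg _).trans (hgD 0)
  -- The pointwise choice needs no further regularity: `huB` below makes `u` Lipschitz.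
  choose u hu using fun ξ => H.exists_velocity hh hN hT (x, ξ) e
  have huA : ∀ ξ, ‖u ξ‖ ≤ 12 / 11 / (N * h) * p e := fun ξ =>
    (H.norm_le _).trans (H.velocity_le hh hN hT (x, ξ) (hu ξ)).1
  have huB : ∀ ξ ξ', ‖u ξ - u ξ'‖ ≤ 3 / 4 * ΛH * (N * h) ^ 2 * p e * r (ξ - ξ') := fun ξ ξ' =>
    (H.norm_le _).trans (H.velocity_sub_le hh hN hT x ξ ξ' (hu ξ) (hu ξ'))
  have hB0 : 0 ≤ 3 / 4 * ΛH * (N * h) ^ 2 * p e := by have := H.nonneg'; positivity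
  set G : E → ℝ := fun ξ => g (verletPosition U h N x ξ) with hG
  have hF : ContDiff ℝ 1 (fun ξ => verletPosition U h N x ξ) :=
    (contDiff_verletPosition H.smooth h N).comp (contDiff_const.prodMk contDiff_id)
  have hFd : ∀ ξ w, fderiv ℝ (fun ξ => verletPosition U h N x ξ) ξ w =
      (fderiv ℝ (verletStep U h)^[N] (x, ξ) (0, w)).1 := by
    intro ξ w
    have h1 : HasFDerivAt (fun ξ : E => (x, ξ)) (ContinuousLinearMap.inr ℝ E E) ξ :=
      hasFDerivAt_prodMk_right x ξ
    have h2 : HasFDerivAt (fun ξ => verletPosition U h N x ξ) _ ξ :=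
      HasFDerivAt.comp (g := fun z : E × E => verletPosition U h N z.1 z.2) ξ
        ((contDiff_verletPosition H.smooth h N).differentiable one_ne_zero (x, ξ)).hasFDerivAt h1
    rw [h2.fderiv, ← fderiv_verletPosition H.smooth]
    simp
  have hGc : ContDiff ℝ 1 G := hg.comp hF
  have hGd : ∀ ξ w, fderiv ℝ G ξ w = fderiv ℝ g (verletPosition U h N x ξ)
      (fderiv ℝ (verletStep U h)^[N] (x, ξ) (0, w)).1 := by
    intro ξ w
    have h1 := (hg.differentiable one_ne_zero (verletPosition U h N x ξ)).hasFDerivAt.comp ξ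
      (hF.differentiable one_ne_zero ξ).hasFDerivAt
    have h2 : HasFDerivAt G _ ξ := h1
    rw [h2.fderiv, ContinuousLinearMap.comp_apply, hFd]
  have hGb : ∀ ξ, ‖fderiv ℝ G ξ‖ ≤ D * (12 / 11 * (N * h * |c|)) := by
    intro ξ
    refine ContinuousLinearMap.opNorm_le_bound _ (by positivity) fun w => ?_
    rw [hGd, mul_assoc]
    refine (ContinuousLinearMap.le_opNorm _ _).trans (mul_le_mul (hgD _) ?_ (norm_nonneg _) hD)
    refine (H.norm_fderiv_snd_le hh.le hT _ _).trans ?_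
    gcongr
    exact le_abs_self c
  have key : ∀ ξ, fderiv ℝ g (verletPosition U h N x ξ)
        (fderiv ℝ (verletStep U h)^[N] (x, ξ) (e, 0)).1 = -fderiv ℝ G ξ (u ξ) := by
    intro ξ
    rw [hGd, ← map_neg]
    congr 1
    have h1 := hu ξ
    have h3 : ((e, u ξ) : E × E) = (e, 0) + (0, u ξ) := by simp
    rw [h3, map_add, Prod.fst_add] at h1
    exact eq_neg_of_add_eq_zero_left h1
  simp_rw [key]
  rw [integral_neg, abs_neg]
  refine (abs_integral_fderiv_apply_le b (q := fun x => r x) huA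
    (fun ξ ξ' => (huB ξ ξ').trans (mul_le_mul_of_nonneg_left (H.sup_le _) hB0)) hB0 hB0 huB
    (fun t x => by simp [map_smul_eq_mul]) hsign hGc (fun ξ => hg1 _) hGb).trans
    (le_of_eq ?_)
  have : (12 / 11 / (N * h) * p e) ^ 2 + (3 / 4 * ΛH * (N * h) ^ 2 * p e * s) ^ 2 =
      ((12 / 11 / (N * h)) ^ 2 + (3 / 4 * ΛH * (N * h) ^ 2 * s) ^ 2) * (p e) ^ 2 := by ring
  rw [this, Real.sqrt_mul (by positivity), Real.sqrt_sq hpe]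

/-- Regularization of the unadjusted Hamiltonian Monte Carlo kernel in total variation. -/
theorem HessianBounds.uhmcKernel_sub_le (H : HessianBounds U p r Λ ΛH c) (hU : ContDiff ℝ 1 U)
    (b : OrthonormalBasis ι ℝ E) {s : ℝ}
    (hsign : ∀ σ : ι → ℝ, (∀ a, σ a = 1 ∨ σ a = -1) → r (∑ a, σ a • b a) ≤ s)
    {h : ℝ} {N : ℕ} (hh : 0 < h) (hN : 0 < N) (hT : Λ * (N * h) ^ 2 ≤ 1 / 6) (x y : E)
    {A : Set E} (hA : MeasurableSet A) :
    (uhmcKernel U h N x).real A - (uhmcKernel U h N y).real A ≤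
      √((12 / 11 / (N * h)) ^ 2 + (3 / 4 * ΛH * (N * h) ^ 2 * s) ^ 2) * p (x - y) := by
  set e := x - y with he
  have hcont := continuous_verletPosition hU h N
  have hPm : ∀ x, Measurable (verletPosition U h N x) := fun x =>
    (hcont.comp (Continuous.prodMk_right x)).measurable
  have hprob : ∀ x, IsProbabilityMeasure (uhmcKernel U h N x) := fun x => by
    rw [uhmcKernel_apply hU]
    exact Measure.isProbabilityMeasure_map (hPm x).aemeasurable
  have := hprob x
  have := hprob y
  refine measureReal_le_of_forall_contDiff (fun g hg hgc hg01 => ?_) hA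
  have hg1 : ∀ x, |g x| ≤ 1 := fun x => abs_le.2 ⟨by linarith [(hg01 x).1], (hg01 x).2⟩
  obtain ⟨D, hD⟩ := (hgc.fderiv ℝ).exists_bound_of_continuous (hg.continuous_fderiv one_ne_zero)
  have hD0 : 0 ≤ D := (norm_nonneg _).trans (hD 0)
  rw [uhmcKernel_apply hU, uhmcKernel_apply hU,
    integral_map (hPm x).aemeasurable hg.continuous.aestronglyMeasurable,
    integral_map (hPm y).aemeasurable hg.continuous.aestronglyMeasurable]
  -- Interpolation from y to x; the integral is differentiated in t and its derivative is bounded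
  -- uniformly on the segment.
  set ψ : ℝ → ℝ := fun t => ∫ ξ, g (verletPosition U h N (y + t • e) ξ) ∂stdGaussian E with hψ
  set ψ' : ℝ → E → ℝ := fun t ξ => fderiv ℝ g (verletPosition U h N (y + t • e) ξ)
    (fderiv ℝ (verletStep U h)^[N] (y + t • e, ξ) (e, 0)).1 with hψ'
  have hpt : ∀ t ξ, HasDerivAt (fun t => g (verletPosition U h N (y + t • e) ξ)) (ψ' t ξ) t := by
    intro t ξ
    have h1 : HasDerivAt (fun t : ℝ => ((y + t • e, ξ) : E × E)) (e, 0) t := by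
      have : HasDerivAt (fun t : ℝ => y + t • e) e t := by
        simpa using ((hasDerivAt_id t).smul_const e).const_add y
      exact this.prodMk (hasDerivAt_const t ξ)
    have h2 := ((contDiff_verletPosition H.smooth h N).differentiable one_ne_zero
      (y + t • e, ξ)).hasFDerivAt.comp_hasDerivAt (f := fun t : ℝ => ((y + t • e, ξ) : E × E)) t h1
    have h3 := (hg.differentiable one_ne_zero
      (verletPosition U h N (y + t • e) ξ)).hasFDerivAt.comp_hasDerivAt
      (f := fun t => verletPosition U h N (y + t • e) ξ) t h2
    rw [fderiv_verletPosition H.smooth] at h3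
    exact h3
  have hbd : ∀ t ξ, ‖ψ' t ξ‖ ≤ D * (12 / 11 * p e) := fun t ξ =>
    (ContinuousLinearMap.le_opNorm _ _).trans (mul_le_mul (hD _)
      (H.norm_fderiv_fst_le hh.le hT _ _) (norm_nonneg _) hD0)
  have hmeas : ∀ t, AEStronglyMeasurable (ψ' t) (stdGaussian E) := fun t => by
    have h1 := hg.continuous_fderiv one_ne_zero
    have h2 := (contDiff_verletStep_iterate H.smooth h N).continuous_fderiv one_ne_zero
    have h3 : Continuous (fun ξ => verletPosition U h N (y + t • e) ξ) :=
      hcont.comp (Continuous.prodMk_right _)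
    have h4 : Continuous (fun ξ => fderiv ℝ (verletStep U h)^[N] (y + t • e, ξ) (e, 0)) :=
      (h2.comp (Continuous.prodMk_right _)).clm_apply continuous_const
    exact ((h1.comp h3).clm_apply (continuous_fst.comp h4)).aestronglyMeasurable
  have hm0 : ∀ t : ℝ, AEStronglyMeasurable (fun ξ => g (verletPosition U h N (y + t • e) ξ))
      (stdGaussian E) := fun t => by
    have h3 : Continuous (fun ξ => verletPosition U h N (y + t • e) ξ) :=
      hcont.comp (Continuous.prodMk_right _)
    exact (hg.continuous.comp h3).aestronglyMeasurable
  have hderiv : ∀ t, HasDerivAt ψ (∫ ξ, ψ' t ξ ∂stdGaussian E) t := fun t =>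
    (hasDerivAt_integral_of_dominated_loc_of_deriv_le (μ := stdGaussian E)
      (F := fun t ξ => g (verletPosition U h N (y + t • e) ξ)) (F' := ψ')
      (bound := fun _ => D * (12 / 11 * p e)) Filter.univ_mem
      (Filter.Eventually.of_forall hm0)
      ((integrable_const (1 : ℝ)).mono' (hm0 t) (Filter.Eventually.of_forall fun ξ => hg1 _))
      (hmeas t) (Filter.Eventually.of_forall fun ξ t _ => hbd t ξ) (integrable_const _)
      (Filter.Eventually.of_forall fun ξ t _ => hpt t ξ)).2
  have hfin := norm_image_sub_le_of_norm_deriv_le_segment_01'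
    (fun t _ => (hderiv t).hasDerivWithinAt) (fun t _ => by
      rw [Real.norm_eq_abs]
      exact H.abs_integral_fderiv_le b hsign hh hN hT (y + t • e) e hg hg1 hD)
  refine (le_abs_self _).trans ?_
  rw [← Real.norm_eq_abs]
  simpa [hψ, he] using hfin

end OneShot

/-! ### Regularization of the mean-field kernel -/

section Config

variable {n k : ℕ} {V W : EuclideanSpace ℝ (Fin k) → ℝ} {ε L L' LH LH' : ℝ}

theorem MeanFieldBounds.hessianBounds (H : MeanFieldBounds V W L L' LH LH') (hε : 0 ≤ ε) (n : ℕ) :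
    HessianBounds (meanFieldPotential V W ε n) (ell1Seminorm n k) (supSeminorm n k)
      (L + 4 * ε * L') (LH + 8 * ε * LH') n where
  smooth := (H.contDiff_gradient_potential ε n).of_le (by norm_num)
  nonneg := by
    have := H.L_nonneg
    have := H.L'_nonneg
    positivity
  nonneg' := by
    have := H.LH_nonneg
    have := H.LH'_nonneg
    positivity
  hess := H.ell1_hess_le hε
  grad_sub := H.sup_gradient_sub_le hε
  hess_sub := H.ell1_hess_sub_le hε
  norm_le := norm_le_ell1Seminorm
  le_norm := ell1Seminorm_le_mul_norm
  sup_le := supSeminorm_le_norm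

/-- The standard orthonormal basis of the configuration space. -/
def configBasis (n k : ℕ) : OrthonormalBasis ((_ : Fin n) × Fin k) ℝ (Config n k) :=
  Pi.orthonormalBasis fun _ => EuclideanSpace.basisFun (Fin k) ℝ

/-- Each particle block consists of k signs and has Euclidean norm √k. This is where the number of
particles drops out. -/
theorem supSeminorm_sum_signs_le {σ : ((_ : Fin n) × Fin k) → ℝ}
    (hσ : ∀ a, σ a = 1 ∨ σ a = -1) :
    supSeminorm n k (∑ a, σ a • configBasis n k a) ≤ √k := by
  refine (supSeminorm_le_iff (Real.sqrt_nonneg _)).2 fun i => ?_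
  have h1 : (∑ a, σ a • configBasis n k a) i = WithLp.toLp 2 fun j => σ ⟨i, j⟩ := by
    ext j
    rw [← particle_apply, map_sum, Fintype.sum_sigma]
    simp only [map_smul, configBasis, Pi.orthonormalBasis_apply, particle_apply,
      EuclideanSpace.basisFun_apply]
    rw [Finset.sum_eq_single i]
    · simp [Pi.single_apply]
    · intro l _ hl
      simp [Ne.symm hl]
    · simp
  rw [h1, EuclideanSpace.norm_eq]
  refine Real.sqrt_le_sqrt ?_
  have h2 : ∀ j ∈ Finset.univ, ‖σ ⟨i, j⟩‖ ^ 2 = 1 := by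
    intro j _
    rcases hσ ⟨i, j⟩ with h | h <;> rw [h] <;> norm_num
  simp only
  rw [Finset.sum_congr rfl h2]
  simp

/-- Regularization of the mean-field kernel in total variation, with a constant independent of
the number of particles. -/
theorem MeanFieldBounds.meanFieldKernel_sub_le (H : MeanFieldBounds V W L L' LH LH')
    (hε : 0 ≤ ε) {h T : ℝ} {N : ℕ} (hh : 0 < h) (hN : 0 < N) (hTN : T = N * h)
    (hT : (L + 4 * ε * L') * T ^ 2 ≤ 1 / 6) (x y : Config n k) {A : Set (Config n k)}
    (hA : MeasurableSet A) :
    |(meanFieldKernel V W ε h N n x).real A - (meanFieldKernel V W ε h N n y).real A| ≤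
      3 / 2 * √((T ^ 2)⁻¹ + 34 * k * (LH + 8 * ε * LH') ^ 2 * T ^ 4) * ell1 x y := by
  subst hTN
  have hTpos : 0 < N * h := by positivity
  have hB := H.hessianBounds hε n
  have hU : ContDiff ℝ 1 (meanFieldPotential V W ε n) :=
    (contDiff_meanFieldPotential H.smoothV H.smoothW ε n).of_le (by norm_num)
  -- The constants have room to spare: (12/11)² ≤ 9/4 and (3/4)² ≤ 34 · 9/4.
  have hc : √((12 / 11 / (N * h)) ^ 2 + (3 / 4 * (LH + 8 * ε * LH') * (N * h) ^ 2 * √k) ^ 2) ≤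
      3 / 2 * √(((N * h) ^ 2)⁻¹ + 34 * k * (LH + 8 * ε * LH') ^ 2 * (N * h) ^ 4) := by
    refine Real.sqrt_le_iff.2 ⟨by positivity, ?_⟩
    rw [mul_pow _ √(k : ℝ), Real.sq_sqrt (Nat.cast_nonneg k), mul_pow (3 / 2 : ℝ),
      Real.sq_sqrt (by positivity)]
    have h1 : 0 ≤ ((N * h) ^ 2)⁻¹ := by positivity
    have h2 : 0 ≤ (k : ℝ) * (LH + 8 * ε * LH') ^ 2 * (N * h) ^ 4 := by positivity
    have h3 : (12 / 11 / (N * h)) ^ 2 = (12 / 11) ^ 2 * ((N * h) ^ 2)⁻¹ := by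
      rw [div_pow, div_eq_mul_inv]
    rw [h3]
    nlinarith
  have key : ∀ x y : Config n k, (meanFieldKernel V W ε h N n x).real A -
      (meanFieldKernel V W ε h N n y).real A ≤
      3 / 2 * √(((N * h) ^ 2)⁻¹ + 34 * k * (LH + 8 * ε * LH') ^ 2 * (N * h) ^ 4) * ell1 x y :=
    fun x y => (hB.uhmcKernel_sub_le hU (configBasis n k)
      (fun σ hσ => supSeminorm_sum_signs_le hσ) hh hN hT x y hA).trans
      (mul_le_mul_of_nonneg_right hc (apply_nonneg _ _))
  refine abs_le.2 ⟨?_, key x y⟩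
  have h1 := key y x
  rw [ell1_eq, map_sub_rev, ← ell1_eq] at h1
  linarith

end Config

/-! ### The concave distance profile -/

section ConcaveProfile

variable {T R₁ : ℝ}

/-- The concave function with slope `exp(-s / T)` on `[0, R₁]` and constant slope beyond `R₁`. -/
def profile (T R₁ s : ℝ) : ℝ :=
  T * (1 - Real.exp (-(min s R₁ / T))) + Real.exp (-(R₁ / T)) * (s - min s R₁)

/-- The derivative of `profile`. -/
def profileSlope (T R₁ s : ℝ) : ℝ := Real.exp (-(min s R₁ / T))

theorem profileSlope_pos (s : ℝ) : 0 < profileSlope T R₁ s := Real.exp_pos _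

theorem profileSlope_le_one (hT : 0 < T) (hR : 0 ≤ R₁) {s : ℝ} (hs : 0 ≤ s) :
    profileSlope T R₁ s ≤ 1 := by
  have : 0 ≤ min s R₁ / T := div_nonneg (le_min hs hR) hT.le
  exact Real.exp_le_one_iff.2 (by linarith)

theorem exp_le_profileSlope (hT : 0 < T) (s : ℝ) :
    Real.exp (-(R₁ / T)) ≤ profileSlope T R₁ s := by
  refine Real.exp_le_exp.2 (neg_le_neg ?_)
  gcongr
  exact min_le_right _ _

theorem profile_zero (hR : 0 ≤ R₁) : profile T R₁ 0 = 0 := by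
  simp [profile, min_eq_left hR]

/-- Concavity in the form that the graph lies below its tangent lines; on the curved part this is
exp t ≥ 1 + t. -/
theorem profile_sub_le (hT : 0 < T) (s t : ℝ) :
    profile T R₁ t - profile T R₁ s ≤ profileSlope T R₁ s * (t - s) := by
  have h1 : T * (Real.exp (-(min s R₁ / T)) - Real.exp (-(min t R₁ / T))) ≤
      profileSlope T R₁ s * (min t R₁ - min s R₁) := by
    have h2 : Real.exp (-(min t R₁ / T)) =
        profileSlope T R₁ s * Real.exp (-((min t R₁ - min s R₁) / T)) := by
      rw [profileSlope, ← Real.exp_add]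
      congr 1
      ring
    have h3 := Real.add_one_le_exp (-((min t R₁ - min s R₁) / T))
    have h4 : T * ((min t R₁ - min s R₁) / T) = min t R₁ - min s R₁ := mul_div_cancel₀ _ hT.ne'
    rw [h2]
    have h5 := mul_le_mul_of_nonneg_left h3
      (mul_nonneg hT.le (profileSlope_pos (T := T) (R₁ := R₁) s).le)
    have h6 : Real.exp (-(min s R₁ / T)) = profileSlope T R₁ s := rfl
    have h7 : T * profileSlope T R₁ s * (-((min t R₁ - min s R₁) / T) + 1) =
        T * profileSlope T R₁ s - profileSlope T R₁ s * (T * ((min t R₁ - min s R₁) / T)) := by ring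
    rw [h6]
    rw [h7, h4] at h5
    linarith
  have h2 : Real.exp (-(R₁ / T)) * ((t - min t R₁) - (s - min s R₁)) ≤
      profileSlope T R₁ s * ((t - min t R₁) - (s - min s R₁)) := by
    rcases le_total s R₁ with h | h
    · rw [min_eq_left h, sub_self, sub_zero]
      exact mul_le_mul_of_nonneg_right (exp_le_profileSlope hT s)
        (sub_nonneg.2 (min_le_left _ _))
    · rw [profileSlope, min_eq_right h]
  simp only [profile]
  linarith

theorem profile_mono (hT : 0 < T) {s t : ℝ} (h : s ≤ t) : profile T R₁ s ≤ profile T R₁ t := by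
  have h1 := profile_sub_le (R₁ := R₁) hT t s
  have h2 := profileSlope_pos (T := T) (R₁ := R₁) t
  nlinarith

theorem profile_nonneg (hT : 0 < T) (hR : 0 ≤ R₁) {s : ℝ} (hs : 0 ≤ s) : 0 ≤ profile T R₁ s := by
  have := profile_mono (R₁ := R₁) hT hs
  rwa [profile_zero hR] at this

theorem profile_add_le (hT : 0 < T) (hR : 0 ≤ R₁) {s d : ℝ} (hs : 0 ≤ s) (hd : 0 ≤ d) :
    profile T R₁ (s + d) ≤ profile T R₁ s + d := by
  have h1 := profile_sub_le (R₁ := R₁) hT s (s + d)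
  have h2 := profileSlope_le_one hT hR hs
  nlinarith

theorem profile_le (hT : 0 < T) (hR : 0 ≤ R₁) {s : ℝ} (hs : 0 ≤ s) : profile T R₁ s ≤ s := by
  have := profile_add_le hT hR le_rfl hs
  rwa [zero_add, profile_zero hR, zero_add] at this

theorem slope_mul_le_profile (hT : 0 < T) (hR : 0 ≤ R₁) (s : ℝ) :
    profileSlope T R₁ s * s ≤ profile T R₁ s := by
  have := profile_sub_le (R₁ := R₁) hT s 0
  rw [profile_zero hR] at this
  linarith

theorem le_exp_mul_profile (hT : 0 < T) (hR : 0 ≤ R₁) {s : ℝ} (hs : 0 ≤ s) :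
    s ≤ Real.exp (R₁ / T) * profile T R₁ s := by
  have h1 := slope_mul_le_profile hT hR s
  have h2 := mul_le_mul_of_nonneg_right (exp_le_profileSlope (R₁ := R₁) hT s) hs
  have h3 : Real.exp (R₁ / T) * Real.exp (-(R₁ / T)) = 1 := by rw [← Real.exp_add]; simp
  have h4 := mul_le_mul_of_nonneg_left (h2.trans h1) (Real.exp_pos (R₁ / T)).le
  rwa [← mul_assoc, h3, one_mul] at h4

/-- The slope decays at rate 1 / T up to `R₁`, so the increase there is at most T times the slope at
s. Beyond `R₁` the slope has shrunk by exp(-(R₁ - s) / T). This limits the cost of a failed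
coupling, however far the particles separate. -/
theorem profile_sub_le_of_le (hT : 0 < T) {s : ℝ} (hs : s ≤ R₁) (t : ℝ) {d : ℝ}
    (ht : t - R₁ ≤ d) (hd : 0 ≤ d) :
    profile T R₁ t - profile T R₁ s ≤
      profileSlope T R₁ s * (T + Real.exp (-((R₁ - s) / T)) * d) := by
  have h1 : t - min t R₁ ≤ d := by
    rcases le_total t R₁ with h | h
    · rw [min_eq_left h]; linarith
    · rw [min_eq_right h]; exact ht
  have h2 : profileSlope T R₁ s * Real.exp (-((R₁ - s) / T)) = Real.exp (-(R₁ / T)) := by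
    rw [profileSlope, min_eq_left hs, ← Real.exp_add]
    congr 1
    ring
  have h3 := mul_le_mul_of_nonneg_left h1 (Real.exp_pos (-(R₁ / T))).le
  have h4 := mul_pos hT (Real.exp_pos (-(min t R₁ / T)))
  rw [mul_add, ← mul_assoc, h2]
  simp only [profile, min_eq_left hs, sub_self, mul_zero, profileSlope]
  linarith

theorem continuous_profile : Continuous (profile T R₁) := by
  unfold profile
  fun_prop

end ConcaveProfile

/-! ### Distant particles under synchronous coupling -/

section Synchronous

variable {F : Type*} [NormedAddCommGroup F] [InnerProductSpace ℝ F]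

/-- In the application a = L T² and κ = K T² (not the interaction strength), `I` is twice the inner
product of the initial difference with the accumulated force, `q` the square of that force, and `D`
the interaction error. -/
theorem sq_norm_bound_aux {r D a κ I q : ℝ} (hD : 0 ≤ D) (hr : 0 ≤ r) (ha : 0 ≤ a) (hκ : 0 ≤ κ)
    (hκ1 : κ ≤ 3 / 20) (ha1 : a ≤ 3 / 20) (haκ : a ^ 2 ≤ 9 / 50 * κ)
    (hq : q ≤ a ^ 2 / 4 * (12 / 11 * r + D) ^ 2)
    (hI : κ * (15 / 16 * r ^ 2) - 2 * κ * (r * (6 / 11 * a * r + D)) -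
      a * ((6 / 11 * a * r + D) * (12 / 11 * r + D)) ≤ I) :
    r ^ 2 - I + q ≤ r ^ 2 * (1 - 3 / 5 * κ) + 1 / 2 * (r * D) + 4 / 25 * (D * D) := by
  have haa' : a ^ 2 ≤ (3 / 20) ^ 2 := pow_le_pow_left₀ ha ha1 2
  have f1 : κ * a * r ^ 2 ≤ κ * (3 / 20) * r ^ 2 := by gcongr
  have f2 : a ^ 2 * r ^ 2 ≤ 9 / 50 * κ * r ^ 2 := by gcongr
  have f3 : a ^ 2 * (r * D) ≤ (3 / 20) ^ 2 * (r * D) := by gcongr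
  have f4 : a ^ 2 * (D * D) ≤ (3 / 20) ^ 2 * (D * D) := by gcongr
  have f5 : a * (r * D) ≤ 3 / 20 * (r * D) := by gcongr
  have f6 : a * (D * D) ≤ 3 / 20 * (D * D) := by gcongr
  have f7 : κ * (r * D) ≤ 3 / 20 * (r * D) := by gcongr
  have f8 : 0 ≤ κ * r ^ 2 := by positivity
  have f9 : 0 ≤ r * D := by positivity
  have f10 : 0 ≤ D * D := by positivity
  linarith

/-- With equal initial velocities the end difference is `z 0` minus the accumulated force. Replacing
`g` by the confining force `b` costs one `D`. Expanding the square of the rest, the inner product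
gains a multiple of K T² r² by convexity, the quadratic term is of order (L T² r)² and is controlled
by `hLLT`, and the mixed terms cost the second `D`. -/
theorem IsVerlet.norm_le_of_strongly_convex {h T K L D r : ℝ} {N : ℕ} {z v g b : ℕ → F}
    (H : IsVerlet h z v g) (hTN : T = N * h) (hK : 0 ≤ K) (hL : 0 ≤ L) (hD : 0 ≤ D)
    (hKL : K * T ^ 2 ≤ 3 / 20) (hLT : L * T ^ 2 ≤ 3 / 20) (hLLT : L ^ 2 * T ^ 2 ≤ 9 / 50 * K)
    (hv : v 0 = 0) (hr : ‖z 0‖ = r)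
    (h1 : ∀ i < N, ‖z i - z 0‖ ≤ 6 / 11 * (L * T ^ 2) * r + D)
    (h2 : ∀ i < N, ‖z i‖ ≤ 12 / 11 * r + D)
    (h3 : ∀ i < N, ‖b i‖ ≤ L * ‖z i‖)
    (h4 : ∀ i < N, K * ‖z i‖ ^ 2 - K * r ^ 2 / 16 ≤ inner ℝ (z i) (b i))
    (h5 : ∀ i < N, T ^ 2 / 2 * ‖g i - b i‖ ≤ D) :
    ‖z N‖ ≤ r * (1 - 3 / 10 * (K * T ^ 2)) + 2 * D := by
  have hr0 : 0 ≤ r := hr ▸ norm_nonneg _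
  have hrD : 0 ≤ r * D := mul_nonneg hr0 hD
  have hDD : 0 ≤ D * D := mul_nonneg hD hD
  set s := h ^ 2 • ∑ i ∈ Finset.range N, verletWeight N i • b i with hs
  set y := z 0 - s with hy
  have hw : h ^ 2 * ∑ i ∈ Finset.range N, verletWeight N i = T ^ 2 / 2 := by
    rw [sum_verletWeight, hTN]; ring
  have hzy : ‖z N - y‖ ≤ D := by
    have e1 : z N - y = -(h ^ 2 • ∑ i ∈ Finset.range N, verletWeight N i • (g i - b i)) := by
      rw [H.pos_eq N, hv, hy, hs]
      simp only [smul_sub, Finset.sum_sub_distrib, smul_zero]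
      abel
    have e2 : ‖∑ i ∈ Finset.range N, verletWeight N i • (g i - b i)‖ ≤
        ∑ i ∈ Finset.range N, verletWeight N i * ‖g i - b i‖ := by
      refine (norm_sum_le _ _).trans (Finset.sum_le_sum fun i hi => ?_)
      rw [norm_smul, Real.norm_of_nonneg (verletWeight_nonneg (Finset.mem_range.1 hi))]
    -- The bound `h5` can be divided by T² / 2 only for T ≠ 0; otherwise the force sum carries a
    -- factor zero or is empty.
    rcases eq_or_ne T 0 with hT0 | hT0
    · have hN0 : (N : ℝ) = 0 ∨ h = 0 := mul_eq_zero.1 (hTN ▸ hT0)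
      rcases hN0 with hN0 | hh0
      · have : N = 0 := by exact_mod_cast hN0
        subst this
        rw [e1]; simpa using hD
      · rw [e1, hh0]; simpa using hD
    · have hT2 : 0 < T ^ 2 / 2 := by positivity
      rw [e1, norm_neg, norm_smul, Real.norm_of_nonneg (sq_nonneg h)]
      have e3 : ∑ i ∈ Finset.range N, verletWeight N i * ‖g i - b i‖ ≤
          ∑ i ∈ Finset.range N, verletWeight N i * (D / (T ^ 2 / 2)) := by
        refine Finset.sum_le_sum fun i hi => mul_le_mul_of_nonneg_left ?_
          (verletWeight_nonneg (Finset.mem_range.1 hi))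
        rw [le_div_iff₀ hT2, mul_comm]
        exact h5 i (Finset.mem_range.1 hi)
      rw [← Finset.sum_mul] at e3
      calc h ^ 2 * ‖∑ i ∈ Finset.range N, verletWeight N i • (g i - b i)‖
          ≤ h ^ 2 * ((∑ i ∈ Finset.range N, verletWeight N i) * (D / (T ^ 2 / 2))) :=
            mul_le_mul_of_nonneg_left (e2.trans e3) (sq_nonneg h)
        _ = D := by rw [← mul_assoc, hw, mul_div_cancel₀ _ hT2.ne']
  have hsn : ‖s‖ ≤ T ^ 2 / 2 * (L * (12 / 11 * r + D)) := by
    have e1 := seminorm_sum_verletWeight_le (normSeminorm ℝ F) (g := b) (j := N)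
      (C := L * (12 / 11 * r + D)) (fun i hi => (h3 i hi).trans
        (mul_le_mul_of_nonneg_left (h2 i hi) hL))
    simp only [coe_normSeminorm] at e1
    rw [hs, norm_smul, Real.norm_of_nonneg (sq_nonneg h)]
    refine (mul_le_mul_of_nonneg_left e1 (sq_nonneg h)).trans (le_of_eq ?_)
    rw [hTN]; ring
  set δ := 6 / 11 * (L * T ^ 2) * r + D with hδ
  have hδ0 : 0 ≤ δ := by positivity
  set m := K * (15 / 16 * r ^ 2) - 2 * K * (r * δ) - L * (δ * (12 / 11 * r + D)) with hm
  have hinner : ∀ i < N, m ≤ inner ℝ (z 0) (b i) := by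
    intro i hi
    have e1 : inner ℝ (z 0) (b i) = inner ℝ (z i) (b i) - inner ℝ (z i - z 0) (b i) := by
      rw [inner_sub_left]; ring
    have e2 : inner ℝ (z i - z 0) (b i) ≤ δ * (L * (12 / 11 * r + D)) := by
      refine (real_inner_le_norm _ _).trans (mul_le_mul (h1 i hi) ((h3 i hi).trans
        (mul_le_mul_of_nonneg_left (h2 i hi) hL)) (norm_nonneg _) hδ0)
    have e3 : r - δ ≤ ‖z i‖ := by
      have := norm_sub_norm_le (z 0) (z i)
      rw [norm_sub_rev, hr] at this
      linarith [h1 i hi]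
    have e4 : r ^ 2 - 2 * (r * δ) ≤ ‖z i‖ ^ 2 := by
      rcases le_total δ r with hle | hle
      · nlinarith [mul_self_le_mul_self (sub_nonneg.2 hle) e3]
      · nlinarith [sq_nonneg ‖z i‖]
    have e5 := mul_le_mul_of_nonneg_left e4 hK
    have e6 := h4 i hi
    rw [e1, hm]
    linarith
  have hzs : T ^ 2 / 2 * m ≤ inner ℝ (z 0) s := by
    rw [hs, inner_smul_right, inner_sum, ← hw, mul_assoc, Finset.sum_mul]
    refine mul_le_mul_of_nonneg_left (Finset.sum_le_sum fun i hi => ?_) (sq_nonneg h)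
    rw [inner_smul_right]
    exact mul_le_mul_of_nonneg_left (hinner i (Finset.mem_range.1 hi))
      (verletWeight_nonneg (Finset.mem_range.1 hi))
  have hyy : ‖y‖ ^ 2 ≤ r ^ 2 * (1 - 3 / 5 * (K * T ^ 2)) + 1 / 2 * (r * D) + 4 / 25 * (D * D) := by
    have e1 : ‖y‖ ^ 2 = r ^ 2 - 2 * inner ℝ (z 0) s + ‖s‖ ^ 2 := by
      rw [hy, norm_sub_sq_real, hr]
    have e2 : ‖s‖ ^ 2 ≤ (T ^ 2 / 2 * (L * (12 / 11 * r + D))) ^ 2 :=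
      pow_le_pow_left₀ (norm_nonneg _) hsn 2
    rw [e1]
    have e3 : (T ^ 2 / 2 * (L * (12 / 11 * r + D))) ^ 2 =
        (L * T ^ 2) ^ 2 / 4 * (12 / 11 * r + D) ^ 2 := by ring
    have e4 : T ^ 2 * m = K * T ^ 2 * (15 / 16 * r ^ 2) - 2 * (K * T ^ 2) * (r * δ) -
        L * T ^ 2 * (δ * (12 / 11 * r + D)) := by rw [hm]; ring
    rw [hδ] at e4
    refine sq_norm_bound_aux hD hr0 (by positivity) (by positivity) hKL hLT ?_ (e3 ▸ e2)
      (by linarith [hzs, e4] : _ ≤ 2 * inner ℝ (z 0) s)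
    have := mul_le_mul_of_nonneg_right hLLT (sq_nonneg T)
    linarith
  have hκ1 : 0 ≤ 1 - 3 / 10 * (K * T ^ 2) := by linarith
  have hyn : ‖y‖ ≤ r * (1 - 3 / 10 * (K * T ^ 2)) + D := by
    refine abs_le_of_sq_le_sq' ?_ (by positivity) |>.2
    have f1 : K * T ^ 2 * (r * D) ≤ 3 / 20 * (r * D) := mul_le_mul_of_nonneg_right hKL hrD
    have f2 : 0 ≤ (r * (K * T ^ 2)) ^ 2 := sq_nonneg _
    nlinarith
  have := norm_add_le y (z N - y)
  rw [add_sub_cancel] at this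
  linarith

end Synchronous

/-! ### Independence of the particle velocities -/

section ProductGaussian

variable {n k : ℕ}

/-- The standard Gaussian measure on configurations has independent standard Gaussian
particles. -/
theorem map_toLp_pi_stdGaussian (n k : ℕ) :
    (Measure.pi fun _ : Fin n => stdGaussian (EuclideanSpace ℝ (Fin k))).map (WithLp.toLp 2) =
      stdGaussian (Config n k) := by
  have : IsProbabilityMeasure
    ((Measure.pi fun _ : Fin n => stdGaussian (EuclideanSpace ℝ (Fin k))).map (WithLp.toLp 2)) :=
    Measure.isProbabilityMeasure_map (by fun_prop)
  refine Measure.ext_of_charFun ?_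
  ext t
  rw [charFun_pi, charFun_stdGaussian]
  simp_rw [charFun_stdGaussian]
  rw [← Complex.exp_sum, ← Complex.ofReal_pow, PiLp.norm_sq_eq_of_L2]
  push_cast
  rw [← Finset.sum_neg_distrib, Finset.sum_div]

end ProductGaussian

/-- The conditions on the parameters under which the chain contracts. -/
structure ContractionParams (K L S T κ : ℝ) : Prop where
  K_pos : 0 < K
  T_pos : 0 < T
  S_nonneg : 0 ≤ S
  κ_nonneg : 0 ≤ κ
  K_le : K ≤ L
  LT : L * T ^ 2 ≤ 3 / 20
  LLT : L ^ 2 * T ^ 2 ≤ 9 / 50 * K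
  LTS : L * T * S ≤ 3 / 640
  ΛT : (L + 4 * κ) * T ^ 2 ≤ 1 / 6
  κ_le : κ ≤ 1 / 2 * (K / (36 * 149)) ^ 2 * (T + 8 * S) ^ 2 * Real.exp (-40 * (S / T))

/-- The radius 4 S + (5/2) T of the profile exceeds the reflection range by (5/2) T. The lower bound
damps the slope beyond the radius, the upper bound limits the loss in equivalence with the norm. -/
theorem exp_five_halves_mem : 12 ≤ Real.exp (5 / 2) ∧ Real.exp (5 / 2) ≤ 13 := by
  have h1 : Real.exp (5 / 2) ^ 2 = Real.exp 1 ^ 5 := by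
    rw [← Real.exp_nat_mul, ← Real.exp_nat_mul]; norm_num
  have h2 := pow_le_pow_left₀ (by norm_num) Real.exp_one_gt_d9.le 5
  have h3 := pow_le_pow_left₀ (Real.exp_pos 1).le Real.exp_one_lt_d9.le 5
  rw [← h1] at h2 h3
  have h0 := Real.exp_pos (5 / 2)
  constructor
  · nlinarith
  · nlinarith

/-! ### Comparison of the rate with the interaction -/

section Params

variable {K L S T κ : ℝ}

theorem ContractionParams.L_nonneg (P : ContractionParams K L S T κ) : 0 ≤ L :=
  P.K_pos.le.trans P.K_le

theorem ContractionParams.KT (P : ContractionParams K L S T κ) : K * T ^ 2 ≤ 3 / 20 :=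
  (mul_le_mul_of_nonneg_right P.K_le (sq_nonneg T)).trans P.LT

theorem ContractionParams.radius_nonneg (P : ContractionParams K L S T κ) :
    0 ≤ 4 * S + 5 / 2 * T := by
  have := P.S_nonneg
  have := P.T_pos
  positivity

theorem ContractionParams.radius_div (P : ContractionParams K L S T κ) :
    (4 * S + 5 / 2 * T) / T = 4 * (S / T) + 5 / 2 := by
  have := P.T_pos.ne'
  field_simp

/-- With q = S / T, the condition on κ and T + 8 S ≤ T exp(8 q) give κ of order K² T² exp(-24 q).
After multiplication by exp(4 q + 5/2) the interaction term is quadratic in K T² with a tiny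
constant, so it fits together with the rate into the budget 1/100. -/
theorem ContractionParams.rate_add_le (P : ContractionParams K L S T κ) :
    K * T ^ 2 / 156 * Real.exp (-10 * (S / T)) +
      14 * κ * T ^ 2 * Real.exp ((4 * S + 5 / 2 * T) / T) ≤
      1 / 100 * (K * T ^ 2) * Real.exp (-4 * (S / T)) := by
  have hT := P.T_pos
  have hK := P.K_pos
  have hq : 0 ≤ S / T := div_nonneg P.S_nonneg hT.le
  rw [P.radius_div]
  set q := S / T with hqdef
  have hS : S = q * T := by rw [hqdef, div_mul_cancel₀ _ hT.ne']
  have h1 : (T + 8 * S) ^ 2 ≤ T ^ 2 * Real.exp (16 * q) := by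
    have h2 : T + 8 * S ≤ T * Real.exp (8 * q) := by
      have := mul_le_mul_of_nonneg_left (Real.add_one_le_exp (8 * q)) hT.le
      rw [hS]; linarith
    have h3 : Real.exp (16 * q) = Real.exp (8 * q) ^ 2 := by
      rw [← Real.exp_nat_mul]; congr 1; push_cast; ring
    rw [h3, ← mul_pow]
    exact pow_le_pow_left₀ (by rw [hS]; positivity) h2 2
  have h2 : κ ≤ 1 / 2 * (K / (36 * 149)) ^ 2 * T ^ 2 * Real.exp (-24 * q) := by
    refine P.κ_le.trans ?_
    have h3 : Real.exp (-24 * q) = Real.exp (16 * q) * Real.exp (-40 * q) := by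
      rw [← Real.exp_add]; congr 1; ring
    rw [h3, mul_assoc _ (T ^ 2), ← mul_assoc (T ^ 2), ← mul_assoc]
    gcongr
  have h3 : Real.exp (4 * q + 5 / 2) ≤ 13 * Real.exp (4 * q) := by
    rw [Real.exp_add, mul_comm]
    exact mul_le_mul_of_nonneg_right exp_five_halves_mem.2 (Real.exp_pos _).le
  have h4 : 14 * κ * T ^ 2 * Real.exp (4 * q + 5 / 2) ≤
      14 * (1 / 2 * (K / (36 * 149)) ^ 2 * T ^ 2 * Real.exp (-24 * q)) * T ^ 2 *
        (13 * Real.exp (4 * q)) := by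
    have := P.κ_nonneg
    gcongr
  have h5 : 14 * (1 / 2 * (K / (36 * 149)) ^ 2 * T ^ 2 * Real.exp (-24 * q)) * T ^ 2 *
        (13 * Real.exp (4 * q)) = 91 / 5364 ^ 2 * (K * T ^ 2) ^ 2 * Real.exp (-20 * q) := by
    have : Real.exp (-20 * q) = Real.exp (-24 * q) * Real.exp (4 * q) := by
      rw [← Real.exp_add]; congr 1; ring
    rw [this]; ring
  have h6 : Real.exp (-20 * q) ≤ Real.exp (-4 * q) := Real.exp_le_exp.2 (by linarith)
  have h7 : Real.exp (-10 * q) ≤ Real.exp (-4 * q) := Real.exp_le_exp.2 (by linarith)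
  have hκ0 : 0 ≤ K * T ^ 2 := by positivity
  have h8 : (K * T ^ 2) ^ 2 ≤ 3 / 20 * (K * T ^ 2) := by
    rw [sq]; exact mul_le_mul_of_nonneg_right P.KT hκ0
  have h9 : 91 / 5364 ^ 2 * (K * T ^ 2) ^ 2 * Real.exp (-20 * q) ≤
      91 / 5364 ^ 2 * (3 / 20 * (K * T ^ 2)) * Real.exp (-4 * q) := by gcongr
  have h10 : K * T ^ 2 / 156 * Real.exp (-10 * q) ≤ K * T ^ 2 / 156 * Real.exp (-4 * q) := by
    gcongr
  have h11 : 0 ≤ K * T ^ 2 * Real.exp (-4 * q) := by positivity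
  rw [h5] at h4
  linarith

end Params

/-! ### Coupling the velocities of one pair of particles -/

section Particle

variable {F : Type*} [NormedAddCommGroup F] [InnerProductSpace ℝ F]
  {K L S T κ : ℝ}

/-- A bound for the distance of two particles which start at distance `z` and with velocity
difference `w`, along the free motion. -/
def freeDist (T : ℝ) (z w : F) : ℝ := max ‖z‖ ‖z + T • w‖

open Classical in
/-- A bound for the distance after one step without interaction. -/
def stepDist (K L S T : ℝ) (z w : F) : ℝ :=
  if w = 0 ∧ 4 * S ≤ ‖z‖ then ‖z‖ * (1 - 3 / 10 * (K * T ^ 2))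
  else ‖z + T • w‖ + 6 / 11 * (L * T ^ 2) * freeDist T z w

theorem freeDist_nonneg (z w : F) : 0 ≤ freeDist T z w := (norm_nonneg z).trans (le_max_left _ _)

theorem freeDist_le (hT : 0 ≤ T) (z w : F) : freeDist T z w ≤ ‖z‖ + T * ‖w‖ := by
  refine max_le (by have := norm_nonneg w; nlinarith) ((norm_add_le _ _).trans ?_)
  rw [norm_smul, Real.norm_of_nonneg hT]

theorem ContractionParams.stepDist_nonneg (P : ContractionParams K L S T κ) (z w : F) :
    0 ≤ stepDist K L S T z w := by
  have := freeDist_nonneg (T := T) z w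
  have := P.L_nonneg
  unfold stepDist
  split_ifs
  · exact mul_nonneg (norm_nonneg _) (by linarith [P.KT])
  · positivity

theorem ContractionParams.stepDist_le (P : ContractionParams K L S T κ) (z w : F) :
    stepDist K L S T z w ≤ 2 * (‖z‖ + T * ‖w‖) := by
  have h0 := freeDist_nonneg (T := T) z w
  have h1 := freeDist_le P.T_pos.le z w
  have h2 : ‖z + T • w‖ ≤ freeDist T z w := le_max_right _ _
  have h3 : ‖z‖ ≤ freeDist T z w := le_max_left _ _
  have hK := P.K_pos
  unfold stepDist
  split_ifs
  · have : ‖z‖ * (1 - 3 / 10 * (K * T ^ 2)) ≤ ‖z‖ :=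
      mul_le_of_le_one_right (norm_nonneg _) (by have : 0 ≤ K * T ^ 2 := by positivity
                                                 linarith)
    linarith
  · have := mul_le_mul_of_nonneg_right P.LT h0
    linarith

variable [MeasurableSpace F] [BorelSpace F]

theorem measurable_freeDist (z : F) : Measurable (fun w => freeDist T z w) := by
  unfold freeDist
  exact Continuous.measurable (by fun_prop)

theorem measurable_stepDist (z : F) : Measurable (fun w => stepDist K L S T z w) := by
  unfold stepDist
  refine Measurable.ite ?_ measurable_const ?_
  · by_cases h : 4 * S ≤ ‖z‖
    · simp [h]
    · simp [h]
  · have h1 : Measurable fun w : F => ‖z + T • w‖ := Continuous.measurable (by fun_prop)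
    exact h1.add ((measurable_freeDist z).const_mul _)

/-- The quantity that bounds the distance of two particles after one step, including the influence
of the interaction. -/
def stepCost (K L S T κ : ℝ) (z w : F) : ℝ :=
  profile T (4 * S + 5 / 2 * T) (stepDist K L S T z w) + 6 * κ * T ^ 2 * freeDist T z w

theorem measurable_stepCost (z : F) : Measurable (fun w => stepCost K L S T κ z w) := by
  unfold stepCost
  exact (continuous_profile.measurable.comp (measurable_stepDist z)).add
    ((measurable_freeDist z).const_mul _)

theorem ContractionParams.abs_stepCost_le (P : ContractionParams K L S T κ) (z w : F) :
    |stepCost K L S T κ z w| ≤ (2 + 6 * κ * T ^ 2) * ‖z‖ + ((2 + 6 * κ * T ^ 2) * T) * ‖w‖ := by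
  have h1 := profile_nonneg P.T_pos P.radius_nonneg (P.stepDist_nonneg z w)
  have h2 := profile_le P.T_pos P.radius_nonneg (P.stepDist_nonneg z w)
  have h3 : 0 ≤ 6 * κ * T ^ 2 := by have := P.κ_nonneg; positivity
  have h4 := mul_nonneg h3 (freeDist_nonneg (T := T) z w)
  have h5 := mul_le_mul_of_nonneg_left (freeDist_le P.T_pos.le z w) h3
  have h6 := P.stepDist_le z w
  unfold stepCost
  rw [abs_of_nonneg (by linarith)]
  linarith

/-- At large distance the norm shrinks by 3/10 K T², and the slope of the profile is at least exp(-4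
S / T) / 13. The gain 3/130 exceeds the budget 1/100 of `rate_add_le`. -/
theorem ContractionParams.stepCost_synchronous_le (P : ContractionParams K L S T κ) (z : F)
    (hz : z = 0 ∨ 4 * S ≤ ‖z‖) :
    stepCost K L S T κ z 0 ≤ (1 - K * T ^ 2 / 156 * Real.exp (-10 * (S / T))) *
      profile T (4 * S + 5 / 2 * T) ‖z‖ := by
  have hT := P.T_pos
  have hR := P.radius_nonneg
  by_cases h : 4 * S ≤ ‖z‖
  · have h1 := profile_sub_le (R₁ := 4 * S + 5 / 2 * T) hT ‖z‖
      (‖z‖ * (1 - 3 / 10 * (K * T ^ 2)))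
    have h2 := exp_le_profileSlope (R₁ := 4 * S + 5 / 2 * T) hT ‖z‖
    have h3 := profile_le hT hR (norm_nonneg z)
    have h4 := le_exp_mul_profile hT hR (norm_nonneg z)
    have h0 := profile_nonneg hT hR (norm_nonneg z)
    have h5 := P.rate_add_le
    have h6 : 1 / 13 * Real.exp (-4 * (S / T)) ≤ Real.exp (-((4 * S + 5 / 2 * T) / T)) := by
      rw [P.radius_div, neg_add, Real.exp_add, mul_comm, neg_mul]
      refine mul_le_mul_of_nonneg_left ?_ (Real.exp_pos _).le
      rw [Real.exp_neg, one_div]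
      exact inv_anti₀ (Real.exp_pos _) exp_five_halves_mem.2
    have hκ0 : 0 ≤ K * T ^ 2 := by have := P.K_pos; positivity
    have hκ : 0 ≤ κ * T ^ 2 := by have := P.κ_nonneg; positivity
    have e1 : stepDist K L S T z 0 = ‖z‖ * (1 - 3 / 10 * (K * T ^ 2)) := if_pos ⟨rfl, h⟩
    have e2 : freeDist T z 0 = ‖z‖ := by simp [freeDist]
    rw [stepCost, e1, e2]
    set f := profile T (4 * S + 5 / 2 * T) ‖z‖
    set E := Real.exp (-4 * (S / T))
    have h7 : 1 / 13 * E * f ≤ profileSlope T (4 * S + 5 / 2 * T) ‖z‖ * ‖z‖ :=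
      mul_le_mul (h6.trans h2) h3 h0 (profileSlope_pos _).le
    have h8 := mul_le_mul_of_nonneg_left h7 hκ0
    have h9 := mul_le_mul_of_nonneg_right h5 h0
    have h10 := mul_le_mul_of_nonneg_left h4 hκ
    have h11 : 0 ≤ K * T ^ 2 * E * f := by positivity
    have h12 : 0 ≤ κ * T ^ 2 * (Real.exp ((4 * S + 5 / 2 * T) / T) * f) := by positivity
    linarith
  · have hz0 : z = 0 := hz.resolve_right h
    subst hz0
    simp [stepCost, stepDist, freeDist, profile_zero hR]

/-- The coupling strength γ = min(1/T, 1/(32 S)) is chosen so that a success does not overshoot (γ T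
≤ 1), the Gaussian shift γ |z| is at most 1/8 for |z| < 4 S, and the force term is small relative to
the gain γ T. The last point matches 3/640 with 3/20 · 1/32. -/
theorem ContractionParams.reflectionStrength (P : ContractionParams K L S T κ) (hS : 0 < S) :
    0 < min (1 / T) (1 / (32 * S)) ∧ min (1 / T) (1 / (32 * S)) * T ≤ 1 ∧
      min (1 / T) (1 / (32 * S)) * S ≤ 1 / 32 ∧
      L * T ^ 2 ≤ 3 / 20 * (min (1 / T) (1 / (32 * S)) * T) := by
  have hT := P.T_pos
  refine ⟨lt_min (by positivity) (by positivity), ?_, ?_, ?_⟩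
  · exact (mul_le_mul_of_nonneg_right (min_le_left _ _) hT.le).trans
      (by rw [one_div, inv_mul_cancel₀ hT.ne'])
  · refine (mul_le_mul_of_nonneg_right (min_le_right _ _) hS.le).trans (le_of_eq ?_)
    field_simp
  · rcases min_choice (1 / T) (1 / (32 * S)) with h | h <;> rw [h]
    · rw [one_div, inv_mul_cancel₀ hT.ne']
      linarith [P.LT]
    · have h1 := mul_le_mul_of_nonneg_right P.LTS hT.le
      have h2 : 3 / 20 * (1 / (32 * S) * T) = 3 / 640 * T / S := by field_simp; norm_num
      rw [h2, le_div_iff₀ hS]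
      linarith

/-- The free motion shrinks z by the factor 1 - γ T, of which the forces undo at most 6/11 · 3/20;
hence 101/110 = 1 - 9/110. -/
theorem ContractionParams.stepCost_success_le (P : ContractionParams K L S T κ) {z : F} {γ : ℝ}
    (hz : ‖z‖ < 4 * S) (hγ : 0 ≤ γ) (hγT : γ * T ≤ 1) (hL : L * T ^ 2 ≤ 3 / 20 * (γ * T)) :
    stepCost K L S T κ z (-(γ • z)) ≤ profile T (4 * S + 5 / 2 * T) ‖z‖ -
      profileSlope T (4 * S + 5 / 2 * T) ‖z‖ * (101 / 110 * (γ * T) * ‖z‖) +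
        6 * κ * T ^ 2 * ‖z‖ := by
  have hr := norm_nonneg z
  have hT := P.T_pos
  have e1 : ‖z + T • -(γ • z)‖ = (1 - γ * T) * ‖z‖ := by
    have : z + T • -(γ • z) = (1 - γ * T) • z := by
      rw [smul_neg, smul_smul, sub_smul, one_smul, mul_comm, sub_eq_add_neg]
    rw [this, norm_smul, Real.norm_of_nonneg (by linarith)]
  have e2 : freeDist T z (-(γ • z)) = ‖z‖ := by
    rw [freeDist, e1, max_eq_left]
    have := mul_nonneg (mul_nonneg hγ hT.le) hr
    linarith
  have e3 : stepDist K L S T z (-(γ • z)) = (1 - γ * T) * ‖z‖ + 6 / 11 * (L * T ^ 2) * ‖z‖ := by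
    rw [stepDist, if_neg (fun h => absurd h.2 (not_le.2 hz)), e1, e2]
  have h1 := profile_sub_le (R₁ := 4 * S + 5 / 2 * T) hT ‖z‖
    ((1 - γ * T) * ‖z‖ + 6 / 11 * (L * T ^ 2) * ‖z‖)
  have h2 := mul_le_mul_of_nonneg_right hL hr
  have h3 := mul_le_mul_of_nonneg_left (show ((1 - γ * T) * ‖z‖ + 6 / 11 * (L * T ^ 2) * ‖z‖) -
    ‖z‖ ≤ -(101 / 110 * (γ * T) * ‖z‖) by linarith)
    (profileSlope_pos (T := T) (R₁ := 4 * S + 5 / 2 * T) ‖z‖).le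
  rw [stepCost, e2, e3]
  linarith

/-- A failure costs at most T times the slope up to the radius. Beyond it the slope is damped by
1/12, while the excess over the radius is at most 119/55 T |s|, giving the coefficient 1/5 of |s|.
-/
theorem ContractionParams.stepCost_failure_le (P : ContractionParams K L S T κ) {z e : F}
    (hz : ‖z‖ < 4 * S) (he : ‖e‖ = 1) (s : ℝ) :
    stepCost K L S T κ z ((2 * s) • e) ≤ (profile T (4 * S + 5 / 2 * T) ‖z‖ +
      profileSlope T (4 * S + 5 / 2 * T) ‖z‖ * T + 6 * κ * T ^ 2 * ‖z‖) +
      (profileSlope T (4 * S + 5 / 2 * T) ‖z‖ * T / 5 + 12 * κ * T ^ 2 * T) * |s| := by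
  have hr := norm_nonneg z
  have hT := P.T_pos
  have hs := abs_nonneg s
  have hL := P.L_nonneg
  have hS := P.S_nonneg
  have hTs : 0 ≤ T * |s| := by positivity
  have e1 : ‖z + T • (2 * s) • e‖ ≤ ‖z‖ + 2 * (T * |s|) := by
    refine (norm_add_le _ _).trans ?_
    rw [norm_smul, norm_smul, he, Real.norm_of_nonneg hT.le, Real.norm_eq_abs, abs_mul, abs_two]
    linarith
  have e2 : freeDist T z ((2 * s) • e) ≤ ‖z‖ + 2 * (T * |s|) := max_le (by linarith) e1
  have h1 : stepDist K L S T z ((2 * s) • e) - (4 * S + 5 / 2 * T) ≤ 119 / 55 * (T * |s|) := by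
    have h2 : 6 / 11 * (L * T ^ 2) * freeDist T z ((2 * s) • e) ≤
        6 / 11 * (L * T ^ 2) * (‖z‖ + 2 * (T * |s|)) := by gcongr
    have h3 : L * T ^ 2 * ‖z‖ ≤ L * T ^ 2 * (4 * S) := by gcongr
    have h4 := mul_le_mul_of_nonneg_right P.LTS hT.le
    have h5 := mul_le_mul_of_nonneg_right P.LT hTs
    rw [stepDist, if_neg (fun h => absurd h.2 (not_le.2 hz))]
    linarith
  have h2 := profile_sub_le_of_le hT (s := ‖z‖) (R₁ := 4 * S + 5 / 2 * T) (by linarith)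
    (stepDist K L S T z ((2 * s) • e)) h1 (by positivity)
  have h3 : Real.exp (-((4 * S + 5 / 2 * T - ‖z‖) / T)) ≤ 1 / 12 := by
    have h4 : 5 / 2 ≤ (4 * S + 5 / 2 * T - ‖z‖) / T := by
      rw [le_div_iff₀ hT]; linarith
    refine (Real.exp_le_exp.2 (neg_le_neg h4)).trans ?_
    rw [Real.exp_neg, one_div]
    exact inv_anti₀ (by norm_num) exp_five_halves_mem.1
  have h5 := profileSlope_pos (T := T) (R₁ := 4 * S + 5 / 2 * T) ‖z‖
  have h6 : Real.exp (-((4 * S + 5 / 2 * T - ‖z‖) / T)) * (119 / 55 * (T * |s|)) ≤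
      1 / 5 * (T * |s|) := by
    have := mul_le_mul_of_nonneg_right h3 (show 0 ≤ 119 / 55 * (T * |s|) by positivity)
    linarith
  have h7 := mul_le_mul_of_nonneg_left h6 h5.le
  have h8 := mul_le_mul_of_nonneg_left e2 (show 0 ≤ 6 * κ * T ^ 2 by
    have := P.κ_nonneg; positivity)
  rw [stepCost]
  linarith

variable [FiniteDimensional ℝ F]

/-- In units of γ T |z| times the slope, success gains at least (1 - 9/128) · 101/110 and failure
costs at most 9/16 · (1 + 1/5), which is smaller. The interaction adds at most (6 + 12 · 9/16) κ T²
|z|, below the 14 allowed in `rate_add_le`. -/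
theorem ContractionParams.integral_reflection_stepCost_le (P : ContractionParams K L S T κ) {z e : F}
    (hz : ‖z‖ < 4 * S) (he : ‖e‖ = 1) (hze : z = ‖z‖ • e) {γ : ℝ}
    (hγ : 0 ≤ γ) (hγT : γ * T ≤ 1) (hγS : γ * S ≤ 1 / 32) (hL : L * T ^ 2 ≤ 3 / 20 * (γ * T)) :
    ∫ p, stepCost K L S T κ z (p.1 - p.2) ∂reflectionCoupling e (γ * ‖z‖) ≤
      (1 - K * T ^ 2 / 156 * Real.exp (-10 * (S / T))) * profile T (4 * S + 5 / 2 * T) ‖z‖ := by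
  have hT := P.T_pos
  have hR := P.radius_nonneg
  have hr := norm_nonneg z
  have hκ := P.κ_nonneg
  have ha : 0 ≤ γ * ‖z‖ := by positivity
  have ha1 : γ * ‖z‖ ≤ 1 / 8 := by
    have := mul_le_mul_of_nonneg_left hz.le hγ
    linarith
  have hslope := profileSlope_pos (T := T) (R₁ := 4 * S + 5 / 2 * T) ‖z‖
  have hsucc := P.stepCost_success_le hz hγ hγT hL
  have hγz : γ • z = (γ * ‖z‖) • e := by rw [mul_smul, ← hze]
  rw [hγz] at hsucc
  have hmain := integral_reflectionCoupling_le he ha (measurable_stepCost z) (P.abs_stepCost_le z)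
    (by positivity) hsucc (by positivity) (P.stepCost_failure_le hz he)
  refine hmain.trans ?_
  have hp0 := reflectionProb_nonneg e (γ * ‖z‖)
  have hq : (γ * ‖z‖ + (γ * ‖z‖) ^ 2) / 2 ≤ 9 / 16 * (γ * ‖z‖) := by
    have := mul_le_mul_of_nonneg_left ha1 ha
    linarith
  have hp := (reflectionProb_le he ha).trans hq
  set pr := reflectionProb e (γ * ‖z‖)
  have hexp : Real.exp (-4 * (S / T)) ≤ profileSlope T (4 * S + 5 / 2 * T) ‖z‖ := by
    rw [profileSlope, min_eq_left (by linarith)]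
    refine Real.exp_le_exp.2 ?_
    have : ‖z‖ / T ≤ 4 * S / T := by gcongr
    linarith [mul_div_assoc 4 S T]
  have h3 := profile_le hT hR hr
  have h4 := le_exp_mul_profile hT hR hr
  have h0 := profile_nonneg hT hR hr
  have h5 := P.rate_add_le
  set f := profile T (4 * S + 5 / 2 * T) ‖z‖
  set f' := profileSlope T (4 * S + 5 / 2 * T) ‖z‖
  set E := Real.exp (-4 * (S / T)) with hE
  set E' := Real.exp ((4 * S + 5 / 2 * T) / T)
  set r := ‖z‖
  have hKγ : K * T ^ 2 ≤ 3 / 20 * (γ * T) :=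
    (mul_le_mul_of_nonneg_right P.K_le (sq_nonneg T)).trans hL
  have hE0 : 0 < E := Real.exp_pos _
  have t1 : pr * (f' * (101 / 110 * (γ * T) * r)) ≤ 9 / 128 * (f' * (101 / 110 * (γ * T) * r)) :=
    mul_le_mul_of_nonneg_right (by linarith) (by positivity)
  have t2 : pr * (f' * T) ≤ 9 / 16 * (γ * r) * (f' * T) :=
    mul_le_mul_of_nonneg_right hp (by positivity)
  have t3 : (f' * T / 5 + 12 * κ * T ^ 2 * T) * ((γ * r + (γ * r) ^ 2) / 2) ≤
      (f' * T / 5 + 12 * κ * T ^ 2 * T) * (9 / 16 * (γ * r)) :=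
    mul_le_mul_of_nonneg_left hq (by positivity)
  have t4 : κ * T ^ 2 * r * (γ * T) ≤ κ * T ^ 2 * r * 1 :=
    mul_le_mul_of_nonneg_left hγT (by positivity)
  have t5 : κ * T ^ 2 * r ≤ κ * T ^ 2 * (E' * f) := mul_le_mul_of_nonneg_left h4 (by positivity)
  have t6 : γ * T * (E * f) ≤ γ * T * (f' * r) :=
    mul_le_mul_of_nonneg_left (mul_le_mul hexp h3 h0 hslope.le) (by positivity)
  have t7 := mul_le_mul_of_nonneg_right h5 h0
  have t8 : K * T ^ 2 * (E * f) ≤ 3 / 20 * (γ * T) * (E * f) :=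
    mul_le_mul_of_nonneg_right hKγ (by positivity)
  have t9 : 0 ≤ γ * T * (E * f) := by positivity
  have t10 : 0 ≤ γ * T * (f' * r) := by positivity
  have t11 : 0 ≤ κ * T ^ 2 * r := by positivity
  linarith

/-- The coupling of the velocities of two particles: synchronous for distant particles, and
reflection coupling for close particles. -/
theorem ContractionParams.exists_coupling (P : ContractionParams K L S T κ) (z : F) :
    ∃ Γ : Measure (F × F), Γ.fst = stdGaussian F ∧ Γ.snd = stdGaussian F ∧
      ∫ p, stepCost K L S T κ z (p.1 - p.2) ∂Γ ≤
        (1 - K * T ^ 2 / 156 * Real.exp (-10 * (S / T))) *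
          profile T (4 * S + 5 / 2 * T) ‖z‖ := by
  -- Particles at the same place have no direction to reflect in and are coupled synchronously as
  -- well. In the remaining case 0 < |z| < 4 S, so S > 0.
  by_cases hz : z = 0 ∨ 4 * S ≤ ‖z‖
  · have hm : Measurable fun ξ : F => (ξ, ξ) := measurable_id.prodMk measurable_id
    refine ⟨(stdGaussian F).map fun ξ => (ξ, ξ), ?_, ?_, ?_⟩
    · rw [Measure.fst, Measure.map_map measurable_fst hm]
      exact Measure.map_id
    · rw [Measure.snd, Measure.map_map measurable_snd hm]
      exact Measure.map_id
    · have hm' : Measurable fun p : F × F => stepCost K L S T κ z (p.1 - p.2) :=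
        (measurable_stepCost z).comp (measurable_fst.sub measurable_snd)
      rw [integral_map hm.aemeasurable hm'.aestronglyMeasurable]
      simpa using P.stepCost_synchronous_le z hz
  · rw [not_or, not_le] at hz
    obtain ⟨hz0, hz⟩ := hz
    have hr : 0 < ‖z‖ := norm_pos_iff.2 hz0
    obtain ⟨h1, h2, h3, h4⟩ := P.reflectionStrength (by linarith)
    have he : ‖(‖z‖⁻¹ • z : F)‖ = 1 := by
      rw [norm_smul, norm_inv, norm_norm, inv_mul_cancel₀ hr.ne']
    exact ⟨_, reflectionCoupling_fst _ _, reflectionCoupling_snd he _,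
      P.integral_reflection_stepCost_le hz he
        (by rw [smul_smul, mul_inv_cancel₀ hr.ne', one_smul]) h1.le h2 h3 h4⟩

end Particle

/-! ### One step of the coupled particle system -/

section OneStep

variable {n k : ℕ} {V W : EuclideanSpace ℝ (Fin k) → ℝ} {ε L L' LH LH' K S T h : ℝ} {N : ℕ}

/-- One common interaction error serves for the deviation from free motion, the size of the
difference and the interaction impulse. Here `m` bounds the mean distance of all particles. -/
theorem free_motion_error_le {L κ t a m : ℝ} (hκ : 0 ≤ κ) (ha : 0 ≤ a) (hm : 0 ≤ m)
    (hLT : L * t ^ 2 ≤ 3 / 20) (hκT : κ * t ^ 2 ≤ 1 / 24) :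
    t ^ 2 / 2 * ((L + 2 * κ) * (12 / 11 * (a + t ^ 2 / 2 * (2 * κ * m))) + 2 * κ * m) ≤
      6 / 11 * (L * t ^ 2) * a + κ * t ^ 2 * (11 / 10 * a + 13 / 10 * m) ∧
    12 / 11 * (a + t ^ 2 / 2 * (2 * κ * m)) ≤
      12 / 11 * a + κ * t ^ 2 * (11 / 10 * a + 13 / 10 * m) ∧
    t ^ 2 / 2 * (2 * κ * (12 / 11 * (a + t ^ 2 / 2 * (2 * κ * m)) + m)) ≤
      κ * t ^ 2 * (11 / 10 * a + 13 / 10 * m) := by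
  have h0 : 0 ≤ κ * t ^ 2 := by positivity
  have h1 : L * t ^ 2 * (κ * t ^ 2 * m) ≤ 3 / 20 * (κ * t ^ 2 * m) :=
    mul_le_mul_of_nonneg_right hLT (by positivity)
  have h2 : κ * t ^ 2 * (κ * t ^ 2 * m) ≤ 1 / 24 * (κ * t ^ 2 * m) :=
    mul_le_mul_of_nonneg_right hκT (by positivity)
  have h3 : 0 ≤ κ * t ^ 2 * m := by positivity
  have h4 : 0 ≤ κ * t ^ 2 * a := by positivity
  refine ⟨?_, ?_, ?_⟩ <;> linarith

/-- The influence of the interaction on the distance of the `i`-th particles after one step. -/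
def interactionError (T κ : ℝ) (x y ξ η : Config n k) (i : Fin n) : ℝ :=
  κ * T ^ 2 * (11 / 10 * freeDist T (x i - y i) (ξ i - η i) +
    13 / 10 * (12 / 11 * (∑ l, freeDist T (x l - y l) (ξ l - η l)) / n))

/-- The two branches match `stepDist`: strong convexity for distant particles with equal velocities,
and otherwise the a priori deviation from free motion. -/
theorem ContractionParams.norm_le_stepDist_add {F : Type*} [NormedAddCommGroup F]
    [InnerProductSpace ℝ F] {κ : ℝ} (P : ContractionParams K L S T κ) {z v g b : ℕ → F}
    (Z : IsVerlet h z v g) (hh : 0 ≤ h) (hTN : T = N * h) {m : ℝ} (hm : 0 ≤ m)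
    (hgb : ∀ j < N, ‖g j - b j‖ ≤ 2 * κ * (‖z j‖ + m)) (hb : ∀ j < N, ‖b j‖ ≤ L * ‖z j‖)
    (hconv : ∀ j < N, K * ‖z j‖ ^ 2 - K * S ^ 2 ≤ inner ℝ (z j) (b j)) :
    ‖z N‖ ≤ stepDist K L S T (z 0) (v 0) +
      2 * (κ * T ^ 2 * (11 / 10 * freeDist T (z 0) (v 0) + 13 / 10 * m)) := by
  have hκ : 0 ≤ κ := P.κ_nonneg
  have hL : 0 ≤ L := P.L_nonneg
  have hκT : κ * T ^ 2 ≤ 1 / 24 := by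
    have h1 := P.ΛT
    have h2 : 0 ≤ L * T ^ 2 := by positivity
    linarith
  have hZ := Z.seminorm_le (normSeminorm ℝ F) (Λ := L + 2 * κ)
    (a := freeDist T (z 0) (v 0)) (N := N) (C := 2 * κ * m) hh (by positivity)
    (by rw [← hTN]; linarith [P.ΛT, mul_nonneg hκ (sq_nonneg T)])
    (le_max_left _ _) (by rw [← hTN]; exact le_max_right _ _) (by positivity) (by
      intro j hj
      have h1 := norm_add_le (g j - b j) (b j)
      rw [sub_add_cancel] at h1
      simp only [coe_normSeminorm]
      linarith [hgb j hj, hb j hj])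
  rw [← hTN] at hZ
  simp only [coe_normSeminorm] at hZ
  obtain ⟨hpos, herr⟩ := hZ
  have ha0 : 0 ≤ freeDist T (z 0) (v 0) := freeDist_nonneg _ _
  obtain ⟨n1, n2, n3⟩ := free_motion_error_le hκ ha0 hm P.LT hκT
  have hD0 : 0 ≤ κ * T ^ 2 * (11 / 10 * freeDist T (z 0) (v 0) + 13 / 10 * m) := by positivity
  by_cases hc : v 0 = 0 ∧ 4 * S ≤ ‖z 0‖
  · have ha : freeDist T (z 0) (v 0) = ‖z 0‖ := by simp [freeDist, hc.1]
    rw [stepDist, if_pos hc]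
    rw [ha] at hpos herr n1 n2 n3 hD0 ⊢
    refine Z.norm_le_of_strongly_convex (b := b)
      hTN P.K_pos.le hL hD0 P.KT P.LT P.LLT hc.1 rfl ?_ ?_ hb ?_ ?_
    · intro j hj
      have := (herr j hj.le).trans n1
      rwa [hc.1, smul_zero, add_zero] at this
    · exact fun j hj => (hpos j hj.le).trans n2
    · intro j hj
      refine le_trans ?_ (hconv j hj)
      -- The threshold 4 S makes the convexity defect K S² at most a sixteenth of K r².
      have h1 : S ^ 2 ≤ ‖z 0‖ ^ 2 / 16 := by nlinarith [hc.2, P.S_nonneg]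
      have h2 := mul_le_mul_of_nonneg_left h1 P.K_pos.le
      linarith
    · intro j hj
      refine le_trans (mul_le_mul_of_nonneg_left ?_ (by positivity)) n3
      refine (hgb j hj).trans ?_
      have := hpos j hj.le
      gcongr
  · rw [stepDist, if_neg hc]
    have h1 := (herr N le_rfl).trans n1
    rw [← hTN] at h1
    have h2 := norm_add_le (z 0 + T • v 0) (z N - (z 0 + T • v 0))
    rw [add_sub_cancel] at h2
    linarith

/-- The estimate for one particle involves the mean distance of all. The `ell1` distance satisfies a
closed inequality, so it can be bounded beforehand. -/
theorem MeanFieldBounds.mean_norm_sub_le (H : MeanFieldBounds V W L L' LH LH')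
    (P : ContractionParams K L S T (ε * L')) (hε : 0 ≤ ε) (hh : 0 ≤ h) (hTN : T = N * h)
    (x y ξ η : Config n k) {j : ℕ} (hj : j ≤ N) :
    (∑ l, ‖((verletStep (meanFieldPotential V W ε n) h)^[j] (x, ξ)).1 l -
        ((verletStep (meanFieldPotential V W ε n) h)^[j] (y, η)).1 l‖) / n ≤
      12 / 11 * (∑ l, freeDist T (x l - y l) (ξ l - η l)) / n := by
  have Z := (isVerlet_iterate (meanFieldPotential V W ε n) h (x, ξ)).sub
    (isVerlet_iterate (meanFieldPotential V W ε n) h (y, η))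
  have hL' : 0 ≤ 4 * ε * L' := by have := P.κ_nonneg; linarith
  have h0 : ell1Seminorm n k (x - y) ≤ ∑ l, freeDist T (x l - y l) (ξ l - η l) := by
    rw [ell1Seminorm_apply]
    exact Finset.sum_le_sum fun l _ => le_max_left _ _
  have h1 : ell1Seminorm n k (x - y + (N * h) • (ξ - η)) ≤
      ∑ l, freeDist T (x l - y l) (ξ l - η l) := by
    rw [ell1Seminorm_apply, ← hTN]
    exact Finset.sum_le_sum fun l _ => le_max_right _ _
  have h2 := (Z.seminorm_le (ell1Seminorm n k) (Λ := L + 4 * ε * L') hh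
      (add_nonneg P.L_nonneg hL') (by rw [← hTN, mul_assoc 4]; exact P.ΛT) h0 h1 le_rfl
      (fun i _ => by rw [add_zero]; exact H.ell1_gradient_sub_le hε _ _)).1 j hj
  rw [mul_zero, add_zero] at h2
  exact div_le_div_of_nonneg_right h2 (Nat.cast_nonneg n)

theorem MeanFieldBounds.norm_verletPosition_sub_le (H : MeanFieldBounds V W L L' LH LH')
    (P : ContractionParams K L S T (ε * L')) (hε : 0 ≤ ε) (hh : 0 ≤ h) (hTN : T = N * h)
    (hconv : ∀ u v, K * ‖u - v‖ ^ 2 - K * S ^ 2 ≤ inner ℝ (u - v) (gradient V u - gradient V v))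
    (x y ξ η : Config n k) (i : Fin n) :
    ‖verletPosition (meanFieldPotential V W ε n) h N x ξ i -
        verletPosition (meanFieldPotential V W ε n) h N y η i‖ ≤
      stepDist K L S T (x i - y i) (ξ i - η i) +
        2 * interactionError T (ε * L') x y ξ η i := by
  have Z := ((isVerlet_iterate (meanFieldPotential V W ε n) h (x, ξ)).sub
    (isVerlet_iterate (meanFieldPotential V W ε n) h (y, η))).map (particle i).toLinearMap
  have hm : 0 ≤ 12 / 11 * (∑ l, freeDist T (x l - y l) (ξ l - η l)) / n :=
    div_nonneg (mul_nonneg (by norm_num) (Finset.sum_nonneg fun l _ => freeDist_nonneg _ _))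
      (Nat.cast_nonneg n)
  refine P.norm_le_stepDist_add Z hh hTN hm (b := fun j =>
    gradient V (((verletStep (meanFieldPotential V W ε n) h)^[j] (x, ξ)).1 i) -
      gradient V (((verletStep (meanFieldPotential V W ε n) h)^[j] (y, η)).1 i))
    (fun j hj => ?_) (fun j _ => norm_gradient_sub_le H.smoothV H.hessV _ _)
    (fun j _ => hconv _ _)
  refine (H.interaction_le hε _ _ i).trans (mul_le_mul_of_nonneg_left
    (add_le_add_right (H.mean_norm_sub_le P hε hh hTN x y ξ η hj.le) _)
    (mul_nonneg two_pos.le P.κ_nonneg))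

/-- The distance in which the chain contracts. -/
def profileDist (T S : ℝ) (x y : Config n k) : ℝ :=
  ∑ i, profile T (4 * S + 5 / 2 * T) ‖x i - y i‖

/-- Summation turns means into totals, and 2 (11/10 + 13/10 · 12/11) is about 5.04, hence the 6 in
`stepCost`. -/
theorem sum_interactionError_le {κ : ℝ} (hκ : 0 ≤ κ) (x y ξ η : Config n k) :
    ∑ i, 2 * interactionError T κ x y ξ η i ≤
      ∑ i, 6 * κ * T ^ 2 * freeDist T (x i - y i) (ξ i - η i) := by
  simp only [interactionError]
  set a : Fin n → ℝ := fun l => freeDist T (x l - y l) (ξ l - η l) with ha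
  have ha0 : 0 ≤ ∑ l, a l := Finset.sum_nonneg fun l _ => freeDist_nonneg _ _
  have h1 : (n : ℝ) * (12 / 11 * (∑ l, a l) / n) ≤ 12 / 11 * ∑ l, a l := by
    rcases Nat.eq_zero_or_pos n with hn | hn
    · simp only [hn, Nat.cast_zero, zero_mul]; positivity
    · rw [mul_div_cancel₀]; positivity
  have h0 : 0 ≤ κ * T ^ 2 := by positivity
  have h2 := mul_le_mul_of_nonneg_left h1 h0
  have h3 := mul_nonneg h0 ha0
  simp only [mul_add, Finset.sum_add_distrib, Finset.sum_const, Finset.card_univ, Fintype.card_fin,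
    nsmul_eq_mul, ← Finset.mul_sum]
  linarith

theorem MeanFieldBounds.profileDist_verletPosition_le (H : MeanFieldBounds V W L L' LH LH')
    (P : ContractionParams K L S T (ε * L')) (hε : 0 ≤ ε) (hh : 0 ≤ h) (hTN : T = N * h)
    (hconv : ∀ u v, K * ‖u - v‖ ^ 2 - K * S ^ 2 ≤ inner ℝ (u - v) (gradient V u - gradient V v))
    (x y ξ η : Config n k) :
    profileDist T S (verletPosition (meanFieldPotential V W ε n) h N x ξ)
        (verletPosition (meanFieldPotential V W ε n) h N y η) ≤
      ∑ i, stepCost K L S T (ε * L') (x i - y i) (ξ i - η i) := by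
  have h1 : ∀ i, 0 ≤ 2 * interactionError T (ε * L') x y ξ η i := by
    intro i
    have h2 : 0 ≤ ∑ l, freeDist T (x l - y l) (ξ l - η l) :=
      Finset.sum_nonneg fun l _ => freeDist_nonneg _ _
    have h3 := freeDist_nonneg (T := T) (x i - y i) (ξ i - η i)
    exact mul_nonneg two_pos.le (mul_nonneg (mul_nonneg P.κ_nonneg (sq_nonneg T))
      (add_nonneg (mul_nonneg (by norm_num) h3) (mul_nonneg (by norm_num)
        (div_nonneg (mul_nonneg (by norm_num) h2) (Nat.cast_nonneg n)))))
  have h2 : ∀ i, profile T (4 * S + 5 / 2 * T)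
      ‖verletPosition (meanFieldPotential V W ε n) h N x ξ i -
        verletPosition (meanFieldPotential V W ε n) h N y η i‖ ≤
      profile T (4 * S + 5 / 2 * T) (stepDist K L S T (x i - y i) (ξ i - η i)) +
        2 * interactionError T (ε * L') x y ξ η i := fun i =>
    (profile_mono P.T_pos (H.norm_verletPosition_sub_le P hε hh hTN hconv x y ξ η i)).trans
      (profile_add_le P.T_pos P.radius_nonneg (P.stepDist_nonneg _ _) (h1 i))
  refine (Finset.sum_le_sum fun i _ => h2 i).trans ?_
  simp only [stepCost]
  rw [Finset.sum_add_distrib, Finset.sum_add_distrib]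
  linarith [sum_interactionError_le (T := T) P.κ_nonneg x y ξ η]

theorem map_toLp_pi_coupling {Γ : Fin n → Measure (EuclideanSpace ℝ (Fin k) ×
    EuclideanSpace ℝ (Fin k))} {f : EuclideanSpace ℝ (Fin k) × EuclideanSpace ℝ (Fin k) →
    EuclideanSpace ℝ (Fin k)} (hf : Measurable f)
    (hΓ : ∀ i, (Γ i).map f = stdGaussian (EuclideanSpace ℝ (Fin k))) :
    (Measure.pi Γ).map (fun ω => WithLp.toLp 2 fun i => f (ω i)) = stdGaussian (Config n k) := by
  have hp : ∀ i, IsProbabilityMeasure ((Γ i).map f) := fun i => by rw [hΓ]; infer_instance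
  have h1 := Measure.pi_map_pi (μ := Γ) (f := fun _ => f) (fun i => hf.aemeasurable)
  have h2 : Measurable fun (ω : Fin n → EuclideanSpace ℝ (Fin k) × EuclideanSpace ℝ (Fin k)) i =>
    f (ω i) := measurable_pi_lambda _ fun i => hf.comp (measurable_pi_apply i)
  simp_rw [hΓ] at h1
  rw [← map_toLp_pi_stdGaussian, ← h1, Measure.map_map (by fun_prop) h2]
  rfl

/-- Contraction of the mean-field kernel in the distance `profileDist`, in dual form. -/
theorem MeanFieldBounds.integral_meanFieldKernel_sub_le (H : MeanFieldBounds V W L L' LH LH')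
    (P : ContractionParams K L S T (ε * L')) (hε : 0 ≤ ε) (hh : 0 ≤ h) (hTN : T = N * h)
    (hconv : ∀ u v, K * ‖u - v‖ ^ 2 - K * S ^ 2 ≤ inner ℝ (u - v) (gradient V u - gradient V v))
    {φ : Config n k → ℝ} (hφ : Measurable φ) {B C : ℝ} (hB : ∀ x, |φ x| ≤ B) (hC : 0 ≤ C)
    (hφC : ∀ x y, φ x - φ y ≤ C * profileDist T S x y) (x y : Config n k) :
    ∫ u, φ u ∂meanFieldKernel V W ε h N n x - ∫ u, φ u ∂meanFieldKernel V W ε h N n y ≤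
      C * ((1 - K * T ^ 2 / 156 * Real.exp (-10 * (S / T))) * profileDist T S x y) := by
  have hU : ContDiff ℝ 1 (meanFieldPotential V W ε n) :=
    (contDiff_meanFieldPotential H.smoothV H.smoothW ε n).of_le (by norm_num)
  have hcont := continuous_verletPosition hU h N
  have hPm : ∀ x, Measurable (verletPosition (meanFieldPotential V W ε n) h N x) := fun x =>
    (hcont.comp (Continuous.prodMk_right x)).measurable
  -- The product of these couplings over the particles has standard Gaussian marginals on
  -- configurations, and the expected cost splits into the costs of the pairs.
  choose Γ hΓ1 hΓ2 hΓ using fun i => P.exists_coupling (x i - y i)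
  have hΓp : ∀ i, IsProbabilityMeasure (Γ i) := fun i => by
    constructor
    have : (Γ i).fst Set.univ = 1 := by rw [hΓ1]; exact measure_univ
    rwa [Measure.fst_univ] at this
  have hlaw1 := map_toLp_pi_coupling measurable_fst hΓ1
  have hlaw2 := map_toLp_pi_coupling measurable_snd hΓ2
  set X : (Fin n → EuclideanSpace ℝ (Fin k) × EuclideanSpace ℝ (Fin k)) → Config n k :=
    fun ω => WithLp.toLp 2 fun i => (ω i).1 with hX
  set Y : (Fin n → EuclideanSpace ℝ (Fin k) × EuclideanSpace ℝ (Fin k)) → Config n k :=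
    fun ω => WithLp.toLp 2 fun i => (ω i).2 with hY
  have hXm : Measurable X := by fun_prop
  have hYm : Measurable Y := by fun_prop
  have hint : ∀ (x : Config n k) {X : (Fin n → EuclideanSpace ℝ (Fin k) ×
      EuclideanSpace ℝ (Fin k)) → Config n k}, Measurable X →
      (Measure.pi Γ).map X = stdGaussian (Config n k) →
      ∫ u, φ u ∂meanFieldKernel V W ε h N n x = ∫ ω, φ (verletPosition
        (meanFieldPotential V W ε n) h N x (X ω)) ∂Measure.pi Γ := by
    intro x X hXm hX
    rw [meanFieldKernel, uhmcKernel_apply hU, ← hX, Measure.map_map (hPm x) hXm,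
      integral_map ((hPm x).comp hXm).aemeasurable hφ.aestronglyMeasurable]
    rfl
  have hI : ∀ (x : Config n k) {X : (Fin n → EuclideanSpace ℝ (Fin k) ×
      EuclideanSpace ℝ (Fin k)) → Config n k}, Measurable X → Integrable (fun ω => φ (verletPosition
        (meanFieldPotential V W ε n) h N x (X ω))) (Measure.pi Γ) := fun x X hXm =>
    (integrable_const B).mono' (hφ.comp ((hPm x).comp hXm)).aestronglyMeasurable
      (Filter.Eventually.of_forall fun ω => hB _)
  have hci : ∀ i, Integrable (fun p : EuclideanSpace ℝ (Fin k) × EuclideanSpace ℝ (Fin k) =>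
      stepCost K L S T (ε * L') (x i - y i) (p.1 - p.2)) (Γ i) := fun i =>
    integrable_coupling_sub (hΓ1 i) (hΓ2 i) (measurable_stepCost _) (P.abs_stepCost_le _)
      (by have := P.κ_nonneg; have := P.T_pos; positivity)
  have hci' : ∀ i ∈ Finset.univ, Integrable (fun ω : Fin n → EuclideanSpace ℝ (Fin k) ×
      EuclideanSpace ℝ (Fin k) =>
      stepCost K L S T (ε * L') (x i - y i) ((ω i).1 - (ω i).2)) (Measure.pi Γ) := fun i _ =>
    integrable_comp_eval (X := fun _ : Fin n => EuclideanSpace ℝ (Fin k) ×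
      EuclideanSpace ℝ (Fin k)) (μ := Γ) (i := i) (f := fun p : EuclideanSpace ℝ (Fin k) × EuclideanSpace ℝ (Fin k) =>
      stepCost K L S T (ε * L') (x i - y i) (p.1 - p.2)) (hci i)
  rw [hint x hXm hlaw1, hint y hYm hlaw2, ← integral_sub (hI x hXm) (hI y hYm)]
  refine (integral_mono ((hI x hXm).sub (hI y hYm)) ((integrable_finsetSum _ hci').const_mul C)
    (fun ω => (hφC _ _).trans (mul_le_mul_of_nonneg_left
      (H.profileDist_verletPosition_le P hε hh hTN hconv x y (X ω) (Y ω)) hC))).trans ?_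
  rw [integral_const_mul, integral_finsetSum _ hci', profileDist]
  refine mul_le_mul_of_nonneg_left ?_ hC
  rw [Finset.mul_sum]
  refine Finset.sum_le_sum fun i _ => ?_
  rw [integral_comp_eval (X := fun _ : Fin n => EuclideanSpace ℝ (Fin k) ×
    EuclideanSpace ℝ (Fin k)) (μ := Γ) (i := i) (f := fun p : EuclideanSpace ℝ (Fin k) × EuclideanSpace ℝ (Fin k) =>
      stepCost K L S T (ε * L') (x i - y i) (p.1 - p.2)) (hci i).aestronglyMeasurable]
  exact hΓ i

theorem ContractionParams.profileDist_le_ell1 {κ : ℝ} (P : ContractionParams K L S T κ)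
    (x y : Config n k) : profileDist T S x y ≤ ell1 x y :=
  Finset.sum_le_sum fun _ _ => profile_le P.T_pos P.radius_nonneg (norm_nonneg _)

theorem ContractionParams.ell1_le_profileDist {κ : ℝ} (P : ContractionParams K L S T κ)
    (x y : Config n k) :
    ell1 x y ≤ Real.exp ((4 * S + 5 / 2 * T) / T) * profileDist T S x y := by
  rw [profileDist, Finset.mul_sum]
  exact Finset.sum_le_sum fun _ _ => le_exp_mul_profile P.T_pos P.radius_nonneg (norm_nonneg _)

end OneStep

/-! ### Limits of measures in total variation -/

section UniformLimit

variable {E : Type*} [MeasurableSpace E]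

/-- A uniformly Cauchy sequence of probability measures has a limit, which is a probability
measure. -/
theorem exists_isProbabilityMeasure_of_uniform_cauchy {μ : ℕ → Measure E}
    [∀ m, IsProbabilityMeasure (μ m)] {b : ℕ → ℝ} (hb : Filter.Tendsto b Filter.atTop (nhds 0))
    (h : ∀ m j A, m ≤ j → MeasurableSet A → |(μ j).real A - (μ m).real A| ≤ b m) :
    ∃ ν : Measure E, IsProbabilityMeasure ν ∧
      ∀ m A, MeasurableSet A → |ν.real A - (μ m).real A| ≤ b m := by
  have hc : ∀ A, MeasurableSet A → ∃ l, Filter.Tendsto (fun m => (μ m).real A) Filter.atTop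
      (nhds l) := by
    intro A hA
    refine cauchySeq_tendsto_of_complete (cauchySeq_of_le_tendsto_0' b (fun m j hmj => ?_) hb)
    rw [dist_comm, Real.dist_eq]
    exact h m j A hmj hA
  choose l hl using hc
  have hlb : ∀ m A (hA : MeasurableSet A), |l A hA - (μ m).real A| ≤ b m := by
    intro m A hA
    refine le_of_tendsto ((hl A hA).sub_const _).abs ?_
    filter_upwards [Filter.eventually_ge_atTop m] with j hj
    exact h m j A hj hA
  have hl0 : ∀ A (hA : MeasurableSet A), 0 ≤ l A hA := fun A hA =>
    ge_of_tendsto' (hl A hA) fun m => measureReal_nonneg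
  -- The setwise limit is finitely additive. Being uniformly close to the countably additive `μ m`,
  -- it is also continuous along partial unions, by a δ/3 argument.
  have hsum : ∀ (f : ℕ → Set E) (hf : ∀ i, MeasurableSet (f i)),
      Pairwise (Function.onFun Disjoint f) →
      HasSum (fun i => l (f i) (hf i)) (l (⋃ i, f i) (MeasurableSet.iUnion hf)) := by
    intro f hf hd
    rw [hasSum_iff_tendsto_nat_of_nonneg fun i => hl0 _ _]
    have hpart : ∀ n, MeasurableSet (⋃ i ∈ Finset.range n, f i) := fun n =>
      Finset.measurableSet_biUnion _ fun i _ => hf i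
    have e1 : ∀ n, ∑ i ∈ Finset.range n, l (f i) (hf i) = l _ (hpart n) := by
      intro n
      refine tendsto_nhds_unique (tendsto_finsetSum _ fun i _ => hl (f i) (hf i)) ?_
      refine (hl _ (hpart n)).congr fun m => ?_
      rw [measureReal_biUnion_finset (fun i _ j _ hij => hd hij) fun i _ => hf i]
    simp_rw [e1]
    rw [Metric.tendsto_atTop]
    intro δ hδ
    obtain ⟨m, hm⟩ := (hb.eventually (gt_mem_nhds (show 0 < δ / 3 by positivity))).exists
    have e2 : Filter.Tendsto (fun n => (μ m).real (⋃ i ∈ Finset.range n, f i)) Filter.atTop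
        (nhds ((μ m).real (⋃ i, f i))) := by
      have e3 := (measure_iUnion hd hf : (μ m) (⋃ i, f i) = _)
      have e4 : HasSum (fun i => (μ m).real (f i)) ((μ m).real (⋃ i, f i)) := by
        have e5 : ∑' i, (μ m) (f i) ≠ ∞ := e3 ▸ measure_ne_top _ _
        have := ENNReal.hasSum_toReal e5
        rw [← ENNReal.tsum_toReal_eq fun i => measure_ne_top _ _, ← e3] at this
        exact this
      refine e4.tendsto_sum_nat.congr fun n => ?_
      rw [measureReal_biUnion_finset (fun i _ j _ hij => hd hij) fun i _ => hf i]
    obtain ⟨n₀, hn₀⟩ := Metric.tendsto_atTop.1 e2 (δ / 3) (by positivity)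
    refine ⟨n₀, fun n hn => ?_⟩
    have f1 := hlb m _ (hpart n)
    have f2 := hlb m _ (MeasurableSet.iUnion hf)
    have f3 := hn₀ n hn
    rw [Real.dist_eq] at f3 ⊢
    rw [abs_le] at f1 f2
    rw [abs_lt] at f3 ⊢
    constructor <;> linarith
  set ν : Measure E := Measure.ofMeasurable (fun A hA => ENNReal.ofReal (l A hA))
    (by
      have : l ∅ MeasurableSet.empty = 0 := tendsto_nhds_unique (hl _ _) (by simp)
      simp [this])
    (fun f hf hd => by
      rw [← (hsum f hf hd).tsum_eq, ENNReal.ofReal_tsum_of_nonneg (fun i => hl0 _ _)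
        (hsum f hf hd).summable]) with hν
  have hνr : ∀ A (hA : MeasurableSet A), ν.real A = l A hA := by
    intro A hA
    rw [Measure.real, hν, Measure.ofMeasurable_apply _ hA, ENNReal.toReal_ofReal (hl0 A hA)]
  refine ⟨ν, ⟨?_⟩, fun m A hA => by rw [hνr A hA]; exact hlb m A hA⟩
  rw [hν, Measure.ofMeasurable_apply _ MeasurableSet.univ]
  have : l Set.univ MeasurableSet.univ = 1 := tendsto_nhds_unique (hl _ _) (by simp)
  simp [this]

/-- By the layer-cake formula the integral is the average of the measures of the superlevel sets
over levels in (0, 1]. -/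
theorem abs_integral_sub_integral_le {μ ν : Measure E} [IsProbabilityMeasure μ]
    [IsProbabilityMeasure ν] {b : ℝ}
    (h : ∀ A, MeasurableSet A → |μ.real A - ν.real A| ≤ b) {g : E → ℝ} (hg : Measurable g)
    (hg01 : ∀ x, 0 ≤ g x ∧ g x ≤ 1) : |∫ x, g x ∂μ - ∫ x, g x ∂ν| ≤ b := by
  have hI : ∀ (μ : Measure E) [IsProbabilityMeasure μ], Integrable g μ := fun μ _ =>
    (integrable_const (1 : ℝ)).mono' hg.aestronglyMeasurable (Filter.Eventually.of_forall fun x => by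
      rw [Real.norm_of_nonneg (hg01 x).1]; exact (hg01 x).2)
  have hlayer : ∀ (μ : Measure E) [IsProbabilityMeasure μ],
      ∫ x, g x ∂μ = ∫ t in Set.Ioc 0 1, μ.real {a | t ≤ g a} := fun μ _ =>
    (hI μ).integral_eq_integral_Ioc_meas_le (Filter.Eventually.of_forall fun x => (hg01 x).1)
      (Filter.Eventually.of_forall fun x => (hg01 x).2)
  have hanti : ∀ (μ : Measure E) [IsProbabilityMeasure μ],
      IntegrableOn (fun t : ℝ => μ.real {a | t ≤ g a}) (Set.Ioc 0 1) := by
    intro μ _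
    have h1 : Antitone fun t : ℝ => μ.real {a | t ≤ g a} := fun s t hst =>
      measureReal_mono fun a (ha : t ≤ g a) => hst.trans ha
    exact (h1.antitoneOn _).integrableOn_isCompact isCompact_Icc |>.mono_set Set.Ioc_subset_Icc_self
  rw [hlayer μ, hlayer ν, ← integral_sub (hanti μ) (hanti ν)]
  have := norm_setIntegral_le_of_norm_le_const (μ := volume) (s := Set.Ioc (0 : ℝ) 1)
    (f := fun t => μ.real {a | t ≤ g a} - ν.real {a | t ≤ g a}) (C := b) (by simp)
    (fun t _ => h _ (measurableSet_le measurable_const hg))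
  simpa using this

end UniformLimit

/-! ### Evolution of laws and of functions -/

section IteratedProbability

variable {E : Type*} [MeasurableSpace E] {π : Kernel E E} [IsMarkovKernel π]

/-- The probability that the chain is in `A` after `m` steps, as a function of the initial
point. -/
def iterProb (π : Kernel E E) (A : Set E) : ℕ → E → ℝ
  | 0 => A.indicator fun _ => 1
  | m + 1 => fun x => ∫ y, iterProb π A m y ∂π x

theorem measurable_iterProb {A : Set E} (hA : MeasurableSet A) (m : ℕ) :
    Measurable (iterProb π A m) := by
  induction m with
  | zero => exact measurable_const.indicator hA
  | succ m ih => exact ih.stronglyMeasurable.integral_kernel.measurable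

theorem iterProb_mem (A : Set E) (m : ℕ) (x : E) :
    0 ≤ iterProb π A m x ∧ iterProb π A m x ≤ 1 := by
  induction m generalizing x with
  | zero =>
    exact ⟨Set.indicator_nonneg (fun _ _ => zero_le_one) x,
      Set.indicator_le_self' (fun _ _ => zero_le_one) x⟩
  | succ m ih =>
    refine ⟨integral_nonneg fun y => (ih y).1, ?_⟩
    have := integral_mono_of_nonneg (μ := π x) (Filter.Eventually.of_forall fun y => (ih y).1)
      (integrable_const (1 : ℝ)) (Filter.Eventually.of_forall fun y => (ih y).2)
    rwa [integral_const, probReal_univ, one_smul] at this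

theorem integrable_iterProb {A : Set E} (hA : MeasurableSet A) (m : ℕ) (μ : Measure E)
    [IsFiniteMeasure μ] : Integrable (iterProb π A m) μ :=
  (integrable_const (1 : ℝ)).mono' (measurable_iterProb hA m).aestronglyMeasurable
    (Filter.Eventually.of_forall fun x => by
      rw [Real.norm_of_nonneg (iterProb_mem A m x).1]; exact (iterProb_mem A m x).2)

theorem iterProb_one {A : Set E} (hA : MeasurableSet A) (x : E) :
    iterProb π A 1 x = (π x).real A := by
  simp [iterProb, integral_indicator_const, hA]

theorem isProbabilityMeasure_bind (ν : Measure E) [IsProbabilityMeasure ν] :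
    IsProbabilityMeasure (ν.bind π) := by
  constructor
  rw [Measure.bind_apply MeasurableSet.univ π.aemeasurable]
  simp

theorem integral_bind_iterProb {A : Set E} (hA : MeasurableSet A) (m : ℕ) (ν : Measure E)
    [IsProbabilityMeasure ν] :
    ∫ x, iterProb π A m x ∂ν.bind π = ∫ x, iterProb π A (m + 1) x ∂ν := by
  have := isProbabilityMeasure_bind (π := π) ν
  have h0 : ∀ (m : ℕ) (μ : Measure E), 0 ≤ᵐ[μ] iterProb π A m := fun m μ =>
    Filter.Eventually.of_forall fun y => (iterProb_mem A m y).1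
  rw [integral_eq_lintegral_of_nonneg_ae (h0 m _) (measurable_iterProb hA m).aestronglyMeasurable,
    integral_eq_lintegral_of_nonneg_ae (h0 (m + 1) _)
      (measurable_iterProb hA (m + 1)).aestronglyMeasurable,
    Measure.lintegral_bind π.aemeasurable (measurable_iterProb hA m).ennreal_ofReal.aemeasurable]
  congr 1
  refine lintegral_congr fun x => ?_
  exact (ofReal_integral_eq_lintegral_ofReal (integrable_iterProb hA m _) (h0 m _)).symm

theorem isProbabilityMeasure_lawAfter (ν : Measure E) [IsProbabilityMeasure ν] (m : ℕ) :
    IsProbabilityMeasure (lawAfter π ν m) := by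
  induction m with
  | zero => assumption
  | succ m ih =>
    rw [lawAfter, Function.iterate_succ_apply']
    have := ih
    rw [lawAfter] at this
    exact isProbabilityMeasure_bind _

theorem lawAfter_real {A : Set E} (hA : MeasurableSet A) (ν : Measure E) [IsProbabilityMeasure ν]
    (m : ℕ) : (lawAfter π ν m).real A = ∫ x, iterProb π A m x ∂ν := by
  induction m generalizing ν with
  | zero => simp [lawAfter, iterProb, integral_indicator_const, hA]
  | succ m ih =>
    have := isProbabilityMeasure_bind (π := π) ν
    rw [← integral_bind_iterProb hA, ← ih]
    rfl

theorem lawAfter_of_invariant {μ : Measure E} (hμ : π.Invariant μ) (m : ℕ) :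
    lawAfter π μ m = μ := by
  induction m with
  | zero => rfl
  | succ m ih =>
    rw [lawAfter, Function.iterate_succ_apply, hμ.def]
    exact ih

end IteratedProbability

/-! ### Regularization plus contraction implies convergence -/

section Contracting

variable {E : Type*} [MeasurableSpace E] {π : Kernel E E} [IsMarkovKernel π]
  {d ρ : E → E → ℝ} {C M θ : ℝ}

/-- A Markov kernel which contracts a distance `ρ` equivalent to `d`, and for which the transition
probabilities are Lipschitz with respect to `d`. -/
structure ContractingKernel (π : Kernel E E) (d ρ : E → E → ℝ) (C M θ : ℝ) : Prop where
  symm : ∀ x y, d x y = d y x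
  nonneg : ∀ x y, 0 ≤ d x y
  le_mul : ∀ x y, d x y ≤ M * ρ x y
  le : ∀ x y, ρ x y ≤ d x y
  C_nonneg : 0 ≤ C
  M_nonneg : 0 ≤ M
  θ_nonneg : 0 ≤ θ
  θ_lt_one : θ < 1
  reg : ∀ x y A, MeasurableSet A → (π x).real A - (π y).real A ≤ C * d x y
  contr : ∀ φ : E → ℝ, Measurable φ → (∀ x, 0 ≤ φ x ∧ φ x ≤ 1) → ∀ D : ℝ, 0 ≤ D →
    (∀ x y, φ x - φ y ≤ D * ρ x y) → ∀ x y, ∫ u, φ u ∂π x - ∫ u, φ u ∂π y ≤ D * (θ * ρ x y)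

/-- The first step creates the Lipschitz constant C M with respect to `ρ`; every later step
multiplies it by θ. -/
theorem ContractingKernel.iterProb_sub_le (H : ContractingKernel π d ρ C M θ) {A : Set E}
    (hA : MeasurableSet A) (m : ℕ) (x y : E) :
    iterProb π A (m + 1) x - iterProb π A (m + 1) y ≤ C * M * θ ^ m * ρ x y := by
  induction m generalizing x y with
  | zero =>
    rw [zero_add, iterProb_one hA, iterProb_one hA]
    have := mul_le_mul_of_nonneg_left (H.le_mul x y) H.C_nonneg
    linarith [H.reg x y A hA]
  | succ m ih =>
    have hD : 0 ≤ C * M * θ ^ m :=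
      mul_nonneg (mul_nonneg H.C_nonneg H.M_nonneg) (pow_nonneg H.θ_nonneg m)
    refine (H.contr _ (measurable_iterProb hA (m + 1)) (iterProb_mem A (m + 1)) _ hD ih x y).trans
      (le_of_eq ?_)
    ring

theorem ContractingKernel.abs_iterProb_sub_le (H : ContractingKernel π d ρ C M θ) {A : Set E}
    (hA : MeasurableSet A) (m : ℕ) (x y : E) :
    |iterProb π A (m + 1) x - iterProb π A (m + 1) y| ≤ C * M * θ ^ m * d x y := by
  have hD : 0 ≤ C * M * θ ^ m :=
    mul_nonneg (mul_nonneg H.C_nonneg H.M_nonneg) (pow_nonneg H.θ_nonneg m)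
  have h1 := (H.iterProb_sub_le hA m x y).trans (mul_le_mul_of_nonneg_left (H.le x y) hD)
  have h2 := (H.iterProb_sub_le hA m y x).trans (mul_le_mul_of_nonneg_left (H.le y x) hD)
  rw [H.symm y x] at h2
  rw [abs_le]
  constructor <;> linarith

theorem ContractingKernel.ofReal_abs_lawAfter_sub_le (H : ContractingKernel π d ρ C M θ)
    {A : Set E} (hA : MeasurableSet A) (m : ℕ) (μ ν : Measure E) [IsProbabilityMeasure μ]
    [IsProbabilityMeasure ν] :
    ENNReal.ofReal |(lawAfter π μ (m + 1)).real A - (lawAfter π ν (m + 1)).real A| ≤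
      ENNReal.ofReal (C * M * θ ^ m) * wasserstein1 d μ ν := by
  have hD : 0 ≤ C * M * θ ^ m :=
    mul_nonneg (mul_nonneg H.C_nonneg H.M_nonneg) (pow_nonneg H.θ_nonneg m)
  have key : ∀ γ ∈ couplings μ ν,
      ENNReal.ofReal |(lawAfter π μ (m + 1)).real A - (lawAfter π ν (m + 1)).real A| ≤
        ENNReal.ofReal (C * M * θ ^ m) * ∫⁻ p, ENNReal.ofReal (d p.1 p.2) ∂γ := by
    rintro γ ⟨h1, h2⟩
    have hg := measurable_iterProb (π := π) hA (m + 1)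
    have hI1 : Integrable (fun p : E × E => iterProb π A (m + 1) p.1) γ := by
      have := integrable_iterProb (π := π) hA (m + 1) μ
      rw [← h1] at this
      exact this.comp_measurable measurable_fst
    have hI2 : Integrable (fun p : E × E => iterProb π A (m + 1) p.2) γ := by
      have := integrable_iterProb (π := π) hA (m + 1) ν
      rw [← h2] at this
      exact this.comp_measurable measurable_snd
    have e1 : (lawAfter π μ (m + 1)).real A = ∫ p, iterProb π A (m + 1) p.1 ∂γ := by
      rw [lawAfter_real hA, ← h1, Measure.fst,
        integral_map measurable_fst.aemeasurable hg.aestronglyMeasurable]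
    have e2 : (lawAfter π ν (m + 1)).real A = ∫ p, iterProb π A (m + 1) p.2 ∂γ := by
      rw [lawAfter_real hA, ← h2, Measure.snd,
        integral_map measurable_snd.aemeasurable hg.aestronglyMeasurable]
    rw [e1, e2, ← integral_sub hI1 hI2, ← Real.enorm_eq_ofReal_abs,
      ← lintegral_const_mul' _ _ ENNReal.ofReal_ne_top]
    refine (enorm_integral_le_lintegral_enorm _).trans (lintegral_mono fun p => ?_)
    rw [Real.enorm_eq_ofReal_abs, ← ENNReal.ofReal_mul hD]
    exact ENNReal.ofReal_le_ofReal (H.abs_iterProb_sub_le hA m _ _)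
  -- A positive factor can be moved across the infimum over couplings; for a zero factor the product
  -- coupling suffices.
  rcases eq_or_ne (ENNReal.ofReal (C * M * θ ^ m)) 0 with h0 | h0
  · have := key (μ.prod ν) ⟨Measure.fst_prod, Measure.snd_prod⟩
    rw [h0, zero_mul] at this ⊢
    exact this
  · rw [← ENNReal.div_le_iff' h0 ENNReal.ofReal_ne_top]
    exact le_iInf₂ fun γ hγ => (ENNReal.div_le_iff' h0 ENNReal.ofReal_ne_top).2 (key γ hγ)

/-- The total variation distance to equilibrium decays geometrically. -/
theorem ContractingKernel.tvDist_lawAfter_le (H : ContractingKernel π d ρ C M θ) {μ ν : Measure E}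
    [IsProbabilityMeasure μ] [IsProbabilityMeasure ν] (hμ : π.Invariant μ) (m : ℕ) {tol : ℝ}
    (htol : 0 ≤ tol)
    (h : ENNReal.ofReal (C * M * θ ^ m) * wasserstein1 d μ ν ≤ ENNReal.ofReal tol) :
    tvDist μ (lawAfter π ν (m + 1)) ≤ tol := by
  refine Real.iSup_le (fun A => ?_) htol
  have h1 := (H.ofReal_abs_lawAfter_sub_le A.2 m μ ν).trans h
  rw [lawAfter_of_invariant hμ] at h1
  exact (ENNReal.ofReal_le_ofReal_iff htol).1 h1

theorem ContractingKernel.abs_iterProb_succ_sub_le (H : ContractingKernel π d ρ C M θ) {x₀ : E}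
    (hd : Integrable (fun y => d y x₀) (π x₀)) {A : Set E} (hA : MeasurableSet A) (m : ℕ) :
    |iterProb π A (m + 2) x₀ - iterProb π A (m + 1) x₀| ≤
      C * M * θ ^ m * ∫ y, d y x₀ ∂π x₀ := by
  have hI := integrable_iterProb (π := π) hA (m + 1) (π x₀)
  have e1 : iterProb π A (m + 2) x₀ - iterProb π A (m + 1) x₀ =
      ∫ y, (iterProb π A (m + 1) y - iterProb π A (m + 1) x₀) ∂π x₀ := by
    rw [integral_sub hI (integrable_const _), integral_const, probReal_univ, one_smul]
    rfl
  rw [e1, ← integral_const_mul]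
  refine (abs_integral_le_integral_abs).trans
    (integral_mono (hI.sub (integrable_const _)).abs (hd.const_mul _) fun y => ?_)
  exact H.abs_iterProb_sub_le hA m y x₀

/-- The chain from `x₀` after one more step is the chain started from `π x₀`, so consecutive
probabilities differ by a geometric term uniformly in A. The uniform limit commutes with one more
transition and is therefore invariant. -/
theorem ContractingKernel.exists_invariant (H : ContractingKernel π d ρ C M θ) {x₀ : E}
    (hd : Integrable (fun y => d y x₀) (π x₀)) :
    ∃ μ : Measure E, IsProbabilityMeasure μ ∧ π.Invariant μ ∧ ∀ A, MeasurableSet A →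
      Filter.Tendsto (fun m => iterProb π A (m + 1) x₀) Filter.atTop (nhds (μ.real A)) := by
  set D := C * M * ∫ y, d y x₀ ∂π x₀ with hD
  have hD0 : 0 ≤ D := mul_nonneg (mul_nonneg H.C_nonneg H.M_nonneg)
    (integral_nonneg fun y => H.nonneg y x₀)
  have hθ : 0 < 1 - θ := sub_pos.2 H.θ_lt_one
  -- Tail of the geometric series: b m - b (m + 1) = D θ^m.
  set b : ℕ → ℝ := fun m => D * θ ^ m / (1 - θ) with hb
  have hb0 : ∀ m, 0 ≤ b m := fun m => div_nonneg (mul_nonneg hD0 (pow_nonneg H.θ_nonneg m)) hθ.le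
  have hbt : Filter.Tendsto b Filter.atTop (nhds 0) := by
    simpa using ((tendsto_pow_atTop_nhds_zero_of_lt_one H.θ_nonneg H.θ_lt_one).const_mul
      D).div_const (1 - θ)
  have := fun m => isProbabilityMeasure_lawAfter (π := π) (Measure.dirac x₀) m
  have hreal : ∀ m A, MeasurableSet A →
      (lawAfter π (Measure.dirac x₀) m).real A = iterProb π A m x₀ := fun m A hA => by
    rw [lawAfter_real hA, integral_dirac' _ _ (measurable_iterProb hA m).stronglyMeasurable]
  have hcauchy : ∀ m i A, MeasurableSet A →
      |iterProb π A (m + i + 1) x₀ - iterProb π A (m + 1) x₀| ≤ b m - b (m + i) := by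
    intro m i A hA
    induction i with
    | zero => simp
    | succ i ih =>
      have h1 := H.abs_iterProb_succ_sub_le hd hA (m + i)
      have h2 := abs_sub_le (iterProb π A (m + i + 2) x₀) (iterProb π A (m + i + 1) x₀)
        (iterProb π A (m + 1) x₀)
      have h3 : b (m + i) - b (m + (i + 1)) = C * M * θ ^ (m + i) * ∫ y, d y x₀ ∂π x₀ := by
        rw [hb, ← add_assoc]
        simp only
        rw [← sub_div, div_eq_iff hθ.ne', hD, pow_succ]
        ring
      have h4 : m + (i + 1) + 1 = m + i + 2 := by ring
      rw [h4]
      linarith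
  obtain ⟨μ, hμ, hμA⟩ := exists_isProbabilityMeasure_of_uniform_cauchy
    (μ := fun m => lawAfter π (Measure.dirac x₀) (m + 1)) hbt (by
      intro m j A hmj hA
      obtain ⟨i, rfl⟩ := Nat.exists_eq_add_of_le hmj
      rw [hreal _ _ hA, hreal _ _ hA]
      linarith [hcauchy m i A hA, hb0 (m + i)])
  have htend : ∀ A, MeasurableSet A →
      Filter.Tendsto (fun m => iterProb π A (m + 1) x₀) Filter.atTop (nhds (μ.real A)) := by
    intro A hA
    refine tendsto_iff_dist_tendsto_zero.2 (squeeze_zero (fun _ => dist_nonneg) (fun m => ?_) hbt)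
    rw [dist_comm, Real.dist_eq, ← hreal _ _ hA]
    exact hμA m A hA
  refine ⟨μ, hμ, ?_, htend⟩
  have hbind := isProbabilityMeasure_bind (π := π) μ
  refine Measure.ext fun A hA => ?_
  rw [← measureReal_eq_measureReal_iff]
  refine tendsto_nhds_unique (f := fun m => iterProb π A (m + 1 + 1) x₀) ?_
    ((htend A hA).comp (Filter.tendsto_add_atTop_nat 1))
  refine tendsto_iff_dist_tendsto_zero.2 (squeeze_zero (fun _ => dist_nonneg) (fun m => ?_) hbt)
  have e1 : (μ.bind π).real A = ∫ x, iterProb π A 1 x ∂μ := by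
    rw [← integral_bind_iterProb hA]
    simp [iterProb, integral_indicator_const, hA]
  have e2 : iterProb π A (m + 1 + 1) x₀ =
      ∫ x, iterProb π A 1 x ∂lawAfter π (Measure.dirac x₀) (m + 1) := by
    rw [← integral_bind_iterProb hA, ← hreal _ _ hA]
    simp [iterProb, integral_indicator_const, hA, lawAfter, Function.iterate_succ_apply']
  rw [dist_comm, Real.dist_eq, e1, e2]
  exact abs_integral_sub_integral_le (hμA m) (measurable_iterProb hA 1) (iterProb_mem A 1)

/-- The probabilities converge to μ(A) from every starting point, and dominated convergence
integrates this against `μ'`; no moment of `μ'` is needed. -/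
theorem ContractingKernel.invariant_unique (H : ContractingKernel π d ρ C M θ) {x₀ : E}
    {μ : Measure E} [IsProbabilityMeasure μ] (hμ : ∀ A, MeasurableSet A →
      Filter.Tendsto (fun m => iterProb π A (m + 1) x₀) Filter.atTop (nhds (μ.real A)))
    {μ' : Measure E} [IsProbabilityMeasure μ'] (hμ' : π.Invariant μ') : μ' = μ := by
  refine Measure.ext fun A hA => ?_
  rw [← measureReal_eq_measureReal_iff]
  have hx : ∀ x, Filter.Tendsto (fun m => iterProb π A (m + 1) x) Filter.atTop
      (nhds (μ.real A)) := by
    intro x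
    have h1 : Filter.Tendsto (fun m => iterProb π A (m + 1) x - iterProb π A (m + 1) x₀)
        Filter.atTop (nhds 0) := by
      refine squeeze_zero_norm (fun m => H.abs_iterProb_sub_le hA m x x₀) ?_
      simpa using ((tendsto_pow_atTop_nhds_zero_of_lt_one H.θ_nonneg H.θ_lt_one).const_mul
        (C * M)).mul_const (d x x₀)
    simpa using h1.add (hμ A hA)
  have h2 := tendsto_integral_of_dominated_convergence (μ := μ') (fun _ => (1 : ℝ))
    (fun m => (measurable_iterProb (π := π) hA (m + 1)).aestronglyMeasurable) (integrable_const _)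
    (fun m => Filter.Eventually.of_forall fun x => by
      rw [Real.norm_of_nonneg (iterProb_mem A (m + 1) x).1]; exact (iterProb_mem A (m + 1) x).2)
    (Filter.Eventually.of_forall hx)
  simp_rw [← lawAfter_real hA, lawAfter_of_invariant hμ'] at h2
  rw [integral_const, probReal_univ, one_smul] at h2
  exact tendsto_nhds_unique tendsto_const_nhds h2

end Contracting

/-! ### Mixing times -/

section MixingTime

variable {E : Type*} [MeasurableSpace E] {π : Kernel E E} [IsMarkovKernel π]
  {d ρ : E → E → ℝ} {C M c : ℝ} {μ ν : Measure E} [IsProbabilityMeasure μ]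
  [IsProbabilityMeasure ν]

theorem coe_mixingTime_le {tol : ℝ} {m : ℕ} (h : tvDist μ (lawAfter π ν m) ≤ tol) :
    ((mixingTime π μ tol ν : ℝ≥0∞) : EReal) ≤ ((m : ℝ) : EReal) := by
  have h1 : mixingTime π μ tol ν ≤ (m : ℕ∞) := iInf₂_le m h
  have h2 : (mixingTime π μ tol ν : ℝ≥0∞) ≤ ((m : ℕ∞) : ℝ≥0∞) := ENat.toENNReal_le.2 h1
  refine (EReal.coe_ennreal_le_coe_ennreal_iff.2 h2).trans (le_of_eq ?_)
  rw [ENat.toENNReal_coe, ← ENNReal.ofReal_natCast, EReal.coe_ennreal_ofReal,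
    max_eq_left (Nat.cast_nonneg m)]

/-- The rounded-up number of contracting steps brings C M exp(-c m) w below `tol`; the extra step is
the regularizing one. -/
theorem ContractingKernel.mixingTime_le_ceil
    (H : ContractingKernel π d ρ C M (Real.exp (-c))) (hc : 0 < c) (hμ : π.Invariant μ) {tol : ℝ}
    (htol : 0 < tol) {w : ℝ} (hw : 0 ≤ w) (h : wasserstein1 d μ ν ≤ ENNReal.ofReal w) :
    ((mixingTime π μ tol ν : ℝ≥0∞) : EReal) ≤
      (((⌈1 / c * Real.log (C * M / tol * w)⌉₊ + 1 : ℝ)) : EReal) := by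
  set m := ⌈1 / c * Real.log (C * M / tol * w)⌉₊ with hm
  have hCM : 0 ≤ C * M := mul_nonneg H.C_nonneg H.M_nonneg
  have hθ : 0 ≤ C * M * Real.exp (-c) ^ m := by positivity
  have hle : C * M * Real.exp (-c) ^ m * w ≤ tol := by
    -- At zero `Real.log 0 = 0` carries no information, but then the distance bound itself vanishes.
    rcases (show 0 ≤ C * M / tol * w by positivity).eq_or_lt with h0 | h0
    · have : C * M * w = 0 := by
        have h1 : C * M * w = tol * (C * M / tol * w) := by field_simp
        rw [h1, ← h0, mul_zero]
      rw [mul_right_comm, this, zero_mul]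
      exact htol.le
    · have h1 : Real.log (C * M / tol * w) ≤ m * c := by
        have := Nat.le_ceil (1 / c * Real.log (C * M / tol * w))
        rwa [← hm, one_div, inv_mul_le_iff₀ hc, mul_comm c] at this
      have h2 : C * M / tol * w ≤ Real.exp (m * c) := by
        rw [← Real.exp_log h0]
        exact Real.exp_le_exp.2 h1
      have h3 : Real.exp (-c) ^ m = (Real.exp (m * c))⁻¹ := by
        rw [← Real.exp_nat_mul, ← Real.exp_neg]
        congr 1
        ring
      rw [h3, mul_right_comm, ← div_eq_mul_inv, div_le_iff₀ (Real.exp_pos _)]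
      have h4 : C * M * w = tol * (C * M / tol * w) := by field_simp
      rw [h4]
      exact mul_le_mul_of_nonneg_left h2 htol.le
  have htv := H.tvDist_lawAfter_le (ν := ν) hμ m htol.le (by
    refine (mul_le_mul_right h _).trans ?_
    rw [← ENNReal.ofReal_mul hθ]
    exact ENNReal.ofReal_le_ofReal hle)
  refine (coe_mixingTime_le htv).trans (le_of_eq ?_)
  push_cast
  rfl

theorem ContractingKernel.mixingTime_le
    (H : ContractingKernel π d ρ C M (Real.exp (-c))) (hc : 0 < c) (hCM : 0 < C * M)
    (hμ : π.Invariant μ) {tol : ℝ} (htol : 0 < tol) :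
    ((mixingTime π μ tol ν : ℝ≥0∞) : EReal) ≤
      max 1 (2 + ((1 / c : ℝ) : EReal) *
        ENNReal.log (ENNReal.ofReal (C * M / tol) * wasserstein1 d μ ν)) := by
  have hs : 0 < C * M / tol := by positivity
  rcases eq_or_ne (wasserstein1 d μ ν) ⊤ with hW | hW
  · rw [hW, ENNReal.mul_top (ENNReal.ofReal_pos.2 hs).ne', ENNReal.log_top,
      EReal.coe_mul_top_of_pos (by positivity), EReal.add_top_of_ne_bot (by decide)]
    simp
  · have h1 := H.mixingTime_le_ceil hc hμ htol ENNReal.toReal_nonneg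
      (ENNReal.ofReal_toReal hW).ge
    refine h1.trans ?_
    set w := (wasserstein1 d μ ν).toReal with hw
    -- At distance zero the ceiling is `0`, so the bound is the `1` in the maximum.
    rcases (ENNReal.toReal_nonneg (a := wasserstein1 d μ ν)).eq_or_lt with h0 | h0
    · rw [← hw] at h0
      rw [← h0]
      simp
    · rw [← ENNReal.ofReal_toReal hW, ← hw, ← ENNReal.ofReal_mul hs.le,
        ENNReal.log_ofReal_of_pos (mul_pos hs h0), ← EReal.coe_mul]
      set x := 1 / c * Real.log (C * M / tol * w)
      rcases le_total x 0 with hx | hx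
      · rw [Nat.ceil_eq_zero.2 hx]
        simp
      · refine le_trans ?_ (le_max_right _ _)
        have h2 := Nat.ceil_lt_add_one hx
        have h3 : (⌈x⌉₊ + 1 : ℝ) ≤ 2 + x := by linarith
        exact (EReal.coe_le_coe_iff.2 h3).trans (le_of_eq (EReal.coe_add 2 x))

end MixingTime

/-! ### Assembly for the mean-field chain -/

section MeanField

variable {n k : ℕ} {V W : EuclideanSpace ℝ (Fin k) → ℝ} {ε L L' LH LH' K R T h : ℝ} {N : ℕ}

theorem isMarkovKernel_meanFieldKernel (hV : ContDiff ℝ 3 V) (hW : ContDiff ℝ 3 W) (ε h : ℝ)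
    (N n : ℕ) : IsMarkovKernel (meanFieldKernel V W ε h N n) := by
  have hU : ContDiff ℝ 1 (meanFieldPotential V W ε n) :=
    (contDiff_meanFieldPotential hV hW ε n).of_le (by norm_num)
  refine ⟨fun x => ?_⟩
  rw [meanFieldKernel, uhmcKernel_apply hU]
  exact Measure.isProbabilityMeasure_map
    ((continuous_verletPosition hU h N).comp (Continuous.prodMk_right x)).measurable.aemeasurable

theorem continuous_ell1 (y : Config n k) : Continuous fun x => ell1 x y := by
  unfold ell1
  fun_prop

theorem MeanFieldBounds.ell1Seminorm_verletPosition_le (H : MeanFieldBounds V W L L' LH LH')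
    (hε : 0 ≤ ε) (hh : 0 ≤ h) (hT : (L + 4 * ε * L') * (N * h) ^ 2 ≤ 1 / 6)
    (x ξ : Config n k) :
    ell1Seminorm n k (verletPosition (meanFieldPotential V W ε n) h N x ξ) ≤
      12 / 11 * (ell1Seminorm n k x + N * h * (n * ‖ξ‖) + (N * h) ^ 2 / 2 *
        ell1Seminorm n k (gradient (meanFieldPotential V W ε n) 0)) := by
  have hΛ : 0 ≤ L + 4 * ε * L' := by
    have := mul_nonneg hε H.L'_nonneg
    linarith [H.L_nonneg]
  have hT0 : 0 ≤ N * h := by positivity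
  have hξ : 0 ≤ N * h * (n * ‖ξ‖) := by positivity
  refine ((isVerlet_iterate (meanFieldPotential V W ε n) h (x, ξ)).seminorm_le
    (ell1Seminorm n k) hh hΛ hT (by simpa using hξ) ?_ (apply_nonneg _ _) ?_).1 N le_rfl
  · refine (map_add_le_add _ _ _).trans (add_le_add_right ?_ _)
    rw [map_smul_eq_mul, Real.norm_of_nonneg hT0]
    exact mul_le_mul_of_nonneg_left (ell1Seminorm_le_mul_norm ξ) hT0
  · intro i _
    have h1 := H.ell1_gradient_sub_le hε
      ((verletStep (meanFieldPotential V W ε n) h)^[i] (x, ξ)).1 0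
    rw [sub_zero] at h1
    have h2 := map_add_le_add (ell1Seminorm n k)
      (gradient (meanFieldPotential V W ε n)
        ((verletStep (meanFieldPotential V W ε n) h)^[i] (x, ξ)).1 -
          gradient (meanFieldPotential V W ε n) 0) (gradient (meanFieldPotential V W ε n) 0)
    rw [sub_add_cancel] at h2
    linarith

theorem MeanFieldBounds.integrable_ell1 (H : MeanFieldBounds V W L L' LH LH')
    (hε : 0 ≤ ε) (hh : 0 ≤ h) (hT : (L + 4 * ε * L') * (N * h) ^ 2 ≤ 1 / 6) (x : Config n k) :
    Integrable (fun y => ell1 y x) (meanFieldKernel V W ε h N n x) := by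
  have hU : ContDiff ℝ 1 (meanFieldPotential V W ε n) :=
    (contDiff_meanFieldPotential H.smoothV H.smoothW ε n).of_le (by norm_num)
  have hm : Measurable (verletPosition (meanFieldPotential V W ε n) h N x) :=
    ((continuous_verletPosition hU h N).comp (Continuous.prodMk_right x)).measurable
  rw [meanFieldKernel, uhmcKernel_apply hU, integrable_map_measure
    (continuous_ell1 x).aestronglyMeasurable hm.aemeasurable]
  have hn := (integrable_norm_stdGaussian (E := Config n k))
  refine (((((integrable_const (ell1Seminorm n k x)).add ((hn.const_mul n).const_mul (N * h))).add
    (integrable_const ((N * h) ^ 2 / 2 * ell1Seminorm n k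
      (gradient (meanFieldPotential V W ε n) 0)))).const_mul (12 / 11)).add
        (integrable_const (ell1Seminorm n k x))).mono'
    ((continuous_ell1 x).measurable.comp hm).aestronglyMeasurable
    (Filter.Eventually.of_forall fun ξ => ?_)
  have h1 := H.ell1Seminorm_verletPosition_le hε hh hT x ξ
  have h2 := map_sub_le_add (ell1Seminorm n k)
    (verletPosition (meanFieldPotential V W ε n) h N x ξ) x
  have h3 : 0 ≤ ell1Seminorm n k (verletPosition (meanFieldPotential V W ε n) h N x ξ - x) :=
    apply_nonneg _ _
  rw [Function.comp_apply, ell1_eq, Real.norm_of_nonneg h3]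
  exact h2.trans (add_le_add_left h1 _)

/-- A nontrivial space contains points at distance R + 1, where convexity and the Lipschitz bound
meet by Cauchy-Schwarz. -/
theorem le_of_strongly_convex_outside {F : Type*} [NormedAddCommGroup F] [InnerProductSpace ℝ F]
    [Nontrivial F] {b : F → F} (hb : ∀ x y, ‖b x - b y‖ ≤ L * ‖x - y‖) (hR : 0 ≤ R)
    (hconv : ∀ x y : F, R ≤ ‖x - y‖ → K * ‖x - y‖ ^ 2 ≤ inner ℝ (x - y) (b x - b y)) :
    K ≤ L := by
  obtain ⟨x, hx⟩ := exists_norm_eq F (show 0 ≤ R + 1 by linarith)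
  have hx0 : R ≤ ‖x - 0‖ := by rw [sub_zero, hx]; linarith
  have h1 := hconv x 0 hx0
  have h2 := real_inner_le_norm (x - 0) (b x - b 0)
  have h3 := mul_le_mul_of_nonneg_left (hb x 0) (norm_nonneg (x - 0))
  have h4 : 0 < ‖x - 0‖ ^ 2 := by rw [sub_zero, hx]; positivity
  refine le_of_mul_le_mul_right ?_ h4
  linarith

/-- Within distance R the inner product is at least -L |x - y|², so the defect is at most (L + K)
R². Writing this as K S² gives S = R √((L + K) / K). -/
theorem strongly_convex_defect_le {F : Type*} [NormedAddCommGroup F] [InnerProductSpace ℝ F]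
    {b : F → F} (hb : ∀ x y, ‖b x - b y‖ ≤ L * ‖x - y‖) (hK : 0 < K) (hL : 0 ≤ L)
    (hconv : ∀ x y : F, R ≤ ‖x - y‖ → K * ‖x - y‖ ^ 2 ≤ inner ℝ (x - y) (b x - b y)) (x y : F) :
    K * ‖x - y‖ ^ 2 - K * (R * √((L + K) / K)) ^ 2 ≤ inner ℝ (x - y) (b x - b y) := by
  have hS : K * (R * √((L + K) / K)) ^ 2 = (L + K) * R ^ 2 := by
    rw [mul_pow, Real.sq_sqrt (by positivity)]
    field_simp
  have hLK : 0 ≤ (L + K) * R ^ 2 := by positivity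
  rw [hS]
  rcases le_total R ‖x - y‖ with h | h
  · linarith [hconv x y h]
  · have h1 := neg_le_of_abs_le (abs_real_inner_le_norm (x - y) (b x - b y))
    have h2 := mul_le_mul_of_nonneg_left (hb x y) (norm_nonneg (x - y))
    have h3 := mul_le_mul_of_nonneg_left (pow_le_pow_left₀ (norm_nonneg _) h 2)
      (show 0 ≤ L + K by linarith)
    linarith

/-- Existence of an equivalent distance in which the mean-field kernel contracts with the rate
`contractionRate`. -/
theorem MeanFieldBounds.exists_contractingKernel [Nontrivial (EuclideanSpace ℝ (Fin k))]
    (H : MeanFieldBounds V W L L' LH LH')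
    (P : ContractionParams K L (R * √((L + K) / K)) T (ε * L')) (hε : 0 ≤ ε) (hh : 0 < h)
    (hN : 0 < N) (hTN : T = N * h)
    (hconv : ∀ x y : EuclideanSpace ℝ (Fin k), R ≤ ‖x - y‖ →
      K * ‖x - y‖ ^ 2 ≤ inner ℝ (x - y) (gradient V x - gradient V y)) (n : ℕ) :
    ContractingKernel (meanFieldKernel V W ε h N n) ell1
      (profileDist T (R * √((L + K) / K)))
      (3 / 2 * √((T ^ 2)⁻¹ + 34 * k * (LH + 8 * ε * LH') ^ 2 * T ^ 4))
      (contractionPrefactor K L R T) (Real.exp (-contractionRate K L R T)) := by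
  have hq : R * √((L + K) / K) / T = R / T * √((L + K) / K) := by ring
  have hrate : contractionRate K L R T =
      K * T ^ 2 / 156 * Real.exp (-10 * (R * √((L + K) / K) / T)) := by
    rw [contractionRate, hq, mul_assoc (-10)]
  -- The left exponent is 4 S / T + 5/2, whereas the prefactor allows 10 S / T + 5/2.
  have hpre : Real.exp ((4 * (R * √((L + K) / K)) + 5 / 2 * T) / T) ≤
      contractionPrefactor K L R T := by
    have h0 : 0 ≤ R * √((L + K) / K) / T := div_nonneg P.S_nonneg P.T_pos.le
    have h1 : 4 * R / T * √((L + K) / K) = 4 * (R * √((L + K) / K) / T) := by ring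
    rw [contractionPrefactor, P.radius_div, h1]
    exact Real.exp_le_exp.2 (by linarith)
  have hnonneg : ∀ x y : Config n k, 0 ≤ profileDist T (R * √((L + K) / K)) x y := fun x y =>
    Finset.sum_nonneg fun i _ => profile_nonneg P.T_pos P.radius_nonneg (norm_nonneg _)
  have hT : (L + 4 * ε * L') * T ^ 2 ≤ 1 / 6 := by rw [mul_assoc 4]; exact P.ΛT
  have hc : 0 < contractionRate K L R T := by
    have := P.K_pos
    have := P.T_pos
    rw [contractionRate]
    positivity
  exact
    { symm := fun x y => by simp only [ell1, norm_sub_rev]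
      nonneg := fun x y => Finset.sum_nonneg fun _ _ => norm_nonneg _
      le_mul := fun x y => (P.ell1_le_profileDist x y).trans
        (mul_le_mul_of_nonneg_right hpre (hnonneg x y))
      le := P.profileDist_le_ell1
      C_nonneg := by positivity
      M_nonneg := (Real.exp_pos _).le
      θ_nonneg := (Real.exp_pos _).le
      θ_lt_one := Real.exp_lt_one_iff.2 (by linarith)
      reg := fun x y A hA => (le_abs_self _).trans
        (H.meanFieldKernel_sub_le hε hh hN hTN hT x y hA)
      contr := fun φ hφ hφ01 D hD hφD x y => by
        refine (H.integral_meanFieldKernel_sub_le P hε hh.le hTN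
          (strongly_convex_defect_le (norm_gradient_sub_le H.smoothV H.hessV) P.K_pos P.L_nonneg
            hconv) hφ (B := 1) (fun x => ?_) hD hφD x y).trans ?_
        · rw [abs_of_nonneg (hφ01 x).1]; exact (hφ01 x).2
        · refine mul_le_mul_of_nonneg_left (mul_le_mul_of_nonneg_right ?_ (hnonneg x y)) hD
          rw [← hrate]
          -- The contraction factor 1 - c is at most exp(-c).
          linarith [Real.add_one_le_exp (-contractionRate K L R T)] }

/-- Covers k = 0, where configurations form a single point and K ≤ L may fail. -/
theorem contractingKernel_of_subsingleton {E : Type*} [MeasurableSpace E] [Subsingleton E]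
    {π : Kernel E E} {d : E → E → ℝ} {C M θ : ℝ} (hd : ∀ x y, d x y = 0) (hC : 0 ≤ C) (hM : 0 ≤ M)
    (hθ : 0 ≤ θ) (hθ1 : θ < 1) : ContractingKernel π d d C M θ where
  symm x y := by rw [hd, hd]
  nonneg x y := (hd x y).ge
  le_mul x y := by simp [hd]
  le _ _ := le_rfl
  C_nonneg := hC
  M_nonneg := hM
  θ_nonneg := hθ
  θ_lt_one := hθ1
  reg x y A _ := by simp [Subsingleton.elim x y, hd]
  contr φ _ _ D _ _ x y := by simp [Subsingleton.elim x y, hd]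

theorem contractionParams_of_bounds {κ h₁ : ℝ} (hKL : K ≤ L) (hK : 0 < K) (hR : 0 ≤ R) (hT : 0 < T)
    (hh₁ : 0 ≤ h₁) (hκ : 0 ≤ κ) (hT1 : L * (T + h₁) ^ 2 * (10 * L) ≤ 3 / 5 * (3 * K))
    (hT2 : L * (T + h₁) ^ 2 ≤ 3 / 5 * (1 / 4))
    (hT3 : L * (T + h₁) ^ 2 * (256 * 5 * 2 ^ 6 * L * R ^ 2 * (L + K)) ≤ 3 / 5 * (3 * K))
    (hΛ : (L + 4 * κ) * T ^ 2 ≤ 1 / 6)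
    (hκ1 : κ ≤ 1 / 2 * (K / (36 * 149)) ^ 2 * (T + 8 * R * √((L + K) / K)) ^ 2 *
        Real.exp (-40 * (R / T) * √((L + K) / K))) :
    ContractionParams K L (R * √((L + K) / K)) T κ := by
  have hL : 0 < L := hK.trans_le hKL
  have hTT : L * T ^ 2 ≤ L * (T + h₁) ^ 2 := by gcongr; linarith
  refine ⟨hK, hT, by positivity, hκ, hKL, by linarith, ?_, ?_, hΛ, ?_⟩
  · have h1 := (mul_le_mul_of_nonneg_right hTT (show 0 ≤ 10 * L by positivity)).trans hT1
    linarith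
  · have h1 := (mul_le_mul_of_nonneg_right hTT
      (show 0 ≤ 256 * 5 * 2 ^ 6 * L * R ^ 2 * (L + K) by positivity)).trans hT3
    have hS : K * (R * √((L + K) / K)) ^ 2 = (L + K) * R ^ 2 := by
      rw [mul_pow, Real.sq_sqrt (by positivity)]
      field_simp
    -- After squaring, the constants match exactly: 9 / (5 · 256 · 5 · 2⁶) = (3/640)².
    refine abs_le_of_sq_le_sq' ?_ (by norm_num) |>.2
    refine le_of_mul_le_mul_left ?_ hK
    have h2 : K * (L * T * (R * √((L + K) / K))) ^ 2 =
        L ^ 2 * T ^ 2 * (K * (R * √((L + K) / K)) ^ 2) := by ring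
    rw [h2, hS]
    linarith
  · refine hκ1.trans (le_of_eq ?_)
    have h1 : -40 * (R / T) * √((L + K) / K) = -40 * (R * √((L + K) / K) / T) := by ring
    have h2 : 8 * R * √((L + K) / K) = 8 * (R * √((L + K) / K)) := by ring
    rw [h1, h2]

end MeanField

end UHMC

end

/-! ### The main theorem -/

theorem mainTheorem8 (k : ℕ) (V W : EuclideanSpace ℝ (Fin k) → ℝ)
    (hV : ContDiff ℝ 3 V) (hW : ContDiff ℝ 3 W)
    (hVmin : IsLocalMin V 0) (hV0 : V 0 = 0)
    (L L' LH LH' : ℝ)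
    (hL : IsLUB (Set.range fun x => ‖iteratedFDeriv ℝ 2 V x‖) L)
    (hL' : IsLUB (Set.range fun x => ‖iteratedFDeriv ℝ 2 W x‖) L')
    (hLH : IsLUB (Set.range fun x => ‖iteratedFDeriv ℝ 3 V x‖) LH)
    (hLH' : IsLUB (Set.range fun x => ‖iteratedFDeriv ℝ 3 W x‖) LH')
    (K R : ℝ) (hK : 0 < K) (hR : 0 ≤ R)
    (hconv : ∀ x y : EuclideanSpace ℝ (Fin k), R ≤ ‖x - y‖ →
      K * ‖x - y‖ ^ 2 ≤ inner ℝ (x - y) (gradient V x - gradient V y))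
    (T ε h₁ : ℝ) (hT : 0 < T) (hε : 0 ≤ ε)
    -- `L (T + h₁)² ≤ (3/5) min (3K/(10L), 1/4, 3K/(256·5·2⁶ L R² (L+K)))`,
    -- cleared of denominators (a quotient by zero would mean `+∞`)
    (hT1 : L * (T + h₁) ^ 2 * (10 * L) ≤ 3 / 5 * (3 * K))
    (hT2 : L * (T + h₁) ^ 2 ≤ 3 / 5 * (1 / 4))
    (hT3 : L * (T + h₁) ^ 2 * (256 * 5 * 2 ^ 6 * L * R ^ 2 * (L + K)) ≤ 3 / 5 * (3 * K))
    (hεL : |ε| * L' < min (K / 6)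
      (1 / 2 * (K / (36 * 149)) ^ 2 * (T + 8 * R * √((L + K) / K)) ^ 2 *
        Real.exp (-40 * (R / T) * √((L + K) / K))))
    (hh₁ : h₁ ≤ K * T / (525 * L + 235 * K))
    (h : ℝ) (N : ℕ) (hh : 0 < h) (hhh₁ : h ≤ h₁) (hTN : T = N * h)
    (hTh : (L + 4 * ε * L') * (T ^ 2 + T * h) ≤ 1 / 6) :
    -- the bound, for every number `n` of particles
    (∀ n : ℕ, 1 ≤ n → ∃ μ : Measure (UHMC.Config n k),
      (IsProbabilityMeasure μ ∧ (UHMC.meanFieldKernel V W ε h N n).Invariant μ) ∧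
      (∀ μ' : Measure (UHMC.Config n k), IsProbabilityMeasure μ' →
        (UHMC.meanFieldKernel V W ε h N n).Invariant μ' → μ' = μ) ∧
      ∀ tol : ℝ, 0 < tol → ∀ ν : Measure (UHMC.Config n k), IsProbabilityMeasure ν →
        ((UHMC.mixingTime (UHMC.meanFieldKernel V W ε h N n) μ tol ν : ℝ≥0∞) : EReal) ≤
          max 1 (2 + ((1 / UHMC.contractionRate K L R T : ℝ) : EReal) *
            ENNReal.log (ENNReal.ofReal
              (3 * √((T ^ 2)⁻¹ + 34 * k * (LH + 8 * ε * LH') ^ 2 * T ^ 4) *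
                UHMC.contractionPrefactor K L R T / (2 * tol)) *
              UHMC.wasserstein1 UHMC.ell1 μ ν))) ∧
    -- logarithmic dependence on `n` if the initial distance grows at most polynomially in `n`
    (∀ tol : ℝ, 0 < tol → ∀ (B : ℝ) (p : ℕ), ∃ C : ℝ, ∀ n : ℕ, 1 ≤ n →
      ∀ μ ν : Measure (UHMC.Config n k), IsProbabilityMeasure μ → IsProbabilityMeasure ν →
        (UHMC.meanFieldKernel V W ε h N n).Invariant μ →
        UHMC.wasserstein1 UHMC.ell1 μ ν ≤ ENNReal.ofReal (B * (n : ℝ) ^ p) →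
        ((UHMC.mixingTime (UHMC.meanFieldKernel V W ε h N n) μ tol ν : ℝ≥0∞) : EReal) ≤
          ((C * (1 + Real.log n) : ℝ) : EReal)) := by
  have H : UHMC.MeanFieldBounds V W L L' LH LH' :=
    ⟨hV, hW, fun x => hL.1 ⟨x, rfl⟩, fun x => hL'.1 ⟨x, rfl⟩, fun x => hLH.1 ⟨x, rfl⟩,
      fun x => hLH'.1 ⟨x, rfl⟩⟩
  have hN : 0 < N := by
    rcases Nat.eq_zero_or_pos N with rfl | hN
    · simp [hTN] at hT
    · exact hN
  have hκ : 0 ≤ ε * L' := mul_nonneg hε H.L'_nonneg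
  have hΛ : (L + 4 * ε * L') * T ^ 2 ≤ 1 / 6 := by
    have h0 : 0 ≤ L + 4 * ε * L' := by linarith [H.L_nonneg]
    have h1 := mul_le_mul_of_nonneg_left (show T ^ 2 ≤ T ^ 2 + T * h by
      linarith [mul_pos hT hh]) h0
    exact h1.trans hTh
  rw [abs_of_nonneg hε] at hεL
  set s := 3 / 2 * √((T ^ 2)⁻¹ + 34 * k * (LH + 8 * ε * LH') ^ 2 * T ^ 4) with hs
  set c := UHMC.contractionRate K L R T with hc
  set M := UHMC.contractionPrefactor K L R T with hM
  have hs0 : 0 < s := mul_pos (by norm_num) (Real.sqrt_pos.2 (by positivity))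
  have hc0 : 0 < c := mul_pos (by positivity) (Real.exp_pos _)
  have hM0 : 0 < M := Real.exp_pos _
  have := UHMC.isMarkovKernel_meanFieldKernel hV hW ε h N
  have hker : ∀ n, ∃ ρ, UHMC.ContractingKernel (UHMC.meanFieldKernel V W ε h N n) UHMC.ell1 ρ s M
      (Real.exp (-c)) := by
    intro n
    rcases subsingleton_or_nontrivial (EuclideanSpace ℝ (Fin k)) with hk | hk
    · have : Subsingleton (UHMC.Config n k) := (WithLp.equiv 2 _).subsingleton
      exact ⟨_, UHMC.contractingKernel_of_subsingleton
        (fun x y => by simp [UHMC.ell1, Subsingleton.elim x y]) hs0.le hM0.le (Real.exp_pos _).le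
        (Real.exp_lt_one_iff.2 (by linarith))⟩
    · have hKL : K ≤ L := UHMC.le_of_strongly_convex_outside
        (UHMC.norm_gradient_sub_le hV H.hessV) hR hconv
      have P := UHMC.contractionParams_of_bounds hKL hK hR hT (hh.le.trans hhh₁) hκ hT1 hT2 hT3
        (by rw [← mul_assoc]; exact hΛ) (hεL.le.trans (min_le_right _ _))
      exact ⟨_, H.exists_contractingKernel P hε hh hN hTN hconv n⟩
  refine ⟨fun n _ => ?_, fun tol htol B p => ?_⟩
  · obtain ⟨ρ, hρ⟩ := hker n
    obtain ⟨μ, hμ, hinv, hlim⟩ := hρ.exists_invariant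
      (H.integrable_ell1 hε hh.le (by rw [← hTN]; exact hΛ) 0)
    refine ⟨μ, ⟨hμ, hinv⟩, fun μ' hμ' hinv' => hρ.invariant_unique hlim hinv',
      fun tol htol ν hν => ?_⟩
    have h1 := hρ.mixingTime_le (ν := ν) hc0 (mul_pos hs0 hM0) hinv htol
    have h2 : 3 * √((T ^ 2)⁻¹ + 34 * k * (LH + 8 * ε * LH') ^ 2 * T ^ 4) * M / (2 * tol) =
        s * M / tol := by
      rw [hs]
      field_simp
    rwa [h2]
  -- Replacing B by max B 1 keeps the argument of the logarithm positive.
  · set b := s * M / tol * max B 1 with hb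
    have hb0 : 0 < b := mul_pos (by positivity) (lt_max_of_lt_right one_pos)
    -- The logarithm splits into log b + p log n; the 2 pays for rounding up and for the
    -- regularizing step.
    refine ⟨2 + 1 / c * (|Real.log b| + p), fun n hn μ ν hμ hν hinv hdist => ?_⟩
    obtain ⟨ρ, hρ⟩ := hker n
    have hn0 : (1 : ℝ) ≤ n := by exact_mod_cast hn
    have hlogn := Real.log_nonneg hn0
    have hnp : 0 < (n : ℝ) ^ p := by positivity
    refine (hρ.mixingTime_le_ceil hc0 hinv htol (w := max B 1 * (n : ℝ) ^ p) (by positivity)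
      (hdist.trans (ENNReal.ofReal_le_ofReal
        (mul_le_mul_of_nonneg_right (le_max_left _ _) hnp.le)))).trans (EReal.coe_le_coe_iff.2 ?_)
    rw [← mul_assoc, ← hb, Real.log_mul hb0.ne' hnp.ne', Real.log_pow]
    have h1 : 1 / c * (Real.log b + p * Real.log n) ≤
        1 / c * (|Real.log b| + p * Real.log n) := by
      gcongr
      exact le_abs_self _
    have h2 : 0 ≤ 1 / c * (|Real.log b| + p * Real.log n) := by positivity
    have h3 := (Nat.ceil_le_ceil h1)
    have h4 := Nat.ceil_lt_add_one h2
    have h5 : (⌈1 / c * (Real.log b + p * Real.log n)⌉₊ : ℝ) ≤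
        ⌈1 / c * (|Real.log b| + p * Real.log n)⌉₊ := by exact_mod_cast h3
    have h6 : 0 ≤ 1 / c * |Real.log b| * Real.log n := by positivity
    have h7 : 0 ≤ 1 / c * (p : ℝ) := by positivity
    linarith
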